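/- Let $d\geq 2$ be an integer and $\beta>d$ a real number. Let $\mathbb{L}$ be the space of affine lines of $\mathbb{R}^d$, let $\ell_0=\mathbb{R}\times\{0\}^{d-1}$, and let $\mu$ be the image of the product of the $(d-1)$-dimensional Lebesgue measure on $\ell_0^\perp=\{0\}\times\mathbb{R}^{d-1}$ and the Haar probability measure on $\mathbf{SO}(\mathbb{R}^d)$ under the map $(w,g)\mapsto g(w+\ell_0)$; here $\mathbb{L}$ carries the finest topology for which this map is continuous, and the corresponding Borel $\sigma$-algebra. Let $\Pi$ be a Poisson process on $\mathbb{L}\times\,]0,\infty[$ with intensity $c\cdot\mu\otimes v^{-\beta}\,\mathrm{d}v$, where $c=(\beta-1)/\upsilon_{d-1}$ and $\upsilon_{d-1}=\pi^{(d-1)/2}/\Gamma((d-1)/2+1)$ is the volume of the Euclidean unit ball of $\mathbb{R}^{d-1}$. For $x\in\mathbb{R}^d$ let $V(x)=\sup\{v:(\ell,v)\in\Pi,\ x\in\ell\}$, with $\sup\emptyset=0$. A $V$-path is a continuous path $\gamma:[0,\tau]\to\mathbb{R}^d$ such that $|\gamma(t_2)-\gamma(t_1)|\leq\int_{t_1}^{t_2}V(\gamma(t))\,\mathrm{d}t$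 for all $0\leq t_1\leq t_2\leq\tau$. For $x,y\in\mathbb{R}^d$ let $T(x,y)$ be the infimum of the $\tau>0$ for which there is a $V$-path $\gamma:[0,\tau]\to\mathbb{R}^d$ from $x$ to $y$. A geodesic $V$-path is a $V$-path $\gamma:[0,\tau]\to\mathbb{R}^d$ with $\tau=T(\gamma(0),\gamma(\tau))$. A geodesic of $(\mathbb{R}^d,T)$ is a path $\gamma:[0,\tau]\to\mathbb{R}^d$ such that $T(\gamma(t_1),\gamma(t_2))=|t_1-t_2|$ for all $t_1,t_2\in[0,\tau]$. A point $x$ is a $k^+$-star of $(\mathbb{R}^d,T)$ if there are $k$ geodesics $\gamma_i:[0,\tau_i]\to\mathbb{R}^d$ of $(\mathbb{R}^d,T)$ with $\tau_i>0$ and $\gamma_i(0)=x$ such that the sets $\gamma_i(]0,\tau_i])$ are pairwise disjoint. Write $\overline{B}(x,r)$ for the closed Euclidean ball. There exists an integer $m\geq 1$, depending only on $d$ and $\beta$, such that almost surely, for every $x\in\mathbb{R}^d$, the following holds: for each $\delta>0$, there exist $\eta\in\,]0,\delta[$ and a set $\mathcal{Z}\subset\overline{B}(x,\delta)\setminus\overline{B}(x,\eta)$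 of cardinality at most $m$ such that any geodesic $V$-path from a point inside $\overline{B}(x,\eta)$ to a point outside $\overline{B}(x,\delta)$ passes through some $z\in\mathcal{Z}$. In particular, almost surely, there are no $(m+1)^+$-stars in $(\mathbb{R}^d,T)$. -/

import Mathlib

open MeasureTheory ProbabilityTheory
open scoped ENNReal NNReal

namespace PoissonRoads

noncomputable section

/-! ### The space of affine lines and its invariant measure -/

/-- Euclidean `d`-space. -/
abbrev E (d : ℕ) : Type := EuclideanSpace ℝ (Fin d)

/-- The space of affine lines of `ℝ^d`: one-dimensional nonempty affine subspaces. -/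
structure Line (d : ℕ) : Type where
  /-- the underlying affine subspace -/
  carrier : AffineSubspace ℝ (E d)
  nonempty : (carrier : Set (E d)).Nonempty
  finrank_direction : Module.finrank ℝ carrier.direction = 1

/-- The group `SO(ℝ^d)`. -/
abbrev SO (d : ℕ) : Type := Matrix.specialOrthogonalGroup (Fin d) ℝ

instance instIsTopologicalGroupSO (d : ℕ) : IsTopologicalGroup (SO d) where
  continuous_mul := continuous_mul
  continuous_inv := continuous_induced_rng.mpr <| by
    have h : Continuous fun g : SO d => (g : Matrix (Fin d) (Fin d) ℝ).transpose :=
      continuous_subtype_val.matrix_transpose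
    exact h

theorem SO.mul_transpose {d : ℕ} (g : SO d) :
    (g : Matrix (Fin d) (Fin d) ℝ) * (g : Matrix (Fin d) (Fin d) ℝ).transpose = 1 :=
  Matrix.mem_orthogonalGroup_iff (Fin d) ℝ |>.1 (Matrix.mem_specialOrthogonalGroup_iff.1 g.2).1

theorem SO.transpose_mul {d : ℕ} (g : SO d) :
    (g : Matrix (Fin d) (Fin d) ℝ).transpose * (g : Matrix (Fin d) (Fin d) ℝ) = 1 :=
  Matrix.mem_orthogonalGroup_iff' (Fin d) ℝ |>.1 (Matrix.mem_specialOrthogonalGroup_iff.1 g.2).1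

instance instCompactSpaceSO (d : ℕ) : CompactSpace (SO d) := by
  have hset : ((Matrix.specialOrthogonalGroup (Fin d) ℝ : Set (Matrix (Fin d) (Fin d) ℝ))) =
      {A | A * A.transpose = 1 ∧ A.det = 1} := by
    ext A
    exact Matrix.mem_specialOrthogonalGroup_iff.trans
      (and_congr_left fun _ => Matrix.mem_orthogonalGroup_iff (Fin d) ℝ)
  have hclosed : IsClosed {A : Matrix (Fin d) (Fin d) ℝ | A * A.transpose = 1 ∧ A.det = 1} :=
    (isClosed_eq (continuous_id.matrix_mul continuous_id.matrix_transpose)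
      continuous_const).inter (isClosed_eq continuous_id.matrix_det continuous_const)
  have hbox : IsCompact (Set.univ.pi fun _ : Fin d =>
      Set.univ.pi fun _ : Fin d => Set.Icc (-1 : ℝ) 1) :=
    isCompact_univ_pi fun _ => isCompact_univ_pi fun _ => isCompact_Icc
  refine isCompact_iff_compactSpace.1 ?_
  rw [hset]
  refine IsCompact.of_isClosed_subset hbox hclosed ?_
  rintro A ⟨hA, -⟩ i - j -
  have h1 : ∑ k, A i k * A i k = 1 := by
    have := congrFun (congrFun hA i) i
    simpa [Matrix.mul_apply] using this
  have h2 : A i j * A i j ≤ 1 := by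
    rw [← h1]
    exact Finset.single_le_sum (f := fun k => A i k * A i k)
      (fun k _ => mul_self_nonneg _) (Finset.mem_univ j)
  exact abs_le.1 (abs_le_one_iff_mul_self_le_one.2 h2)

instance instMeasurableSpaceSO (d : ℕ) : MeasurableSpace (SO d) := borel _

instance instBorelSpaceSO (d : ℕ) : BorelSpace (SO d) := ⟨rfl⟩

/-- The Haar probability measure on `SO(ℝ^d)`. -/
def haarSO (d : ℕ) : Measure (SO d) := Measure.haarMeasure ⊤

/-- The isometry `g` of `ℝ^d` given by a matrix `g ∈ SO(ℝ^d)`. -/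
def rot {d : ℕ} (g : SO d) (x : E d) : E d :=
  WithLp.toLp 2 ((g : Matrix (Fin d) (Fin d) ℝ).mulVec x.ofLp)

/-- The first vector `(1, 0, …, 0)` of the standard basis. -/
def e₁ (d : ℕ) : E d := WithLp.toLp 2 fun i => if i.val = 0 then 1 else 0

/-- The identification of `ℝ^(d-1)` with the hyperplane `{0} × ℝ^(d-1)` of `ℝ^d`. -/
def inHyperplane {d : ℕ} (w : Fin (d - 1) → ℝ) : E d :=
  WithLp.toLp 2 fun i => if h : i.val = 0 then 0 else w ⟨i.val - 1, by omega⟩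

theorem rot_e₁_ne_zero {d : ℕ} (hd : d ≠ 0) (g : SO d) : rot g (e₁ d) ≠ 0 := by
  intro h
  have h1 : (g : Matrix (Fin d) (Fin d) ℝ).mulVec (e₁ d).ofLp = 0 :=
    congrArg WithLp.ofLp h
  have h2 : (e₁ d).ofLp = 0 := by
    have := congrArg ((g : Matrix (Fin d) (Fin d) ℝ).transpose.mulVec) h1
    rwa [Matrix.mulVec_mulVec, SO.transpose_mul, Matrix.one_mulVec, Matrix.mulVec_zero] at this
  have h3 := congrFun h2 ⟨0, Nat.pos_of_ne_zero hd⟩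
  simp [e₁] at h3

/-- The map `(w, g) ↦ g (w + ℓ₀)`, where `ℓ₀` is the line spanned by `(1, 0, …, 0)` and `w` ranges
over the hyperplane orthogonal to it: `g (w + ℓ₀)` is the line through `g w` directed by `g e₁`. -/
def lineMap (d : ℕ) [NeZero d] (p : (Fin (d - 1) → ℝ) × SO d) : Line d where
  carrier := AffineSubspace.mk' (rot p.2 (inHyperplane p.1)) (Submodule.span ℝ {rot p.2 (e₁ d)})
  nonempty := ⟨_, AffineSubspace.self_mem_mk' _ _⟩
  finrank_direction := by
    rw [AffineSubspace.direction_mk']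
    exact finrank_span_singleton (rot_e₁_ne_zero (NeZero.ne d) p.2)

/-- The finest topology on the space of lines for which `lineMap` is continuous. -/
instance instTopologicalSpaceLine (d : ℕ) [NeZero d] : TopologicalSpace (Line d) :=
  TopologicalSpace.coinduced (lineMap d) inferInstance

instance instMeasurableSpaceLine (d : ℕ) [NeZero d] : MeasurableSpace (Line d) := borel _

instance instBorelSpaceLine (d : ℕ) [NeZero d] : BorelSpace (Line d) := ⟨rfl⟩

/-- The invariant measure `μ` on the space of lines: the image under `lineMap` of the product of
Lebesgue measure on the hyperplane and the Haar probability measure on `SO(ℝ^d)`. -/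
def lineMeasure (d : ℕ) [NeZero d] : Measure (Line d) :=
  Measure.map (lineMap d) ((volume : Measure (Fin (d - 1) → ℝ)).prod (haarSO d))

/-! ### The Poisson process of roads -/

/-- A road is a pair `(ℓ, v)` of a line and a speed limit `v > 0`. -/
abbrev Road (d : ℕ) : Type := Line d × Set.Ioi (0 : ℝ)

/-- The volume `π^(s/2) / Γ(s/2 + 1)` of the Euclidean unit ball of `ℝ^s`. -/
def unitBallVolume (s : ℕ) : ℝ := Real.pi ^ ((s : ℝ) / 2) / Real.Gamma ((s : ℝ) / 2 + 1)

/-- The measure `v^(-β) dv` on `(0, ∞)`. -/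
def speedMeasure (β : ℝ) : Measure (Set.Ioi (0 : ℝ)) :=
  (Measure.comap Subtype.val (volume : Measure ℝ)).withDensity fun v : Set.Ioi (0 : ℝ) =>
    ENNReal.ofReal ((v : ℝ) ^ (-β))

/-- The intensity measure `ν = c · μ ⊗ v^(-β) dv`, where `c = (β - 1) / υ_(d-1)`. -/
def intensity (d : ℕ) [NeZero d] (β : ℝ) : Measure (Road d) :=
  ENNReal.ofReal ((unitBallVolume (d - 1))⁻¹ * (β - 1)) •
    ((lineMeasure d).prod (speedMeasure β))

/-- `S` is a Poisson process with intensity `ν`, seen as the random set of its atoms (for a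
diffuse `ν`, the atoms of a Poisson process are almost surely simple): the number of points in a
measurable set `B` is a random variable, it has the Poisson distribution with parameter `ν B` if
`ν B < ∞`, and the numbers of points in pairwise disjoint measurable sets are independent. -/
structure IsPoissonProcess {Ω X : Type*} [MeasurableSpace Ω] [MeasurableSpace X]
    (P : Measure Ω) (ν : Measure X) (S : Ω → Set X) : Prop where
  measurable_encard : ∀ B : Set X, MeasurableSet B → Measurable fun ω => (S ω ∩ B).encard
  map_encard : ∀ B : Set X, MeasurableSet B → ν B ≠ ∞ →
    P.map (fun ω => (S ω ∩ B).encard) =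
      (poissonMeasure (ν B).toNNReal).map (fun n : ℕ => (n : ℕ∞))
  indep : ∀ (n : ℕ) (B : Fin n → Set X), (∀ i, MeasurableSet (B i)) →
    Pairwise (fun i j => Disjoint (B i) (B j)) →
    iIndepFun (fun i ω => (S ω ∩ B i).encard) P

/-! ### The driving time metric of a set of roads -/

/-- The speed limit `V(x)`: the supremum of the speed limits of the roads that pass through `x`,
`0` if there are none. -/
def speedLimit {d : ℕ} (R : Set (Road d)) (x : E d) : ℝ≥0∞ :=
  ⨆ r ∈ R, ⨆ _ : x ∈ r.1.carrier, ENNReal.ofReal (r.2 : ℝ)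

/-- `γ : [0, τ] → ℝ^d` is a `V`-path: it is continuous and respects the speed limits. (Only the
restriction of `γ` to `[0, τ]` matters.) -/
def IsVPath {d : ℕ} (R : Set (Road d)) (τ : ℝ) (γ : ℝ → E d) : Prop :=
  0 ≤ τ ∧ ContinuousOn γ (Set.Icc 0 τ) ∧
    ∀ t₁ ∈ Set.Icc 0 τ, ∀ t₂ ∈ Set.Icc 0 τ, t₁ ≤ t₂ →
      edist (γ t₁) (γ t₂) ≤ ∫⁻ t in Set.Icc t₁ t₂, speedLimit R (γ t)

/-- The driving time `T(x, y)`: the infimum of the `τ > 0` such that there is a `V`-path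
`γ : [0, τ] → ℝ^d` from `x` to `y`. -/
def drivingTime {d : ℕ} (R : Set (Road d)) (x y : E d) : ℝ≥0∞ :=
  ⨅ (τ : ℝ) (_ : 0 < τ ∧ ∃ γ : ℝ → E d, IsVPath R τ γ ∧ γ 0 = x ∧ γ τ = y), ENNReal.ofReal τ

/-- A geodesic `V`-path: a `V`-path whose driving time is the distance between its endpoints. -/
def IsGeodesicVPath {d : ℕ} (R : Set (Road d)) (τ : ℝ) (γ : ℝ → E d) : Prop :=
  IsVPath R τ γ ∧ drivingTime R (γ 0) (γ τ) = ENNReal.ofReal τ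

/-- The property `P(x)`, with bound `m` on the cardinality of cut sets: for every `δ > 0` there are
`0 < η < δ` and at most `m` points of `B̄(x, δ) ∖ B̄(x, η)` such that every geodesic `V`-path from a
point of `B̄(x, η)` to a point outside `B̄(x, δ)` passes through one of them. -/
def HasSmallCutSets {d : ℕ} (R : Set (Road d)) (m : ℕ) (x : E d) : Prop :=
  ∀ δ : ℝ, 0 < δ → ∃ η : ℝ, 0 < η ∧ η < δ ∧ ∃ Z : Finset (E d),
    (Z : Set (E d)) ⊆ Metric.closedBall x δ \ Metric.closedBall x η ∧ Z.card ≤ m ∧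
    ∀ (τ : ℝ) (γ : ℝ → E d), IsGeodesicVPath R τ γ →
      γ 0 ∈ Metric.closedBall x η → γ τ ∉ Metric.closedBall x δ →
      ∃ z ∈ Z, ∃ t ∈ Set.Icc 0 τ, γ t = z

/-- `γ : [0, τ] → ℝ^d` is a geodesic of the metric space `(ℝ^d, T)`. -/
def IsMetricGeodesic {d : ℕ} (R : Set (Road d)) (τ : ℝ) (γ : ℝ → E d) : Prop :=
  0 ≤ τ ∧ ∀ t₁ ∈ Set.Icc 0 τ, ∀ t₂ ∈ Set.Icc 0 τ,
    drivingTime R (γ t₁) (γ t₂) = ENNReal.ofReal |t₁ - t₂|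

/-- `x` is a `k⁺`-star of `(ℝ^d, T)`: there are `k` nontrivial geodesics emanating from `x` which
are disjoint apart from their common starting point `x`. -/
def IsPlusStar {d : ℕ} (R : Set (Road d)) (k : ℕ) (x : E d) : Prop :=
  ∃ (τ : Fin k → ℝ) (γ : Fin k → ℝ → E d),
    (∀ i, 0 < τ i ∧ IsMetricGeodesic R (τ i) (γ i) ∧ γ i 0 = x) ∧
    Pairwise fun i j => Disjoint (γ i '' Set.Ioc 0 (τ i)) (γ j '' Set.Ioc 0 (τ j))

end

end PoissonRoads

/-! A deterministic argument produces the cut set at a good scale r around a point x. Suppose that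
any two points of the ball B(x, 2r) are joined in time at most D, that at most M roads of speed at
least v meet this ball, and that vD ≤ r/4. A geodesic that crosses the annulus between radii r and
2r does so in time at most D, hence moves by at most r/4 off the M fast roads, and must follow one
of them over a long stretch. Between its first and last visits to the fastest of these roads a
geodesic runs straight along that road; induction on the number of roads
(`IsGeodesicVPath.dist_le_of_short`) bounds the number of such stretches by 2^M. So points placed on
each fast road at spacing r/2^(M+1) meet every crossing geodesic (`exists_cutSet`).

Good scales come from scale invariance. Take q = 1/b and σ with σ^(1-β) q^(d-1) = 1: the mean number
of roads of speed at least σ^k that meet a ball of radius q^k is then bounded above and below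
uniformly in k, and β > d allows 16q ≤ σ. Points at distance of order q^k are joined hierarchically:
a road of speed of order σ^k passes near both ends, and the two remaining gaps, of order q^(k+1),
are filled in the same way. The durations form a convergent series of order (q/σ)^k
(`reach_add_of_connects`). The bottom of the hierarchy uses a fictitious extra speed η, removed by
compactness and upper semicontinuity of V (`Reach.of_tendsto`).

A given scale is bad with positive probability, so uniformity in x comes from many scales. For fixed
z, the scales n, …, 2n-1 are all bad with probability at most 3(2ε)^n, where ε is as small as
desired (`measure_forall_not_goodScale_le`): missing connections are controlled by void
probabilities of disjoint sets of roads, crowded scales by a Chernoff bound in which a road is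
weighted by the number of scales at which it counts as fast. This beats the number of points, of
order b^(2nd), of a grid of mesh of order q^(2n). By Borel–Cantelli every grid point has a good
scale, and every x is close enough to a grid point to inherit it.

Stars are excluded by the pigeonhole principle, since disjoint geodesics from x need distinct cut
points (`not_isPlusStar`). -/

namespace PoissonRoads

open Filter Topology Set

/-! ### Locally finite sets of roads -/

section Roads

variable {d : ℕ}

/-- The lines that meet the closed ball of centre `p` and radius `ϱ`. -/
def hits (p : E d) (ϱ : ℝ) : Set (Line d) := {ℓ | ∃ y ∈ ℓ.carrier, dist y p ≤ ϱ}

/-- The roads of `R` of speed limit at least `v` that meet a closed ball. -/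
def fastRoads (R : Set (Road d)) (v : ℝ) (p : E d) (ϱ : ℝ) : Set (Road d) :=
  {r | r ∈ R ∧ v ≤ (r.2 : ℝ) ∧ r.1 ∈ hits p ϱ}

/-- Only finitely many roads with speed limits bounded below meet a given ball. -/
def IsLocallyFinite (R : Set (Road d)) : Prop :=
  ∀ n : ℕ, (fastRoads R ((n : ℝ) + 1)⁻¹ 0 n).Finite

theorem hits_mono {p q : E d} {ϱ ϱ' : ℝ} (h : dist p q + ϱ ≤ ϱ') : hits p ϱ ⊆ hits q ϱ' := by
  rintro ℓ ⟨y, hy, hyp⟩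
  refine ⟨y, hy, ?_⟩
  linarith [dist_triangle y p q]

theorem fastRoads_mono {R : Set (Road d)} {v v' : ℝ} {p q : E d} {ϱ ϱ' : ℝ} (hv : v' ≤ v)
    (h : dist p q + ϱ ≤ ϱ') : fastRoads R v p ϱ ⊆ fastRoads R v' q ϱ' :=
  fun _ hr => ⟨hr.1, hv.trans hr.2.1, hits_mono h hr.2.2⟩

theorem IsLocallyFinite.finite {R : Set (Road d)} (hR : IsLocallyFinite R) {v : ℝ} (hv : 0 < v)
    (p : E d) (ϱ : ℝ) : (fastRoads R v p ϱ).Finite := by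
  obtain ⟨n, hn⟩ := exists_nat_ge (max (dist p 0 + ϱ) v⁻¹)
  refine (hR n).subset (fastRoads_mono ?_ ((le_max_left _ _).trans hn))
  have h1 : v⁻¹ ≤ (n : ℝ) + 1 := by linarith [(le_max_right (dist p 0 + ϱ) v⁻¹).trans hn]
  exact inv_le_of_inv_le₀ hv h1

theorem IsLocallyFinite.countable {R : Set (Road d)} (hR : IsLocallyFinite R) : R.Countable := by
  have : R ⊆ ⋃ n : ℕ, fastRoads R ((n : ℝ) + 1)⁻¹ 0 n := by
    intro r hr
    obtain ⟨y, hy⟩ := r.1.nonempty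
    have hv : (0 : ℝ) < r.2 := r.2.2
    obtain ⟨n, hn⟩ := exists_nat_ge (max (dist y 0) (r.2 : ℝ)⁻¹)
    refine mem_iUnion.2 ⟨n, hr, ?_, y, hy, (le_max_left _ _).trans hn⟩
    have h1 : (r.2 : ℝ)⁻¹ ≤ (n : ℝ) + 1 := by
      linarith [(le_max_right (dist y 0) (r.2 : ℝ)⁻¹).trans hn]
    exact inv_le_of_inv_le₀ hv h1
  exact (countable_iUnion fun n => (hR n).countable).mono this

theorem Line.isClosed (ℓ : Line d) : IsClosed (ℓ.carrier : Set (E d)) :=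
  AffineSubspace.closed_of_finiteDimensional _

theorem measurable_speedLimit {R : Set (Road d)} (hR : IsLocallyFinite R) :
    Measurable (speedLimit R) := by
  refine Measurable.biSup _ hR.countable fun r _ => ?_
  have : (fun x : E d => ⨆ _ : x ∈ r.1.carrier, ENNReal.ofReal (r.2 : ℝ)) =
      (r.1.carrier : Set (E d)).indicator fun _ => ENNReal.ofReal (r.2 : ℝ) := by
    ext x
    by_cases hx : x ∈ r.1.carrier
    · simp [hx]
    · simp [hx]
  rw [this]
  exact measurable_const.indicator r.1.isClosed.measurableSet

theorem le_speedLimit {R : Set (Road d)} {r : Road d} (hr : r ∈ R) {x : E d}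
    (hx : x ∈ r.1.carrier) : ENNReal.ofReal (r.2 : ℝ) ≤ speedLimit R x :=
  le_iSup₂_of_le r hr (le_iSup_of_le hx le_rfl)

theorem speedLimit_le {R : Set (Road d)} {x : E d} {c : ℝ}
    (h : ∀ r ∈ R, x ∈ r.1.carrier → (r.2 : ℝ) ≤ c) : speedLimit R x ≤ ENNReal.ofReal c :=
  iSup₂_le fun r hr => iSup_le fun hx => ENNReal.ofReal_le_ofReal (h r hr hx)

theorem IsLocallyFinite.exists_bound {R : Set (Road d)} (hR : IsLocallyFinite R) (p : E d)
    (ϱ : ℝ) : ∃ L : ℝ, 0 < L ∧ ∀ y ∈ Metric.closedBall p ϱ,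
      speedLimit R y ≤ ENNReal.ofReal L := by
  obtain ⟨L, hL⟩ := ((hR.finite one_pos p ϱ).image fun r => (r.2 : ℝ)).bddAbove
  refine ⟨max L 1, by positivity, fun y hy => speedLimit_le fun r hr hry => ?_⟩
  by_cases h1 : 1 ≤ (r.2 : ℝ)
  · exact (hL ⟨r, ⟨hr, h1, y, hry, hy⟩, rfl⟩).trans (le_max_left _ _)
  · exact (not_le.1 h1).le.trans (le_max_right _ _)

/-- Finitely many roads of speed at least `c'` > V(y) meet a ball around `y`; they are closed and
avoid `y`, hence avoid a neighbourhood of `y`. This is what lets limits of paths respect the speed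
limits. -/
theorem IsLocallyFinite.upperSemicontinuous {R : Set (Road d)} (hR : IsLocallyFinite R) :
    UpperSemicontinuous (speedLimit R) := by
  intro y c hc
  obtain ⟨c', hyc', hc'⟩ := ENNReal.lt_iff_exists_nnreal_btwn.1 hc
  have hpos : (0 : ℝ) < c' := by
    have : (0 : ℝ≥0∞) < c' := (zero_le).trans_lt hyc'
    exact_mod_cast this
  have hfin := hR.finite hpos y 1
  have hopen : ∀ᶠ y' in 𝓝 y, ∀ r ∈ fastRoads R c' y 1, y' ∉ r.1.carrier := by
    refine (eventually_all_finite hfin).2 fun r hr => ?_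
    refine r.1.isClosed.isOpen_compl.mem_nhds fun hy => ?_
    have h1 := le_speedLimit hr.1 hy
    have h2 : (c' : ℝ≥0∞) ≤ ENNReal.ofReal (r.2 : ℝ) := by
      rw [← ENNReal.ofReal_coe_nnreal]
      exact ENNReal.ofReal_le_ofReal hr.2.1
    exact absurd (h2.trans h1) (not_le.2 hyc')
  filter_upwards [hopen, Metric.closedBall_mem_nhds y one_pos] with y' h1 h2
  refine lt_of_le_of_lt ?_ hc'
  rw [← ENNReal.ofReal_coe_nnreal]
  refine speedLimit_le fun r hr hry => ?_
  by_contra hlt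
  exact h1 r ⟨hr, (not_le.1 hlt).le, y', hry, h2⟩ hry

end Roads

/-! ### Paths that respect a field of speed limits -/

section Paths

variable {d : ℕ}

/-- `γ : [0, τ] → ℝ^d` is continuous and respects the speed limits given by `W`. -/
def IsFieldPath (W : E d → ℝ≥0∞) (τ : ℝ) (γ : ℝ → E d) : Prop :=
  0 ≤ τ ∧ ContinuousOn γ (Icc 0 τ) ∧
    ∀ t₁ ∈ Icc 0 τ, ∀ t₂ ∈ Icc 0 τ, t₁ ≤ t₂ →
      edist (γ t₁) (γ t₂) ≤ ∫⁻ t in Icc t₁ t₂, W (γ t)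

/-- One can drive from `x` to `y` in time exactly `τ`, under the speed limits `W`. -/
def Reach (W : E d → ℝ≥0∞) (τ : ℝ) (x y : E d) : Prop :=
  ∃ γ : ℝ → E d, IsFieldPath W τ γ ∧ γ 0 = x ∧ γ τ = y

theorem Reach.nonneg {W : E d → ℝ≥0∞} {τ : ℝ} {x y : E d} (h : Reach W τ x y) : 0 ≤ τ := by
  obtain ⟨γ, h, -⟩ := h
  exact h.1

theorem lintegral_Icc_shift (f : ℝ → ℝ≥0∞) (a b s : ℝ) :
    ∫⁻ t in Icc a b, f (t + s) = ∫⁻ t in Icc (a + s) (b + s), f t := by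
  have h := (measurePreserving_add_right volume s).setLIntegral_comp_preimage_emb
    (measurableEmbedding_addRight s) f (Icc (a + s) (b + s))
  rw [← h]
  simp

theorem lintegral_Icc_split (f : ℝ → ℝ≥0∞) {a b c : ℝ} (hab : a ≤ b) (hbc : b ≤ c) :
    ∫⁻ t in Icc a c, f t = (∫⁻ t in Icc a b, f t) + ∫⁻ t in Icc b c, f t := by
  rw [← Icc_union_Ioc_eq_Icc hab hbc, lintegral_union measurableSet_Ioc,
    restrict_Ioc_eq_restrict_Icc]
  exact disjoint_left.2 fun x hx hx' => (not_le.2 hx'.1) hx.2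

theorem lintegral_Icc_congr {f g : ℝ → ℝ≥0∞} {a b : ℝ} (h : ∀ t ∈ Ioo a b, f t = g t) :
    ∫⁻ t in Icc a b, f t = ∫⁻ t in Icc a b, g t := by
  rw [← restrict_Ioo_eq_restrict_Icc]
  exact setLIntegral_congr_fun measurableSet_Ioo h

theorem lintegral_Icc_le_of_le {f : ℝ → ℝ≥0∞} {a b : ℝ} {c : ℝ} (hc : 0 ≤ c)
    (h : ∀ t ∈ Ioo a b, f t ≤ ENNReal.ofReal c) :
    ∫⁻ t in Icc a b, f t ≤ ENNReal.ofReal (c * (b - a)) := by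
  rw [← restrict_Ioo_eq_restrict_Icc]
  calc ∫⁻ t in Ioo a b, f t ≤ ∫⁻ _ in Ioo a b, ENNReal.ofReal c :=
        setLIntegral_mono' measurableSet_Ioo h
    _ = ENNReal.ofReal (c * (b - a)) := by
        rw [setLIntegral_const, Real.volume_Ioo, ENNReal.ofReal_mul hc]

theorem IsFieldPath.dist_le {W : E d → ℝ≥0∞} {τ : ℝ} {γ : ℝ → E d} (h : IsFieldPath W τ γ)
    {s t c : ℝ} (hs : 0 ≤ s) (hst : s ≤ t) (ht : t ≤ τ) (hc : 0 ≤ c)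
    (hW : ∀ u ∈ Ioo s t, W (γ u) ≤ ENNReal.ofReal c) : dist (γ s) (γ t) ≤ c * (t - s) := by
  have h1 := (h.2.2 s ⟨hs, hst.trans ht⟩ t ⟨hs.trans hst, ht⟩ hst).trans
    (lintegral_Icc_le_of_le hc hW)
  rw [edist_dist] at h1
  exact (ENNReal.ofReal_le_ofReal_iff (mul_nonneg hc (sub_nonneg.2 hst))).1 h1

theorem IsFieldPath.shift {W : E d → ℝ≥0∞} {τ : ℝ} {γ : ℝ → E d} (h : IsFieldPath W τ γ)
    {s t : ℝ} (hs : 0 ≤ s) (hst : s ≤ t) (ht : t ≤ τ) :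
    IsFieldPath W (t - s) fun u => γ (u + s) := by
  have hmem : ∀ u ∈ Icc 0 (t - s), u + s ∈ Icc 0 τ := fun u hu =>
    ⟨by linarith [hu.1], by linarith [hu.2]⟩
  refine ⟨sub_nonneg.2 hst, h.2.1.comp (by fun_prop) hmem, fun t₁ h1 t₂ h2 h12 => ?_⟩
  refine (h.2.2 _ (hmem t₁ h1) _ (hmem t₂ h2) (by linarith)).trans_eq ?_
  exact (lintegral_Icc_shift (fun u => W (γ u)) t₁ t₂ s).symm

theorem IsFieldPath.reach {W : E d → ℝ≥0∞} {τ : ℝ} {γ : ℝ → E d} (h : IsFieldPath W τ γ)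
    {s t : ℝ} (hs : 0 ≤ s) (hst : s ≤ t) (ht : t ≤ τ) : Reach W (t - s) (γ s) (γ t) :=
  ⟨_, h.shift hs hst ht, by simp, by simp⟩

theorem Reach.refl (W : E d → ℝ≥0∞) {τ : ℝ} (hτ : 0 ≤ τ) (x : E d) : Reach W τ x x :=
  ⟨fun _ => x, ⟨hτ, continuousOn_const, by simp⟩, rfl, rfl⟩

theorem IsFieldPath.concat {W : E d → ℝ≥0∞} {σ τ : ℝ} {γ ζ : ℝ → E d} (h : IsFieldPath W σ γ)
    (h' : IsFieldPath W τ ζ) (hγζ : γ σ = ζ 0) :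
    IsFieldPath W (σ + τ) fun t => if t ≤ σ then γ t else ζ (t - σ) := by
  set ξ : ℝ → E d := fun t => if t ≤ σ then γ t else ζ (t - σ) with hξ
  have hξ1 : ∀ t ≤ σ, ξ t = γ t := fun t ht => if_pos ht
  have hξ2 : ∀ t, σ ≤ t → ξ t = ζ (t - σ) := by
    intro t ht
    rcases ht.eq_or_lt with rfl | ht
    · rw [hξ1 _ le_rfl, hγζ, sub_self]
    · exact if_neg (not_le.2 ht)
  have key1 : ∀ t₁ t₂, 0 ≤ t₁ → t₁ ≤ t₂ → t₂ ≤ σ →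
      edist (ξ t₁) (ξ t₂) ≤ ∫⁻ t in Icc t₁ t₂, W (ξ t) := by
    intro t₁ t₂ h1 h12 h2
    rw [hξ1 _ (h12.trans h2), hξ1 _ h2]
    refine (h.2.2 t₁ ⟨h1, h12.trans h2⟩ t₂ ⟨h1.trans h12, h2⟩ h12).trans_eq ?_
    exact lintegral_Icc_congr fun t ht => by rw [hξ1 _ (ht.2.le.trans h2)]
  have key2 : ∀ t₁ t₂, σ ≤ t₁ → t₁ ≤ t₂ → t₂ ≤ σ + τ →
      edist (ξ t₁) (ξ t₂) ≤ ∫⁻ t in Icc t₁ t₂, W (ξ t) := by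
    intro t₁ t₂ h1 h12 h2
    rw [hξ2 _ h1, hξ2 _ (h1.trans h12)]
    refine (h'.2.2 (t₁ - σ) ⟨by linarith, by linarith⟩ (t₂ - σ) ⟨by linarith, by linarith⟩
      (by linarith)).trans_eq ?_
    have := lintegral_Icc_shift (fun t => W (ξ t)) (t₁ - σ) (t₂ - σ) σ
    rw [sub_add_cancel, sub_add_cancel] at this
    rw [← this]
    refine lintegral_Icc_congr fun t ht => ?_
    rw [hξ2 (t + σ) (by linarith [ht.1]), add_sub_cancel_right]
  refine ⟨add_nonneg h.1 h'.1, ?_, fun t₁ h1 t₂ h2 h12 => ?_⟩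
  · have hu : Icc 0 (σ + τ) = Icc 0 σ ∪ Icc σ (σ + τ) :=
      (Icc_union_Icc_eq_Icc h.1 (by linarith [h'.1])).symm
    rw [hu]
    refine ContinuousOn.union_of_isClosed ?_ ?_ isClosed_Icc isClosed_Icc
    · exact h.2.1.congr fun t ht => hξ1 t ht.2
    · refine ContinuousOn.congr (f := fun t => ζ (t - σ)) ?_ fun t ht => hξ2 t ht.1
      exact h'.2.1.comp (by fun_prop) fun t ht => ⟨by linarith [ht.1], by linarith [ht.2]⟩
  · rcases le_total t₂ σ with h2' | h2'
    · exact key1 _ _ h1.1 h12 h2'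
    · rcases le_total σ t₁ with h1' | h1'
      · exact key2 _ _ h1' h12 h2.2
      · rw [lintegral_Icc_split _ h1' h2']
        exact (edist_triangle _ (ξ σ) _).trans
          (add_le_add (key1 _ _ h1.1 h1' le_rfl) (key2 _ _ le_rfl h2' h2.2))

theorem Reach.trans {W : E d → ℝ≥0∞} {σ τ : ℝ} {x y z : E d} (h : Reach W σ x y)
    (h' : Reach W τ y z) : Reach W (σ + τ) x z := by
  obtain ⟨γ, hγ, rfl, rfl⟩ := h
  obtain ⟨ζ, hζ, h0, rfl⟩ := h'
  refine ⟨_, hγ.concat hζ h0.symm, if_pos hγ.1, ?_⟩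
  rcases hζ.1.eq_or_lt with h | h
  · simp [← h, h0]
  · simp [h]

theorem Reach.mono {W : E d → ℝ≥0∞} {σ τ : ℝ} {x y : E d} (h : Reach W σ x y) (hστ : σ ≤ τ) :
    Reach W τ x y := by
  have := h.trans (Reach.refl W (sub_nonneg.2 hστ) y)
  rwa [add_sub_cancel] at this

theorem Reach.of_segment {W : E d → ℝ≥0∞} {τ v : ℝ} {x y : E d} (hτ : 0 ≤ τ) (hv : 0 ≤ v)
    (hW : ∀ p ∈ segment ℝ x y, ENNReal.ofReal v ≤ W p) (hxy : dist x y ≤ v * τ) :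
    Reach W τ x y := by
  rcases hτ.eq_or_lt with rfl | hτ
  · have : x = y := dist_le_zero.1 (by simpa using hxy)
    exact this ▸ Reach.refl W le_rfl x
  refine ⟨fun t => AffineMap.lineMap x y (t / τ), ⟨hτ.le, ?_, ?_⟩, by simp, by simp [hτ.ne']⟩
  · exact (AffineMap.lineMap_continuous.comp (by fun_prop)).continuousOn
  · intro t₁ h1 t₂ h2 h12
    calc edist (AffineMap.lineMap x y (t₁ / τ) : E d) (AffineMap.lineMap x y (t₂ / τ))
        ≤ ENNReal.ofReal (v * (t₂ - t₁)) := by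
          rw [edist_dist, dist_lineMap_lineMap]
          refine ENNReal.ofReal_le_ofReal ?_
          rw [dist_comm, Real.dist_eq, ← sub_div, abs_of_nonneg (by
            apply div_nonneg _ hτ.le; linarith), div_mul_eq_mul_div, div_le_iff₀ hτ]
          nlinarith
      _ = ∫⁻ _ in Icc t₁ t₂, ENNReal.ofReal v := by
          rw [setLIntegral_const, Real.volume_Icc, ENNReal.ofReal_mul hv]
      _ ≤ ∫⁻ t in Icc t₁ t₂, W (AffineMap.lineMap x y (t / τ)) := by
          refine setLIntegral_mono' measurableSet_Icc fun t ht => hW _ ?_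
          rw [segment_eq_image_lineMap]
          refine ⟨t / τ, ⟨div_nonneg (h1.1.trans ht.1) hτ.le, ?_⟩, rfl⟩
          exact (div_le_one hτ).2 (ht.2.trans h2.2)

/-- Until the first time at distance ϱ from `c` the speed is at most `L`, and by `h0` this is too
slow to get there before time `τ`. -/
theorem IsFieldPath.mem_closedBall {W : E d → ℝ≥0∞} {τ L ϱ : ℝ} {γ : ℝ → E d} {c : E d}
    (h : IsFieldPath W τ γ) (hL : 0 ≤ L)
    (hW : ∀ y ∈ Metric.closedBall c ϱ, W y ≤ ENNReal.ofReal L)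
    (h0 : dist (γ 0) c + L * τ < ϱ) : ∀ t ∈ Icc 0 τ, γ t ∈ Metric.closedBall c ϱ := by
  by_contra hcon
  push Not at hcon
  obtain ⟨t, ht, htc⟩ := hcon
  have hcont : ContinuousOn (fun u => dist (γ u) c) (Icc 0 t) :=
    continuous_dist.comp_continuousOn
      ((h.2.1.mono (Icc_subset_Icc_right ht.2)).prodMk continuousOn_const)
  have hclosed : IsClosed (Icc 0 t ∩ (fun u => dist (γ u) c) ⁻¹' Ici ϱ) :=
    hcont.preimage_isClosed_of_isClosed isClosed_Icc isClosed_Ici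
  have hne : (Icc 0 t ∩ (fun u => dist (γ u) c) ⁻¹' Ici ϱ).Nonempty :=
    ⟨t, ⟨ht.1, le_rfl⟩, mem_preimage.2 (mem_Ici.2 (not_le.1 htc).le)⟩
  have hbdd : BddBelow (Icc 0 t ∩ (fun u => dist (γ u) c) ⁻¹' Ici ϱ) :=
    ⟨0, fun u hu => hu.1.1⟩
  have hmem := hclosed.csInf_mem hne hbdd
  set s := sInf (Icc 0 t ∩ (fun u => dist (γ u) c) ⁻¹' Ici ϱ)
  have hs : ∀ u ∈ Ioo 0 s, W (γ u) ≤ ENNReal.ofReal L := by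
    intro u hu
    refine hW _ (Metric.mem_closedBall.2 (not_lt.1 fun hlt => ?_))
    have : s ≤ u := csInf_le hbdd ⟨⟨hu.1.le, hu.2.le.trans hmem.1.2⟩, le_of_lt hlt⟩
    exact absurd hu.2 (not_lt.2 this)
  have h1 := h.dist_le le_rfl hmem.1.1 (hmem.1.2.trans ht.2) hL hs
  have h2 : ϱ ≤ dist (γ s) c := hmem.2
  have h3 := dist_triangle_left (γ s) c (γ 0)
  have h4 : L * (s - 0) ≤ L * τ := by
    gcongr
    linarith [hmem.1.2, ht.2]
  linarith

end Paths

/-! ### Limits of paths -/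

section Limits

variable {d : ℕ}

/-- Reverse Fatou: the limsup of the integrals is at most the integral of the limsup, which upper
semicontinuity bounds by V along the limit. The slack `η n` accommodates paths allowed a small extra
speed everywhere. -/
theorem isVPath_of_tendsto {R : Set (Road d)} (hR : IsLocallyFinite R) {τ : ℝ} (hτ : 0 ≤ τ)
    {γn : ℕ → ℝ → E d} {γ : ℝ → E d} {η : ℕ → ℝ≥0∞} (hη : Tendsto η atTop (𝓝 0))
    (hη1 : ∀ n, η n ≤ 1) {c : E d} {ϱ : ℝ}
    (hball : ∀ n, ∀ t ∈ Icc 0 τ, γn n t ∈ Metric.closedBall c ϱ)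
    (hpath : ∀ n, IsFieldPath (fun y => speedLimit R y + η n) τ (γn n))
    (hlim : ∀ t ∈ Icc 0 τ, Tendsto (fun n => γn n t) atTop (𝓝 (γ t))) :
    IsVPath R τ γ := by
  obtain ⟨L, hL0, hL⟩ := hR.exists_bound c ϱ
  have hγball : ∀ t ∈ Icc 0 τ, γ t ∈ Metric.closedBall c ϱ := fun t ht =>
    Metric.isClosed_closedBall.mem_of_tendsto (hlim t ht) (Eventually.of_forall fun n =>
      hball n t ht)
  have hineq : ∀ t₁ ∈ Icc 0 τ, ∀ t₂ ∈ Icc 0 τ, t₁ ≤ t₂ →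
      edist (γ t₁) (γ t₂) ≤ ∫⁻ t in Icc t₁ t₂, speedLimit R (γ t) := by
    intro t₁ h1 t₂ h2 h12
    have hsub : Icc t₁ t₂ ⊆ Icc 0 τ := Icc_subset_Icc h1.1 h2.2
    -- `projIcc` extends the paths by constants outside `[0, τ]`, so that the integrands are
    -- measurable and bounded on the whole line.
    set f : ℕ → ℝ → ℝ≥0∞ := fun n t => speedLimit R (γn n (projIcc 0 τ hτ t)) + η n with hf
    have hfeq : ∀ n, ∀ t ∈ Icc t₁ t₂, f n t = speedLimit R (γn n t) + η n := by
      intro n t ht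
      simp only [hf, projIcc_of_mem hτ (hsub ht)]
    have hcontn : ∀ n, Continuous fun t => γn n (projIcc 0 τ hτ t) := fun n =>
      (hpath n).2.1.comp_continuous (continuous_subtype_val.comp continuous_projIcc)
        fun t => (projIcc 0 τ hτ t).2
    have hmeas : ∀ n, Measurable (f n) := fun n =>
      ((measurable_speedLimit hR).comp (hcontn n).measurable).add_const _
    have hbound : ∀ n, f n ≤ᵐ[volume.restrict (Icc t₁ t₂)] fun _ => ENNReal.ofReal L + 1 :=
      fun n => Eventually.of_forall fun t =>
        add_le_add (hL _ (hball n _ (projIcc 0 τ hτ t).2)) (hη1 n)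
    have hfin : ∫⁻ _ in Icc t₁ t₂, (ENNReal.ofReal L + 1) ≠ ∞ := by
      rw [setLIntegral_const, Real.volume_Icc]
      exact ENNReal.mul_ne_top (by simp) (by simp)
    have hdist : Tendsto (fun n => edist (γn n t₁) (γn n t₂)) atTop (𝓝 (edist (γ t₁) (γ t₂))) :=
      (hlim t₁ h1).edist (hlim t₂ h2)
    have hle : ∀ n, edist (γn n t₁) (γn n t₂) ≤ ∫⁻ t in Icc t₁ t₂, f n t := by
      intro n
      refine ((hpath n).2.2 t₁ h1 t₂ h2 h12).trans_eq ?_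
      exact (setLIntegral_congr_fun measurableSet_Icc (hfeq n)).symm
    calc edist (γ t₁) (γ t₂) = limsup (fun n => edist (γn n t₁) (γn n t₂)) atTop :=
          hdist.limsup_eq.symm
      _ ≤ limsup (fun n => ∫⁻ t in Icc t₁ t₂, f n t) atTop :=
          limsup_le_limsup (Eventually.of_forall hle)
      _ ≤ ∫⁻ t in Icc t₁ t₂, limsup (fun n => f n t) atTop :=
          limsup_lintegral_le _ hmeas hbound hfin
      _ ≤ ∫⁻ t in Icc t₁ t₂, speedLimit R (γ t) := by
          refine setLIntegral_mono' measurableSet_Icc fun t ht => ?_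
          refine le_of_forall_gt fun b hb => ?_
          obtain ⟨b', hb', hbb'⟩ := exists_between hb
          have hev1 : ∀ᶠ n in atTop, speedLimit R (γn n t) < b' :=
            (hlim t (hsub ht)).eventually (hR.upperSemicontinuous (γ t) b' hb')
          have hpos : (0 : ℝ≥0∞) < b - b' := tsub_pos_of_lt hbb'
          obtain ⟨e, he, heb⟩ := exists_between hpos
          have hev2 : ∀ᶠ n in atTop, η n < e := hη.eventually_lt_const he
          have hsum : b' + e < b := by
            rw [add_comm]
            exact lt_tsub_iff_right.1 heb
          refine lt_of_le_of_lt (limsup_le_of_le (by isBoundedDefault) ?_) hsum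
          filter_upwards [hev1, hev2] with n hn1 hn2
          rw [hfeq n t ht]
          exact add_le_add hn1.le hn2.le
  refine ⟨hτ, ?_, hineq⟩
  have hlip : LipschitzOnWith L.toNNReal γ (Icc 0 τ) := by
    have key : ∀ t₁ ∈ Icc 0 τ, ∀ t₂ ∈ Icc 0 τ, t₁ ≤ t₂ →
        edist (γ t₁) (γ t₂) ≤ ENNReal.ofReal L * edist t₁ t₂ := by
      intro t₁ h1 t₂ h2 h12
      refine (hineq t₁ h1 t₂ h2 h12).trans ((lintegral_Icc_le_of_le hL0.le fun t ht =>
        hL _ (hγball t ⟨h1.1.trans ht.1.le, ht.2.le.trans h2.2⟩)).trans_eq ?_)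
      rw [ENNReal.ofReal_mul hL0.le, edist_comm, edist_dist, Real.dist_eq,
        abs_of_nonneg (sub_nonneg.2 h12)]
    intro t₁ h1 t₂ h2
    rcases le_total t₁ t₂ with h | h
    · exact key t₁ h1 t₂ h2 h
    · rw [edist_comm (γ t₁), edist_comm t₁]
      exact key t₂ h2 t₁ h1 h
  exact hlip.continuousOn

/-- A sequence of equi-Lipschitz paths in a ball has a pointwise convergent subsequence. -/
theorem exists_subseq_tendsto {τ : ℝ} (hτ : 0 ≤ τ) {L : ℝ≥0} {c : E d} {ϱ : ℝ}
    {γn : ℕ → ℝ → E d} (hball : ∀ n, ∀ t ∈ Icc 0 τ, γn n t ∈ Metric.closedBall c ϱ)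
    (hlip : ∀ n, LipschitzOnWith L (γn n) (Icc 0 τ)) :
    ∃ (φ : ℕ → ℕ) (γ : ℝ → E d), StrictMono φ ∧
      ∀ t ∈ Icc 0 τ, Tendsto (fun n => γn (φ n) t) atTop (𝓝 (γ t)) := by
  set A : Set (BoundedContinuousFunction (Icc 0 τ) (E d)) :=
    {f | LipschitzWith L f ∧ ∀ t, f t ∈ Metric.closedBall c ϱ} with hA
  have hcomp : IsCompact (closure A) := by
    refine BoundedContinuousFunction.arzela_ascoli (Metric.closedBall c ϱ)
      (isCompact_closedBall c ϱ) A (fun f x hf => hf.2 x) ?_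
    exact (LipschitzWith.uniformEquicontinuous _ L fun f => f.2.1).equicontinuous
  let g : ℕ → BoundedContinuousFunction (Icc 0 τ) (E d) := fun n =>
    BoundedContinuousFunction.mkOfCompact ⟨fun t => γn n t,
      (lipschitzOnWith_iff_restrict.1 (hlip n)).continuous⟩
  have hg : ∀ n, g n ∈ closure A := fun n => subset_closure
    ⟨lipschitzOnWith_iff_restrict.1 (hlip n), fun t => hball n t t.2⟩
  obtain ⟨f, -, φ, hφ, hlim⟩ := hcomp.tendsto_subseq hg
  refine ⟨φ, fun t => f (projIcc 0 τ hτ t), hφ, fun t ht => ?_⟩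
  have h1 := (BoundedContinuousFunction.tendsto_iff_tendstoUniformly.1 hlim).tendsto_at ⟨t, ht⟩
  simp only [projIcc_of_mem hτ ht]
  exact h1

/-- Arzelà–Ascoli followed by `isVPath_of_tendsto`. The factor `L + 1` in `hx` absorbs the slack, at
most 1, and keeps all paths in one ball, where they share a Lipschitz constant. -/
theorem Reach.of_tendsto {R : Set (Road d)} (hR : IsLocallyFinite R) {τ : ℝ} {η : ℕ → ℝ≥0∞}
    (hη : Tendsto η atTop (𝓝 0)) (hη1 : ∀ n, η n ≤ 1) {c x y : E d} {yn : ℕ → E d} {L ϱ : ℝ}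
    (hL : 0 ≤ L) (hV : ∀ y ∈ Metric.closedBall c ϱ, speedLimit R y ≤ ENNReal.ofReal L)
    (hx : dist x c + (L + 1) * τ < ϱ) (hy : Tendsto yn atTop (𝓝 y))
    (hreach : ∀ n, Reach (fun y => speedLimit R y + η n) τ x (yn n)) :
    Reach (speedLimit R) τ x y := by
  have hτ := (hreach 0).nonneg
  choose γn hpath h0 h1 using hreach
  have hW : ∀ n, ∀ y ∈ Metric.closedBall c ϱ, speedLimit R y + η n ≤ ENNReal.ofReal (L + 1) := by
    intro n y hy
    rw [ENNReal.ofReal_add hL zero_le_one, ENNReal.ofReal_one]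
    exact add_le_add (hV y hy) (hη1 n)
  have hball : ∀ n, ∀ t ∈ Icc 0 τ, γn n t ∈ Metric.closedBall c ϱ := fun n =>
    (hpath n).mem_closedBall (by linarith) (hW n) (by rwa [h0 n])
  have hlip : ∀ n, LipschitzOnWith (L + 1).toNNReal (γn n) (Icc 0 τ) := by
    intro n
    have key : ∀ t₁ ∈ Icc 0 τ, ∀ t₂ ∈ Icc 0 τ, t₁ ≤ t₂ →
        dist (γn n t₁) (γn n t₂) ≤ (L + 1) * dist t₁ t₂ := by
      intro t₁ h1 t₂ h2 h12
      rw [dist_comm t₁, Real.dist_eq, abs_of_nonneg (sub_nonneg.2 h12)]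
      exact (hpath n).dist_le h1.1 h12 h2.2 (by linarith) fun u hu =>
        hW n _ (hball n u ⟨h1.1.trans hu.1.le, hu.2.le.trans h2.2⟩)
    refine LipschitzOnWith.of_dist_le_mul fun t₁ h1 t₂ h2 => ?_
    rw [Real.coe_toNNReal _ (by linarith)]
    rcases le_total t₁ t₂ with h | h
    · exact key t₁ h1 t₂ h2 h
    · rw [dist_comm (γn n t₁), dist_comm t₁]
      exact key t₂ h2 t₁ h1 h
  obtain ⟨φ, γ, hφ, hlim⟩ := exists_subseq_tendsto hτ hball hlip
  refine ⟨γ, isVPath_of_tendsto hR hτ (hη.comp hφ.tendsto_atTop) (fun n => hη1 (φ n))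
    (fun n => hball (φ n)) (fun n => hpath (φ n)) hlim, ?_, ?_⟩
  · refine tendsto_nhds_unique (hlim 0 ⟨le_rfl, hτ⟩) ?_
    simp [h0]
  · refine tendsto_nhds_unique (hlim τ ⟨hτ, le_rfl⟩) ?_
    simpa [h1, Function.comp_def] using hy.comp hφ.tendsto_atTop

end Limits

/-! ### Driving times and geodesics -/

section Geodesics

variable {d : ℕ}

theorem drivingTime_le {R : Set (Road d)} {τ : ℝ} {x y : E d} (h : Reach (speedLimit R) τ x y) :
    drivingTime R x y ≤ ENNReal.ofReal τ := by
  refine ENNReal.le_of_forall_pos_le_add fun ε hε _ => ?_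
  -- The infimum defining the driving time runs over positive times, whereas `Reach` allows time 0.
  have hpos : 0 < τ + ε := add_pos_of_nonneg_of_pos h.nonneg (by exact_mod_cast hε)
  refine (iInf₂_le (τ + ε) ⟨hpos, h.mono (by simp)⟩).trans ?_
  rw [← ENNReal.ofReal_coe_nnreal (p := ε), ← ENNReal.ofReal_add h.nonneg (NNReal.coe_nonneg ε)]

theorem exists_reach_of_drivingTime_lt {R : Set (Road d)} {τ : ℝ} {x y : E d}
    (h : drivingTime R x y < ENNReal.ofReal τ) : Reach (speedLimit R) τ x y := by
  obtain ⟨σ, h⟩ := iInf_lt_iff.1 h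
  obtain ⟨⟨hσ, hreach⟩, h⟩ := iInf_lt_iff.1 h
  exact Reach.mono hreach (ENNReal.ofReal_lt_ofReal_iff'.1 h).1.le

/-- A quicker connection spliced between times `s` and `t` would shorten the whole geodesic. -/
theorem IsGeodesicVPath.le_of_reach {R : Set (Road d)} {τ : ℝ} {γ : ℝ → E d}
    (h : IsGeodesicVPath R τ γ) {s t u : ℝ} (hs : 0 ≤ s) (hst : s ≤ t) (ht : t ≤ τ)
    (hu : Reach (speedLimit R) u (γ s) (γ t)) : t - s ≤ u := by
  have hp : IsFieldPath (speedLimit R) τ γ := h.1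
  have h1 := ((hp.reach le_rfl hs (hst.trans ht)).trans hu).trans
    (hp.reach (hs.trans hst) ht le_rfl)
  have h2 := drivingTime_le h1
  rw [h.2, ENNReal.ofReal_le_ofReal_iff h1.nonneg] at h2
  linarith

/-- A minimal driving time that is short enough is attained. -/
theorem reach_of_drivingTime_le {R : Set (Road d)} (hR : IsLocallyFinite R) {c x y : E d}
    {τ L ϱ : ℝ} (hτ : 0 ≤ τ) (hL : 0 ≤ L)
    (hV : ∀ y ∈ Metric.closedBall c ϱ, speedLimit R y ≤ ENNReal.ofReal L)
    (hx : dist x c + (L + 1) * τ < ϱ) (h : drivingTime R x y ≤ ENNReal.ofReal τ) :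
    Reach (speedLimit R) τ x y := by
  obtain ⟨e, he0, he⟩ : ∃ e : ℝ, 0 < e ∧ dist x c + (L + 1) * (τ + e) < ϱ := by
    refine ⟨(ϱ - (dist x c + (L + 1) * τ)) / (2 * (L + 1)), by
      apply div_pos <;> linarith, ?_⟩
    have : (L + 1) * ((ϱ - (dist x c + (L + 1) * τ)) / (2 * (L + 1))) =
        (ϱ - (dist x c + (L + 1) * τ)) / 2 := by
      field_simp
    rw [mul_add, this]
    linarith
  -- Paths that are slightly too long are cut at time `τ`: they then end near `y`, because the speed
  -- is bounded.
  have hex : ∀ n : ℕ, ∃ z, Reach (speedLimit R) τ x z ∧ dist z y ≤ L * (e / ((n : ℝ) + 1)) := by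
    intro n
    have hn : 0 < e / ((n : ℝ) + 1) := by positivity
    obtain ⟨γ, hγ, h0, h1⟩ := exists_reach_of_drivingTime_lt (τ := τ + e / ((n : ℝ) + 1))
      (h.trans_lt ((ENNReal.ofReal_lt_ofReal_iff (by linarith)).2 (by linarith)))
    have hne : e / ((n : ℝ) + 1) ≤ e := div_le_self he0.le (by linarith [Nat.cast_nonneg (α := ℝ) n])
    have hball := hγ.mem_closedBall hL hV (by
      rw [h0]
      have : L * (τ + e / ((n : ℝ) + 1)) ≤ (L + 1) * (τ + e) := by gcongr; linarith
      linarith)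
    refine ⟨γ τ, ?_, ?_⟩
    · have := hγ.reach (s := 0) (t := τ) le_rfl hτ (by linarith)
      rwa [sub_zero, h0] at this
    · rw [← h1]
      have := hγ.dist_le (s := τ) (t := τ + e / ((n : ℝ) + 1)) hτ (by linarith) le_rfl hL
        fun u hu => hV _ (hball u ⟨hτ.trans hu.1.le, hu.2.le⟩)
      simpa using this
  choose yn hyn hdist using hex
  refine Reach.of_tendsto hR (η := fun _ => 0) tendsto_const_nhds (fun _ => zero_le_one) hL hV hx
    (yn := yn) ?_ (by simpa using hyn)
  rw [tendsto_iff_dist_tendsto_zero]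
  refine squeeze_zero (fun _ => dist_nonneg) hdist ?_
  have := (tendsto_const_div_atTop_nhds_zero_nat e).comp (tendsto_add_atTop_nat 1)
  simpa using this.const_mul L

end Geodesics

/-! ### Cut sets from connection times and numbers of fast roads -/

section CutSets

variable {d : ℕ}

/-- The displacement of a geodesic along which every straight piece that follows a fast road is
short. -/
theorem IsGeodesicVPath.dist_le_of_short {R : Set (Road d)} {τ : ℝ} {γ : ℝ → E d}
    (hG : IsGeodesicVPath R τ γ) {v e : ℝ} (hv : 0 < v) (he : 0 ≤ e) :
    ∀ (N : ℕ) (F : Finset (Road d)), F.card = N → (∀ r ∈ F, r ∈ R ∧ v ≤ (r.2 : ℝ)) →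
      ∀ s₁ s₂, 0 ≤ s₁ → s₁ ≤ s₂ → s₂ ≤ τ →
      (∀ t ∈ Ioo s₁ s₂, ∀ r ∈ R, v ≤ (r.2 : ℝ) → γ t ∈ r.1.carrier → r ∈ F) →
      (∀ r ∈ F, ∀ a b, s₁ ≤ a → a ≤ b → b ≤ s₂ → γ a ∈ r.1.carrier → γ b ∈ r.1.carrier →
        (∀ z ∈ segment ℝ (γ a) (γ b), ∃ t ∈ Icc a b, γ t = z) → dist (γ a) (γ b) ≤ e) →
      dist (γ s₁) (γ s₂) ≤ v * (s₂ - s₁) + (2 ^ N - 1) * e := by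
  have hp : IsFieldPath (speedLimit R) τ γ := hG.1
  intro N
  induction N with
  | zero =>
    intro F hF _ s₁ s₂ h1 h12 h2 hfast _
    rw [Finset.card_eq_zero] at hF
    subst hF
    have := hp.dist_le h1 h12 h2 hv.le fun t ht => speedLimit_le fun r hr hrt => by
      by_contra hlt
      exact absurd (hfast t ht r hr (not_le.1 hlt).le hrt) (Finset.notMem_empty r)
    simpa using this
  | succ N ih =>
    intro F hF hFR s₁ s₂ h1 h12 h2 hfast hshort
    -- Cut at the first visit `a` and the last visit `b` to the fastest road of `F`. Before `a` and
    -- after `b` this road is not used and the induction applies; the stretch in between is short by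
    -- hypothesis. The recursion 2(2^N - 1) + 1 = 2^(N+1) - 1 gives the coefficient of `e`.
    obtain ⟨r, hrF, hmax⟩ := F.exists_max_image (fun r => (r.2 : ℝ))
      (Finset.card_pos.1 (by omega))
    classical
    have hcard : (F.erase r).card = N := by rw [Finset.card_erase_of_mem hrF, hF]; rfl
    have hFR' : ∀ r' ∈ F.erase r, r' ∈ R ∧ v ≤ (r'.2 : ℝ) := fun r' hr' =>
      hFR r' (Finset.mem_of_mem_erase hr')
    have hpow : (1 : ℝ) ≤ 2 ^ N := one_le_pow₀ one_le_two
    have ihr : ∀ a b, s₁ ≤ a → a ≤ b → b ≤ s₂ → (∀ t ∈ Ioo a b, γ t ∉ r.1.carrier) →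
        dist (γ a) (γ b) ≤ v * (b - a) + (2 ^ N - 1) * e := by
      intro a b ha hab hb hav
      refine ih (F.erase r) hcard hFR' a b (h1.trans ha) hab (hb.trans h2) ?_ ?_
      · intro t ht r' hr' hvr' htr'
        refine Finset.mem_erase.2 ⟨?_, hfast t ⟨ha.trans_lt ht.1, ht.2.trans_le hb⟩ r' hr' hvr' htr'⟩
        rintro rfl
        exact hav t ht htr'
      · intro r' hr' a' b' ha' hab' hb'
        exact hshort r' (Finset.mem_of_mem_erase hr') a' b' (ha.trans ha') hab' (hb'.trans hb)
    set T : Set ℝ := Icc s₁ s₂ ∩ γ ⁻¹' (r.1.carrier : Set (E d)) with hT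
    have hTc : IsCompact T := by
      refine isCompact_Icc.of_isClosed_subset ?_ inter_subset_left
      exact (hp.2.1.mono (Icc_subset_Icc h1 h2)).preimage_isClosed_of_isClosed isClosed_Icc
        r.1.isClosed
    rcases T.eq_empty_or_nonempty with hTe | hTn
    · have := ihr s₁ s₂ le_rfl h12 le_rfl fun t ht htr => by
        have : t ∈ T := ⟨Ioo_subset_Icc_self ht, htr⟩
        rwa [hTe] at this
      refine this.trans ?_
      rw [pow_succ]
      nlinarith
    obtain ⟨a, haT, ha⟩ := hTc.exists_isLeast hTn
    obtain ⟨b, hbT, hb⟩ := hTc.exists_isGreatest hTn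
    have hab : a ≤ b := ha hbT
    set w : ℝ := Subtype.val r.2 with hw
    have hw0 : 0 < w := r.2.2
    have hslow : ∀ t ∈ Ioo a b, speedLimit R (γ t) ≤ ENNReal.ofReal w := by
      intro t ht
      refine speedLimit_le fun r' hr' htr' => ?_
      by_contra hlt
      have hlt := not_le.1 hlt
      exact absurd (hmax r' (hfast t ⟨haT.1.1.trans_lt ht.1, ht.2.trans_le hbT.1.2⟩ r' hr'
        ((hFR r hrF).2.trans hlt.le) htr')) (not_le.2 hlt)
    have ha0 : 0 ≤ a := h1.trans haT.1.1
    have hbτ : b ≤ τ := hbT.1.2.trans h2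
    -- Between `a` and `b` no road met is faster than `w`, while `r` itself offers speed `w` along
    -- the straight segment, so minimality forces equality.
    have hdist : dist (γ a) (γ b) = w * (b - a) := by
      refine le_antisymm (hp.dist_le ha0 hab hbτ hw0.le hslow) ?_
      have hreach : Reach (speedLimit R) (dist (γ a) (γ b) / w) (γ a) (γ b) := by
        refine Reach.of_segment (div_nonneg dist_nonneg hw0.le) hw0.le (fun p hps => ?_)
          (mul_div_cancel₀ _ hw0.ne').ge
        exact le_speedLimit (hFR r hrF).1 (r.1.carrier.convex.segment_subset haT.2 hbT.2 hps)
      have := hG.le_of_reach ha0 hab hbτ hreach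
      rw [le_div_iff₀ hw0] at this
      linarith
    -- Equality in the triangle inequality, by strict convexity of the Euclidean norm, puts the path
    -- on the segment at constant speed `w`.
    have hstraight : ∀ z ∈ segment ℝ (γ a) (γ b), ∃ t ∈ Icc a b, γ t = z := by
      intro z hz
      rw [segment_eq_image_lineMap] at hz
      obtain ⟨c, ⟨hc0, hc1⟩, rfl⟩ := hz
      have hba : 0 ≤ b - a := sub_nonneg.2 hab
      have hta : a ≤ a + c * (b - a) := by nlinarith
      have htb : a + c * (b - a) ≤ b := by nlinarith
      refine ⟨a + c * (b - a), ⟨hta, htb⟩, ?_⟩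
      have d1 := hp.dist_le ha0 hta (htb.trans hbτ) hw0.le fun u hu =>
        hslow u ⟨hu.1, hu.2.trans_le htb⟩
      have d2 := hp.dist_le (ha0.trans hta) htb hbτ hw0.le fun u hu =>
        hslow u ⟨hta.trans_lt hu.1, hu.2⟩
      have d3 := dist_triangle (γ a) (γ (a + c * (b - a))) (γ b)
      apply eq_lineMap_of_dist_eq_mul_of_dist_eq_mul
      · rw [hdist] at d3 ⊢
        nlinarith
      · rw [hdist] at d3 ⊢
        nlinarith
    have hmid := hshort r hrF a b haT.1.1 hab hbT.1.2 haT.2 hbT.2 hstraight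
    have hleft := ihr s₁ a le_rfl haT.1.1 haT.1.2 fun t ht htr =>
      absurd (ha ⟨⟨ht.1.le, ht.2.le.trans haT.1.2⟩, htr⟩) (not_le.2 ht.2)
    have hright := ihr b s₂ hbT.1.1 hbT.1.2 le_rfl fun t ht htr =>
      absurd (hb ⟨⟨hbT.1.1.trans ht.1.le, ht.2.le⟩, htr⟩) (not_le.2 ht.1)
    have htri := dist_triangle4 (γ s₁) (γ a) (γ b) (γ s₂)
    have hvab : 0 ≤ v * (b - a) := mul_nonneg hv.le (sub_nonneg.2 hab)
    rw [pow_succ]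
    nlinarith

/-- A path from level `a` to level `b` has a piece that joins the two levels and stays between
them. -/
theorem exists_crossing {τ a b : ℝ} {ψ : ℝ → ℝ} (hτ : 0 ≤ τ) (hψ : ContinuousOn ψ (Icc 0 τ))
    (hab : a < b) (h0 : ψ 0 ≤ a) (hb : b ≤ ψ τ) :
    ∃ s₁ s₂, 0 ≤ s₁ ∧ s₁ ≤ s₂ ∧ s₂ ≤ τ ∧ ψ s₁ = a ∧ ψ s₂ = b ∧
      ∀ t ∈ Icc s₁ s₂, a ≤ ψ t ∧ ψ t ≤ b := by
  -- The time `s₂` is the first at level at least `b`, and `s₁` the last before it at level at most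
  -- `a`.
  have hc1 : IsCompact (Icc 0 τ ∩ ψ ⁻¹' Ici b) :=
    isCompact_Icc.of_isClosed_subset (hψ.preimage_isClosed_of_isClosed isClosed_Icc isClosed_Ici)
      inter_subset_left
  obtain ⟨s₂, hs₂, hmin⟩ := hc1.exists_isLeast ⟨τ, ⟨hτ, le_rfl⟩, hb⟩
  have hψ2 : ContinuousOn ψ (Icc 0 s₂) := hψ.mono (Icc_subset_Icc_right hs₂.1.2)
  have hc2 : IsCompact (Icc 0 s₂ ∩ ψ ⁻¹' Iic a) :=
    isCompact_Icc.of_isClosed_subset (hψ2.preimage_isClosed_of_isClosed isClosed_Icc isClosed_Iic)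
      inter_subset_left
  obtain ⟨s₁, hs₁, hmax⟩ := hc2.exists_isGreatest ⟨0, ⟨le_rfl, hs₂.1.1⟩, h0⟩
  have hb2 : b ≤ ψ s₂ := hs₂.2
  have ha1 : ψ s₁ ≤ a := hs₁.2
  have hψ12 : ContinuousOn ψ (Icc s₁ s₂) := hψ2.mono (Icc_subset_Icc_left hs₁.1.1)
  have e1 : ψ s₁ = a := by
    obtain ⟨t, ht, hta⟩ := intermediate_value_Icc hs₁.1.2 hψ12
      (show a ∈ Icc (ψ s₁) (ψ s₂) from ⟨ha1, by linarith⟩)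
    have : t ≤ s₁ := hmax ⟨⟨hs₁.1.1.trans ht.1, ht.2⟩, hta.le⟩
    rw [← hta, le_antisymm this ht.1]
  have e2 : ψ s₂ = b := by
    obtain ⟨t, ht, htb⟩ := intermediate_value_Icc hs₁.1.2 hψ12
      (show b ∈ Icc (ψ s₁) (ψ s₂) from ⟨by linarith, hb2⟩)
    have : s₂ ≤ t := hmin ⟨⟨hs₁.1.1.trans ht.1, ht.2.trans hs₂.1.2⟩, htb.ge⟩
    rw [← htb, le_antisymm ht.2 this]
  refine ⟨s₁, s₂, hs₁.1.1, hs₁.1.2, hs₂.1.2, e1, e2, fun t ht => ⟨?_, ?_⟩⟩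
  · rcases ht.1.eq_or_lt with rfl | hlt
    · exact e1.ge
    · by_contra hcon
      exact absurd (hmax ⟨⟨hs₁.1.1.trans ht.1, ht.2⟩, (not_le.1 hcon).le⟩) (not_le.2 hlt)
  · rcases ht.2.eq_or_lt with rfl | hlt
    · exact e2.le
    · by_contra hcon
      exact absurd (hmin ⟨⟨hs₁.1.1.trans ht.1, ht.2.trans hs₂.1.2⟩, (not_le.1 hcon).le⟩)
        (not_le.2 hlt)

/-- The part of a line in a ball has a finite net that meets all its long segments. -/
theorem Line.exists_net (ℓ : Line d) (x : E d) {ϱ e : ℝ} (he : 0 < e) {N : ℕ}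
    (hN : 2 * ϱ ≤ N * e) :
    ∃ Z : Finset (E d), Z.card ≤ 2 * N + 1 ∧ ∀ p ∈ ℓ.carrier, ∀ q ∈ ℓ.carrier,
      p ∈ Metric.closedBall x ϱ → q ∈ Metric.closedBall x ϱ → e ≤ dist p q →
      ∃ z ∈ Z, z ∈ segment ℝ p q := by
  classical
  by_cases hne : ∃ y ∈ ℓ.carrier, y ∈ Metric.closedBall x ϱ
  swap
  · push Not at hne
    exact ⟨∅, by simp, fun p hp _ _ hpx => absurd hpx (hne p hp)⟩
  obtain ⟨y, hy, hyx⟩ := hne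
  obtain ⟨u₀, hu₀, hspan⟩ := finrank_eq_one_iff'.1 ℓ.finrank_direction
  set n : ℝ := ‖(u₀ : E d)‖ with hn
  have hn0 : 0 < n := norm_pos_iff.2 fun h => hu₀ (Subtype.ext h)
  set u : E d := n⁻¹ • (u₀ : E d) with hu
  have hu1 : ‖u‖ = 1 := by
    rw [hu, norm_smul, norm_inv, Real.norm_of_nonneg hn0.le]
    exact inv_mul_cancel₀ hn0.ne'
  have hparam : ∀ p ∈ ℓ.carrier, ∃ s : ℝ, p = y + s • u := by
    intro p hp
    obtain ⟨c, hc⟩ := hspan ⟨p -ᵥ y, AffineSubspace.vsub_mem_direction hp hy⟩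
    have hc' : c • (u₀ : E d) = p - y := congrArg Subtype.val hc
    refine ⟨c * n, ?_⟩
    rw [hu, smul_smul, mul_assoc, mul_inv_cancel₀ hn0.ne', mul_one, hc']
    abel
  have hdist : ∀ s t : ℝ, dist (y + s • u) (y + t • u) = |s - t| := by
    intro s t
    rw [dist_add_left, dist_eq_norm, ← sub_smul, norm_smul, hu1, mul_one, Real.norm_eq_abs]
  have hbound : ∀ s : ℝ, y + s • u ∈ Metric.closedBall x ϱ → |s| ≤ N * e := by
    intro s hs
    have h1 := hdist s 0
    rw [zero_smul, add_zero, sub_zero] at h1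
    rw [← h1]
    have := dist_triangle_right (y + s • u) y x
    linarith [Metric.mem_closedBall.1 hs, Metric.mem_closedBall.1 hyx]
  -- The net consists of the points at signed distance a multiple of `e` from `y`. Points of the
  -- ball are at distance at most 2ϱ ≤ Ne from `y`, and an interval of length at least `e` contains
  -- a multiple of `e`.
  refine ⟨(Finset.Icc (-(N : ℤ)) N).image fun k : ℤ => y + ((k : ℝ) * e) • u, ?_, ?_⟩
  · refine Finset.card_image_le.trans ?_
    rw [Int.card_Icc]
    omega
  have key : ∀ s t : ℝ, s ≤ t → |s| ≤ N * e → |t| ≤ N * e → e ≤ t - s →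
      ∃ k ∈ Finset.Icc (-(N : ℤ)) N, s ≤ k * e ∧ k * e ≤ t := by
    intro s t hst hs ht hes
    have h1 : s ≤ ⌈s / e⌉ * e := (div_le_iff₀ he).1 (Int.le_ceil _)
    have h2 : ⌈s / e⌉ * e ≤ t := by
      have := (Int.ceil_lt_add_one (s / e)).le
      have := mul_le_mul_of_nonneg_right this he.le
      rw [add_mul, div_mul_cancel₀ _ he.ne'] at this
      linarith
    refine ⟨⌈s / e⌉, Finset.mem_Icc.2 ⟨?_, ?_⟩, h1, h2⟩
    · have : (-(N : ℝ)) * e ≤ ⌈s / e⌉ * e := by linarith [(abs_le.1 hs).1]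
      have := le_of_mul_le_mul_right this he
      exact_mod_cast this
    · have : (⌈s / e⌉ : ℝ) * e ≤ N * e := h2.trans (abs_le.1 ht).2
      have := le_of_mul_le_mul_right this he
      exact_mod_cast this
  have key' : ∀ s t : ℝ, s ≤ t → y + s • u ∈ Metric.closedBall x ϱ →
      y + t • u ∈ Metric.closedBall x ϱ → e ≤ t - s →
      ∃ z ∈ (Finset.Icc (-(N : ℤ)) N).image fun k : ℤ => y + ((k : ℝ) * e) • u,
        z ∈ segment ℝ (y + s • u) (y + t • u) := by
    intro s t hst hs ht hes
    obtain ⟨k, hk, h1, h2⟩ := key s t hst (hbound s hs) (hbound t ht) hes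
    refine ⟨_, Finset.mem_image_of_mem _ hk, ?_⟩
    have hmem : (k * e : ℝ) ∈ segment ℝ s t := by
      rw [segment_eq_Icc hst]
      exact ⟨h1, h2⟩
    obtain ⟨α, β, hα, hβ, hαβ, hk⟩ := hmem
    refine ⟨α, β, hα, hβ, hαβ, ?_⟩
    rw [← hk]
    simp only [smul_eq_mul]
    have : α • y + β • y = y := by rw [← add_smul, hαβ, one_smul]
    calc α • (y + s • u) + β • (y + t • u) = (α • y + β • y) + (α * s + β * t) • u := by module
      _ = _ := by rw [this]
  intro p hp q hq hpx hqx hpq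
  obtain ⟨s, rfl⟩ := hparam p hp
  obtain ⟨t, rfl⟩ := hparam q hq
  rw [hdist] at hpq
  rcases le_total s t with hst | hst
  · exact key' s t hst hpx hqx (by rwa [abs_sub_comm, abs_of_nonneg (sub_nonneg.2 hst)] at hpq)
  · rw [segment_symm]
    exact key' t s hst hqx hpx (by rwa [abs_of_nonneg (sub_nonneg.2 hst)] at hpq)

/-- If few fast roads meet a ball, and if one can drive quickly between any two of its points,
then a bounded number of points cuts all geodesics that cross the annulus. -/
theorem exists_cutSet {R : Set (Road d)} (hR : IsLocallyFinite R) {x : E d} {r v D : ℝ} {M : ℕ}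
    (hr : 0 < r) (hv : 0 < v) (hM : (fastRoads R v x (2 * r)).encard ≤ M)
    (hD : ∀ y ∈ Metric.closedBall x (2 * r), ∀ y' ∈ Metric.closedBall x (2 * r),
      Reach (speedLimit R) D y y') (hvD : v * D ≤ r / 4) :
    ∃ Z : Finset (E d), Z.card ≤ M * (2 * 2 ^ (M + 3) + 1) ∧
      (∀ z ∈ Z, r ≤ dist z x ∧ dist z x ≤ 2 * r) ∧
      ∀ (τ : ℝ) (γ : ℝ → E d), IsGeodesicVPath R τ γ → γ 0 ∈ Metric.closedBall x r →
        γ τ ∉ Metric.closedBall x (2 * r) → ∃ z ∈ Z, ∃ t ∈ Icc 0 τ, γ t = z := by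
  classical
  have hfin := hR.finite hv x (2 * r)
  set F := hfin.toFinset with hF
  have hFM : F.card ≤ M := by
    have := hM
    rw [hfin.encard_eq_coe_toFinset_card] at this
    exact_mod_cast this
  -- At most 2^M stretches of length at most `e` contribute r/2; with the r/4 driven off the fast
  -- roads this stays below the width `r` of the annulus.
  set e : ℝ := r / 2 ^ (M + 1) with he
  have he0 : 0 < e := by positivity
  have hN : 2 * (2 * r) ≤ (2 ^ (M + 3) : ℕ) * e := by
    rw [he, pow_succ, pow_succ 2 M, show M + 2 = M + 1 + 1 from rfl, pow_succ 2 (M + 1), pow_succ]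
    push_cast
    field_simp
    norm_num
  choose net hcard hnet using fun ℓ : Line d => ℓ.exists_net x he0 hN
  refine ⟨(F.biUnion fun r' => net r'.1).filter fun z => r ≤ dist z x ∧ dist z x ≤ 2 * r,
    ?_, fun z hz => (Finset.mem_filter.1 hz).2, ?_⟩
  · refine (Finset.card_filter_le _ _).trans (Finset.card_biUnion_le.trans ?_)
    refine (Finset.sum_le_card_nsmul _ _ _ fun r' _ => hcard r'.1).trans ?_
    rw [smul_eq_mul]
    exact Nat.mul_le_mul_right _ hFM
  intro τ γ hG h0 hτ
  by_contra hcon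
  push Not at hcon
  have hp : IsFieldPath (speedLimit R) τ γ := hG.1
  obtain ⟨s₁, s₂, h1, h12, h2, e1, e2, hbetw⟩ := exists_crossing (ψ := fun t => dist (γ t) x)
    (a := r) (b := 2 * r) hp.1
    (continuous_dist.comp_continuousOn (hp.2.1.prodMk continuousOn_const)) (by linarith) h0
    (not_le.1 hτ).le
  have hball : ∀ t ∈ Icc s₁ s₂, γ t ∈ Metric.closedBall x (2 * r) := fun t ht => (hbetw t ht).2
  have key := hG.dist_le_of_short hv he0.le F.card F rfl
    (fun r' hr' => by
      have := hfin.mem_toFinset.1 hr'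
      exact ⟨this.1, this.2.1⟩) s₁ s₂ h1 h12 h2
    (fun t ht r' hr' hvr' htr' => hfin.mem_toFinset.2
      ⟨hr', hvr', γ t, htr', hball t (Ioo_subset_Icc_self ht)⟩)
    (fun r' hr' a b ha hab hb har hbr hseg => by
      by_contra hlt
      obtain ⟨z, hz, hzs⟩ := hnet r'.1 (γ a) har (γ b) hbr (hball a ⟨ha, hab.trans hb⟩)
        (hball b ⟨ha.trans hab, hb⟩) (not_le.1 hlt).le
      obtain ⟨t, ht, rfl⟩ := hseg z hzs
      refine hcon (γ t) (Finset.mem_filter.2 ⟨Finset.mem_biUnion.2 ⟨r', hr', hz⟩,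
        hbetw t ⟨ha.trans ht.1, ht.2.trans hb⟩⟩) t
        ⟨h1.trans (ha.trans ht.1), (ht.2.trans hb).trans h2⟩ rfl)
  have hs : s₂ - s₁ ≤ D := hG.le_of_reach h1 h12 h2
    (hD _ (hball s₁ ⟨le_rfl, h12⟩) _ (hball s₂ ⟨h12, le_rfl⟩))
  have htri : r ≤ dist (γ s₁) (γ s₂) := by
    have := dist_triangle_left (γ s₂) x (γ s₁)
    linarith
  have hpow : (2 : ℝ) ^ F.card ≤ 2 ^ M := pow_le_pow_right₀ one_le_two hFM
  have hE : 2 ^ M * e = r / 2 := by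
    rw [he, pow_succ]
    field_simp
  have h3 : v * (s₂ - s₁) ≤ r / 4 := (mul_le_mul_of_nonneg_left hs hv.le).trans hvD
  have h4 : (2 ^ F.card - 1) * e ≤ 2 ^ M * e := mul_le_mul_of_nonneg_right (by linarith) he0.le
  linarith

/-- The bound on the cardinality of cut sets when there are at most `M` fast roads. -/
def cutBound (M : ℕ) : ℕ := M * (2 * 2 ^ (M + 3) + 1)

theorem hasSmallCutSets {R : Set (Road d)} (hR : IsLocallyFinite R) {x : E d} {M : ℕ}
    (h : ∀ δ : ℝ, 0 < δ → ∃ r v D : ℝ, 0 < r ∧ 2 * r ≤ δ ∧ 0 < v ∧ v * D ≤ r / 4 ∧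
      (fastRoads R v x (2 * r)).encard ≤ M ∧
      ∀ y ∈ Metric.closedBall x (2 * r), ∀ y' ∈ Metric.closedBall x (2 * r),
        Reach (speedLimit R) D y y') : HasSmallCutSets R (cutBound M) x := by
  intro δ hδ
  obtain ⟨r, v, D, hr, hrδ, hv, hvD, hM, hD⟩ := h δ hδ
  obtain ⟨Z, hZc, hZ, hcut⟩ := exists_cutSet hR hr hv hM hD hvD
  -- The inner radius is r/2 rather than `r` because cut points may lie exactly at distance `r`.
  refine ⟨r / 2, by positivity, by linarith, Z, fun z hz => ⟨?_, fun hz' => ?_⟩, hZc,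
    fun τ γ hG h0 hτ => hcut τ γ hG (Metric.closedBall_subset_closedBall (by linarith) h0)
      fun hmem => hτ (Metric.closedBall_subset_closedBall hrδ hmem)⟩
  · exact (hZ z hz).2.trans hrδ
  · have := (hZ z hz).1
    rw [Metric.mem_closedBall] at hz'
    linarith

end CutSets

/-! ### Stars -/

section Stars

variable {d : ℕ}

/-- The initial pieces of a geodesic of the metric space `(ℝ^d, T)` are geodesic `V`-paths. -/
theorem IsMetricGeodesic.exists_isGeodesicVPath {R : Set (Road d)} (hR : IsLocallyFinite R)
    {τ : ℝ} {γ : ℝ → E d} (h : IsMetricGeodesic R τ γ) (hτ : 0 < τ) :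
    ∃ σ, 0 < σ ∧ σ ≤ τ ∧ IsGeodesicVPath R σ γ := by
  set c := γ 0 with hc
  obtain ⟨L, hL0, hL⟩ := hR.exists_bound c 2
  have hL1 : ∀ y ∈ Metric.closedBall c 1, speedLimit R y ≤ ENNReal.ofReal L := fun y hy =>
    hL y (Metric.closedBall_subset_closedBall one_le_two hy)
  -- Short enough for paths from `c` to stay where V is at most `L`.
  set σ := min τ (1 / (2 * (L + 1))) with hσ
  have hσ0 : 0 < σ := lt_min hτ (by positivity)
  have hστ : σ ≤ τ := min_le_left _ _
  have hLσ : (L + 1) * σ ≤ 1 / 2 := by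
    have := min_le_right τ (1 / (2 * (L + 1)))
    rw [← hσ, le_div_iff₀ (by positivity)] at this
    linarith
  have hLt : ∀ t, t ≤ σ → (L + 1) * t ≤ 1 / 2 := fun t ht =>
    (mul_le_mul_of_nonneg_left ht (by linarith)).trans hLσ
  have hLt' : ∀ t, 0 ≤ t → t ≤ σ → L * t ≤ 1 / 2 := fun t ht0 ht => by
    have := hLt t ht
    linarith
  have hT : ∀ s t, 0 ≤ s → s ≤ t → t ≤ σ →
      drivingTime R (γ s) (γ t) = ENNReal.ofReal (t - s) := by
    intro s t hs hst ht
    rw [h.2 s ⟨hs, by linarith⟩ t ⟨by linarith, by linarith⟩, abs_sub_comm,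
      abs_of_nonneg (sub_nonneg.2 hst)]
  have hball : ∀ t ∈ Icc 0 σ, γ t ∈ Metric.closedBall c 1 := by
    intro t ht
    have hTt := hT 0 t le_rfl ht.1 ht.2
    rw [sub_zero] at hTt
    obtain ⟨ζ, hζ, h0, h1⟩ := reach_of_drivingTime_le (c := c) hR ht.1 hL0.le hL1
      (by rw [← hc, dist_self]; linarith [hLt t ht.2]) hTt.le
    rw [← h1]
    refine hζ.mem_closedBall hL0.le hL1 ?_ t ⟨ht.1, le_rfl⟩
    rw [h0, dist_self]
    linarith [hLt' t ht.1 ht.2]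
  have hreach : ∀ s t, 0 ≤ s → s ≤ t → t ≤ σ → Reach (speedLimit R) (t - s) (γ s) (γ t) := by
    intro s t hs hst ht
    refine reach_of_drivingTime_le (c := c) hR (sub_nonneg.2 hst) hL0.le hL ?_
      (hT s t hs hst ht).le
    have := Metric.mem_closedBall.1 (hball s ⟨hs, hst.trans ht⟩)
    linarith [hLt (t - s) (by linarith)]
  have hlip : ∀ s t, 0 ≤ s → s ≤ t → t ≤ σ → dist (γ s) (γ t) ≤ L * (t - s) := by
    intro s t hs hst ht
    obtain ⟨ζ, hζ, h0, h1⟩ := hreach s t hs hst ht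
    have hb := hζ.mem_closedBall hL0.le hL (by
      have := Metric.mem_closedBall.1 (hball s ⟨hs, hst.trans ht⟩)
      rw [h0]
      linarith [hLt' (t - s) (by linarith) (by linarith)])
    have := hζ.dist_le le_rfl hζ.1 le_rfl hL0.le fun u hu => hL _ (hb u (Ioo_subset_Icc_self hu))
    rwa [h0, h1, sub_zero] at this
  -- A metric geodesic is not known to satisfy the integral inequality. Between consecutive times of
  -- a subdivision it is replaced by a V-path with the same endpoints and the same duration; these
  -- interpolations converge to `γ`, which is thus a V-path.
  have hinterp : ∀ n : ℕ, ∃ ζ, IsFieldPath (speedLimit R) σ ζ ∧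
      ∀ i ≤ n + 1, ζ (i * (σ / (n + 1))) = γ (i * (σ / (n + 1))) := by
    intro n
    set k : ℝ := σ / (n + 1) with hk
    have hk0 : 0 < k := by positivity
    have hkσ : ((n + 1 : ℕ) : ℝ) * k = σ := by
      rw [hk]
      push_cast
      field_simp
    have hik : ∀ i : ℕ, i ≤ n + 1 → i * k ≤ σ := fun i hi => by
      rw [← hkσ]
      gcongr
    have : ∀ j ≤ n + 1, ∃ ζ, IsFieldPath (speedLimit R) (j * k) ζ ∧
        ∀ i ≤ j, ζ (i * k) = γ (i * k) := by
      intro j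
      induction j with
      | zero =>
        intro _
        refine ⟨fun _ => γ 0, ⟨by simp, continuousOn_const, by simp⟩, fun i hi => ?_⟩
        obtain rfl : i = 0 := by omega
        simp
      | succ j ihj =>
        intro hj
        obtain ⟨ζ, hζ, hζi⟩ := ihj (by omega)
        obtain ⟨ξ, hξ, hξ0, hξ1⟩ := hreach (j * k) ((j + 1 : ℕ) * k) (by positivity)
          (by push_cast; nlinarith) (hik _ hj)
        have hstep : ((j + 1 : ℕ) : ℝ) * k - j * k = k := by push_cast; ring
        rw [hstep] at hξ hξ1
        have hcat := hζ.concat hξ (by rw [hζi j le_rfl, hξ0])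
        have hadd : (j : ℝ) * k + k = (j + 1 : ℕ) * k := by push_cast; ring
        rw [hadd] at hcat
        refine ⟨_, hcat, fun i hi => ?_⟩
        rcases hi.lt_or_eq with hi | rfl
        · have hle : (i : ℝ) * k ≤ j * k := by
            gcongr
            omega
          simp only [hle, if_true]
          exact hζi i (by omega)
        · have hlt : ¬((j + 1 : ℕ) : ℝ) * k ≤ j * k := by push_cast; nlinarith
          simp only [hlt, if_false, hstep]
          exact hξ1
    obtain ⟨ζ, hζ, hζi⟩ := this (n + 1) le_rfl
    rw [hkσ] at hζ
    exact ⟨ζ, hζ, hζi⟩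
  choose ζ hζ hζi using hinterp
  have hζball : ∀ n, ∀ t ∈ Icc 0 σ, ζ n t ∈ Metric.closedBall c 2 := by
    intro n
    refine (hζ n).mem_closedBall hL0.le hL ?_
    have h0 := hζi n 0 (by omega)
    simp only [Nat.cast_zero, zero_mul] at h0
    rw [h0, ← hc, dist_self]
    linarith [hLt' σ hσ0.le le_rfl]
  have hclose : ∀ n, ∀ t ∈ Icc 0 σ, dist (ζ n t) (γ t) ≤ 2 * L * (σ / ((n : ℝ) + 1)) := by
    intro n t ht
    set k : ℝ := σ / ((n : ℝ) + 1) with hk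
    have hk0 : 0 < k := by positivity
    have hkσ : ((n : ℝ) + 1) * k = σ := by
      rw [hk]
      field_simp
    set i := ⌊t / k⌋₊ with hi
    have hi1 : i * k ≤ t := by
      have := Nat.floor_le (div_nonneg ht.1 hk0.le)
      rwa [le_div_iff₀ hk0] at this
    have hi2 : t ≤ i * k + k := by
      have := (Nat.lt_floor_add_one (t / k)).le
      rw [div_le_iff₀ hk0] at this
      linarith
    have hin : i ≤ n + 1 := by
      have : (i : ℝ) * k ≤ ((n : ℝ) + 1) * k := by linarith [ht.2]
      have := le_of_mul_le_mul_right this hk0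
      exact_mod_cast this
    have hik0 : 0 ≤ i * k := by positivity
    have d1 := (hζ n).dist_le hik0 hi1 ht.2 hL0.le fun u hu =>
      hL _ (hζball n u ⟨hik0.trans hu.1.le, hu.2.le.trans ht.2⟩)
    have d2 := hlip (i * k) t hik0 hi1 ht.2
    rw [hζi n i hin] at d1
    have d3 := dist_triangle_left (ζ n t) (γ t) (γ (i * k))
    nlinarith
  refine ⟨σ, hσ0, hστ, isVPath_of_tendsto hR (γn := ζ) (η := fun _ => 0) hσ0.le tendsto_const_nhds
    (fun _ => zero_le_one) hζball (by simpa using hζ) fun t ht => ?_, ?_⟩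
  · rw [tendsto_iff_dist_tendsto_zero]
    refine squeeze_zero (fun _ => dist_nonneg) (fun n => hclose n t ht) ?_
    have := (tendsto_const_div_atTop_nhds_zero_nat σ).comp (tendsto_add_atTop_nat 1)
    simpa using this.const_mul (2 * L)
  · have := hT 0 σ le_rfl hσ0.le le_rfl
    rwa [sub_zero] at this

/-- Pigeonhole: two of the m + 1 geodesics pass through the same cut point, which is not `x`. -/
theorem not_isPlusStar {R : Set (Road d)} (hR : IsLocallyFinite R) {m : ℕ} {x : E d}
    (h : HasSmallCutSets R m x) : ¬ IsPlusStar R (m + 1) x := by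
  rintro ⟨τ, γ, hγ, hdisj⟩
  choose σ hσ0 hστ hσ using fun i => (hγ i).2.1.exists_isGeodesicVPath hR (hγ i).1
  have hne : ∀ i, 0 < dist (γ i (σ i)) x := by
    intro i
    refine dist_pos.2 fun heq => ?_
    have h1 := (hσ i).2
    rw [(hγ i).2.2, heq] at h1
    have h2 := drivingTime_le (Reach.refl (speedLimit R) le_rfl x)
    rw [h1, ENNReal.ofReal_zero] at h2
    exact absurd (ENNReal.ofReal_eq_zero.1 (le_antisymm h2 (zero_le))) (not_le.2 (hσ0 i))
  obtain ⟨i₀, hi₀⟩ := Finite.exists_min fun i => dist (γ i (σ i)) x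
  -- Half the least distance from `x` to an endpoint, so that every geodesic ends outside the ball.
  obtain ⟨η, hη0, -, Z, hZ, hZc, hcut⟩ := h (dist (γ i₀ (σ i₀)) x / 2) (half_pos (hne i₀))
  have hex : ∀ i, ∃ z ∈ Z, ∃ t ∈ Icc 0 (σ i), γ i t = z := fun i =>
    hcut (σ i) (γ i) (hσ i) (by rw [(hγ i).2.2]; exact Metric.mem_closedBall_self hη0.le) (by
      rw [Metric.mem_closedBall, not_le]
      linarith [hi₀ i, hne i₀])
  choose z hz t ht hzt using hex
  obtain ⟨i, -, j, -, hij, hzij⟩ := Finset.exists_ne_map_eq_of_card_lt_of_maps_to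
    (s := Finset.univ) (t := Z) (f := z) (by simpa using Nat.lt_succ_of_le hZc)
    fun i _ => hz i
  have hpos : ∀ i, t i ∈ Ioc 0 (τ i) := by
    intro i
    refine ⟨(ht i).1.lt_of_ne fun h0 => ?_, (ht i).2.trans (hστ i)⟩
    have : z i = x := by rw [← hzt i, ← h0, (hγ i).2.2]
    exact (hZ (hz i)).2 (this ▸ Metric.mem_closedBall_self hη0.le)
  refine disjoint_left.1 (hdisj hij) ⟨t i, hpos i, hzt i⟩ ⟨t j, hpos j, ?_⟩
  rw [hzt j, hzij]

end Stars

/-! ### Grids -/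

section Grid

variable {d : ℕ}

/-- The point of the cubic lattice of mesh `h` and origin `z` with integer coordinates `n`. -/
noncomputable def gridPt (z : E d) (h : ℝ) (n : Fin d → ℤ) : E d :=
  z + h • WithLp.toLp 2 fun i => (n i : ℝ)

/-- The integer vectors whose coordinates are at most `N` in absolute value. -/
noncomputable def grid (d N : ℕ) : Finset (Fin d → ℤ) :=
  Fintype.piFinset fun _ => Finset.Icc (-(N : ℤ)) N

theorem card_grid (d N : ℕ) : (grid d N).card = (2 * N + 1) ^ d := by
  rw [grid, Fintype.card_piFinset_const, Int.card_Icc]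
  congr 1
  omega

theorem norm_le_of_coord_le {x : E d} {h : ℝ} (hx : ∀ i, |x i| ≤ h) (hh : 0 ≤ h) :
    ‖x‖ ≤ d * h := by
  rw [EuclideanSpace.norm_eq]
  refine Real.sqrt_le_iff.2 ⟨by positivity, ?_⟩
  calc ∑ i, ‖x i‖ ^ 2 ≤ ∑ _i : Fin d, h ^ 2 := by
        refine Finset.sum_le_sum fun i _ => ?_
        rw [Real.norm_eq_abs]
        exact pow_le_pow_left₀ (abs_nonneg _) (hx i) 2
    _ = d * h ^ 2 := by simp
    _ ≤ (d * h) ^ 2 := by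
        rw [mul_pow]
        have : (d : ℝ) ≤ (d : ℝ) ^ 2 := by exact_mod_cast Nat.le_self_pow two_ne_zero d
        exact mul_le_mul_of_nonneg_right this (sq_nonneg h)

theorem exists_gridPt_dist_le (z y : E d) {h ϱ : ℝ} (hh : 0 < h) {N : ℕ}
    (hy : dist y z ≤ ϱ) (hN : ϱ + h ≤ N * h) :
    ∃ n ∈ grid d N, dist y (gridPt z h n) ≤ d * h := by
  set n : Fin d → ℤ := fun i => ⌊(y i - z i) / h⌋ with hn
  have h1 : ∀ i, (n i : ℝ) * h ≤ y i - z i := fun i => by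
    have := Int.floor_le ((y i - z i) / h)
    rwa [le_div_iff₀ hh] at this
  have h2 : ∀ i, y i - z i ≤ n i * h + h := fun i => by
    have := (Int.lt_floor_add_one ((y i - z i) / h)).le
    rw [div_le_iff₀ hh] at this
    linarith
  refine ⟨n, Fintype.mem_piFinset.2 fun i => Finset.mem_Icc.2 ?_, ?_⟩
  · have h3 : |y i - z i| ≤ ϱ := by
      have := PiLp.norm_apply_le (y - z) i
      rw [Real.norm_eq_abs, ← dist_eq_norm] at this
      exact this.trans hy
    obtain ⟨h4, h5⟩ := abs_le.1 h3
    constructor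
    · have h6 : -(N : ℝ) * h ≤ n i * h := by linarith [h2 i]
      have := le_of_mul_le_mul_right h6 hh
      exact_mod_cast this
    · have h6 : (n i : ℝ) * h ≤ N * h := by linarith [h1 i]
      have := le_of_mul_le_mul_right h6 hh
      exact_mod_cast this
  · rw [dist_eq_norm]
    refine norm_le_of_coord_le (fun i => ?_) hh.le
    have : (y - gridPt z h n) i = y i - z i - n i * h := by
      simp [gridPt]
      ring
    rw [this, abs_of_nonneg (by linarith [h1 i])]
    linarith [h2 i]

end Grid

/-! ### Hierarchical connections -/

section Connections

variable {d : ℕ}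

/-- At scale `b^(-(k+j))` in a ball of radius of order `b^(-k)` around `z`, all pairs of points at
bounded relative distance are almost joined by a road, of speed limit in a prescribed window. -/
def Connects (R : Set (Road d)) (b : ℕ) (σ a : ℝ) (z : E d) (k j : ℕ) : Prop :=
  ∀ m ∈ grid d (16 * d * b ^ (j + 1) + 1), ∀ m' ∈ grid d (16 * d * b ^ (j + 1) + 1),
    dist (gridPt z ((b : ℝ)⁻¹ ^ (k + j + 1) / d) m) (gridPt z ((b : ℝ)⁻¹ ^ (k + j + 1) / d) m') ≤
      10 * b * (b : ℝ)⁻¹ ^ (k + j + 1) →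
    ∃ r ∈ R, a * 4⁻¹ ^ j * σ ^ (k + j) ≤ (r.2 : ℝ) ∧ (r.2 : ℝ) < 2 * (a * 4⁻¹ ^ j * σ ^ (k + j)) ∧
      r.1 ∈ hits (gridPt z ((b : ℝ)⁻¹ ^ (k + j + 1) / d) m) ((b : ℝ)⁻¹ ^ (k + j + 1)) ∧
      r.1 ∈ hits (gridPt z ((b : ℝ)⁻¹ ^ (k + j + 1) / d) m') ((b : ℝ)⁻¹ ^ (k + j + 1))

/-- Both points are rounded to the grid, with error at most b^(-(k+j+1)) since the mesh is smaller
by the factor `d`. The rounded points are within 8b^(-(k+j)) + 2b^(-(k+j+1)) ≤ 10b^(-(k+j)), the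
threshold in `Connects`. -/
theorem Connects.exists_road {R : Set (Road d)} (hd : d ≠ 0) {b : ℕ} (hb : 4 ≤ b) {σ a : ℝ}
    {z : E d} {k j : ℕ} (h : Connects R b σ a z k j) {y y' : E d}
    (hy : dist y z ≤ 16 * (b : ℝ)⁻¹ ^ k) (hy' : dist y' z ≤ 16 * (b : ℝ)⁻¹ ^ k)
    (hyy' : dist y y' ≤ 8 * (b : ℝ)⁻¹ ^ (k + j)) :
    ∃ r ∈ R, a * 4⁻¹ ^ j * σ ^ (k + j) ≤ (r.2 : ℝ) ∧ ∃ p ∈ r.1.carrier, ∃ p' ∈ r.1.carrier,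
      dist y p ≤ 2 * (b : ℝ)⁻¹ ^ (k + j + 1) ∧ dist y' p' ≤ 2 * (b : ℝ)⁻¹ ^ (k + j + 1) := by
  have hb0 : (0 : ℝ) < b := by positivity
  have hd0 : (0 : ℝ) < d := by positivity
  have hd1 : (1 : ℝ) ≤ d := by exact_mod_cast Nat.one_le_iff_ne_zero.2 hd
  set ϱ : ℝ := (b : ℝ)⁻¹ ^ (k + j + 1) with hϱ
  have hϱ0 : 0 < ϱ := by positivity
  have hϱk : (b : ℝ) ^ (j + 1) * ϱ = (b : ℝ)⁻¹ ^ k := by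
    rw [hϱ, add_assoc, pow_add (b : ℝ)⁻¹, mul_left_comm, ← mul_pow, mul_inv_cancel₀ hb0.ne', one_pow,
      mul_one]
  have hϱj : (b : ℝ) * ϱ = (b : ℝ)⁻¹ ^ (k + j) := by
    rw [hϱ, pow_succ, mul_left_comm, mul_inv_cancel₀ hb0.ne', mul_one]
  have hN : 16 * (b : ℝ)⁻¹ ^ k + ϱ / d ≤ (16 * d * b ^ (j + 1) + 1 : ℕ) * (ϱ / d) := by
    push_cast
    rw [add_mul, one_mul, ← hϱk]
    refine add_le_add (le_of_eq ?_) le_rfl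
    field_simp
  obtain ⟨m, hm, hmd⟩ := exists_gridPt_dist_le z y (div_pos hϱ0 hd0) hy hN
  obtain ⟨m', hm', hmd'⟩ := exists_gridPt_dist_le z y' (div_pos hϱ0 hd0) hy' hN
  rw [mul_div_cancel₀ _ hd0.ne'] at hmd hmd'
  have hb4 : (4 : ℝ) ≤ b := by exact_mod_cast hb
  obtain ⟨r, hr, hrv, -, ⟨p, hp, hpm⟩, p', hp', hpm'⟩ := h m hm m' hm' (by
    have := dist_triangle4 (gridPt z (ϱ / d) m) y y' (gridPt z (ϱ / d) m')
    rw [dist_comm (gridPt z (ϱ / d) m) y] at this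
    rw [← hϱj] at hyy'
    nlinarith)
  refine ⟨r, hr, hrv, p, hp, p', hp', ?_, ?_⟩
  · have := dist_triangle_right y p (gridPt z (ϱ / d) m)
    linarith
  · have := dist_triangle_right y' p' (gridPt z (ϱ / d) m')
    linarith

/-- At level `j` one drives from `y` to a nearby point of a road, along the road, and from the road
to `y'`; both gaps are handled at level `j + 1`. Up to a common factor the road costs 16θ^j, and
32θ^j solves the recursion because 2·32·θ + 16 ≤ 32 when θ = 4q/σ ≤ 1/4. This is where 16q ≤ σ
enters. -/
theorem reach_add_of_connects {R : Set (Road d)} (hd : d ≠ 0) {b : ℕ} (hb : 4 ≤ b) {σ a : ℝ}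
    (ha : 0 < a) (hσ0 : 0 < σ) (hσ1 : σ ≤ 1) (hσ : 16 * (b : ℝ)⁻¹ ≤ σ) {z : E d} {k : ℕ}
    (h : ∀ j, Connects R b σ a z k j) {η : ℝ} (hη : 0 < η) {y y' : E d}
    (hy : dist y z ≤ 8 * (b : ℝ)⁻¹ ^ k) (hy' : dist y' z ≤ 8 * (b : ℝ)⁻¹ ^ k)
    (hyy' : dist y y' ≤ 8 * (b : ℝ)⁻¹ ^ k) :
    Reach (fun p => speedLimit R p + ENNReal.ofReal η) (32 / a * ((b : ℝ)⁻¹ / σ) ^ k) y y' := by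
  have hb0 : (0 : ℝ) < b := by positivity
  have hb4 : (4 : ℝ) ≤ b := by exact_mod_cast hb
  set q : ℝ := (b : ℝ)⁻¹ with hq
  have hq0 : 0 < q := inv_pos.2 hb0
  have hq4 : q ≤ 4⁻¹ := inv_anti₀ (by norm_num) hb4
  set θ : ℝ := 4 * (q / σ) with hθ
  have hθ0 : 0 < θ := by positivity
  have hθ4 : θ ≤ 4⁻¹ := by
    rw [hθ, mul_div_assoc', div_le_iff₀ hσ0]
    linarith
  -- At depth `n` the extra speed `η` is at least the speed that a road would have to offer, so the
  -- recursion can stop.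
  obtain ⟨n, hn⟩ : ∃ n : ℕ, a * 4⁻¹ ^ n ≤ η := by
    obtain ⟨n, hn⟩ := exists_pow_lt_of_lt_one (div_pos hη ha) (by norm_num : (4 : ℝ)⁻¹ < 1)
    refine ⟨n, ?_⟩
    rw [lt_div_iff₀ ha] at hn
    linarith
  -- Induction on the number `i` of levels left. The radius (16 - 8q^j)q^k grows with `j` to leave
  -- room for the drift of the endpoints, yet never exceeds the radius 16q^k covered by the grids.
  have key : ∀ i j : ℕ, i + j = n → ∀ y y' : E d, dist y z ≤ (16 - 8 * q ^ j) * q ^ k →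
      dist y' z ≤ (16 - 8 * q ^ j) * q ^ k → dist y y' ≤ 8 * q ^ (k + j) →
      Reach (fun p => speedLimit R p + ENNReal.ofReal η) (32 / a * (q / σ) ^ k * θ ^ j) y y' := by
    intro i
    induction i with
    | zero =>
      intro j hj y y' _ _ hyy'
      obtain rfl : j = n := by omega
      refine Reach.of_segment (by positivity) hη.le (fun p _ => le_add_self) (hyy'.trans ?_)
      have e1 : (q / σ) ^ k * θ ^ j = q ^ (k + j) * 4 ^ j / σ ^ (k + j) := by
        rw [hθ, mul_pow, div_pow, div_pow, pow_add, pow_add]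
        field_simp
      rw [mul_assoc (32 / a), e1]
      have e2 : η * (32 / a * (q ^ (k + j) * 4 ^ j / σ ^ (k + j))) =
          q ^ (k + j) * (32 * η * 4 ^ j / (a * σ ^ (k + j))) := by
        field_simp
      rw [e2, mul_comm 8]
      refine mul_le_mul_of_nonneg_left ?_ (by positivity)
      rw [le_div_iff₀ (by positivity)]
      have h1 : a * σ ^ (k + j) ≤ a := mul_le_of_le_one_right ha.le (pow_le_one₀ hσ0.le hσ1)
      have h2 : a ≤ η * 4 ^ j := by
        rwa [inv_pow, ← div_eq_mul_inv, div_le_iff₀ (by positivity)] at hn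
      nlinarith
    | succ i ih =>
      intro j hj y y' hy hy' hyy'
      have hqk : 0 < q ^ k := by positivity
      have hqj : 0 < q ^ j := by positivity
      have hqj1 : q ^ (k + j + 1) = q ^ k * q ^ j * q := by rw [pow_succ, pow_add]
      obtain ⟨r, hr, hrv, p, hp, p', hp', hyp, hyp'⟩ := (h j).exists_road hd hb
        (hy.trans (by rw [← hq]; nlinarith)) (hy'.trans (by rw [← hq]; nlinarith)) hyy'
      rw [← hq, hqj1] at hyp hyp'
      have hqq : q ^ k * q ^ j * q ≤ q ^ k * q ^ j * 4⁻¹ :=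
        mul_le_mul_of_nonneg_left hq4 (by positivity)
      have hyz : (16 - 8 * q ^ j) * q ^ k + 2 * (q ^ k * q ^ j * q) ≤
          (16 - 8 * q ^ (j + 1)) * q ^ k := by
        rw [pow_succ]
        nlinarith [mul_pos hqk hqj]
      have hy1 : dist y z ≤ (16 - 8 * q ^ (j + 1)) * q ^ k :=
        le_trans (by nlinarith [mul_pos (mul_pos hqk hqj) hq0]) hyz
      have hy1' : dist y' z ≤ (16 - 8 * q ^ (j + 1)) * q ^ k :=
        le_trans (by nlinarith [mul_pos (mul_pos hqk hqj) hq0]) hyz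
      have hpz : dist p z ≤ (16 - 8 * q ^ (j + 1)) * q ^ k := by
        have := dist_triangle_left p z y
        linarith
      have hpz' : dist p' z ≤ (16 - 8 * q ^ (j + 1)) * q ^ k := by
        have := dist_triangle_left p' z y'
        linarith
      have e1 : q ^ (k + (j + 1)) = q ^ k * q ^ j * q := by rw [← add_assoc, hqj1]
      have hpos : 0 < q ^ k * q ^ j * q := by positivity
      have r1 := ih (j + 1) (by omega) y p hy1 hpz (by rw [e1]; linarith)
      have r3 := ih (j + 1) (by omega) p' y' hpz' hy1' (by
        rw [e1, dist_comm]
        linarith)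
      have hpp' : dist p p' ≤ 16 * q ^ (k + j) := by
        have := dist_triangle4 p y y' p'
        rw [dist_comm p y] at this
        rw [pow_add] at hyy' ⊢
        linarith
      have hw0 : 0 < a * 4⁻¹ ^ j * σ ^ (k + j) := by positivity
      have r2 : Reach (fun p => speedLimit R p + ENNReal.ofReal η)
          (16 / a * (q / σ) ^ k * θ ^ j) p p' := by
        refine Reach.of_segment (by positivity) hw0.le (fun x hx => ?_) (hpp'.trans ?_)
        · refine le_add_right ((ENNReal.ofReal_le_ofReal hrv).trans (le_speedLimit hr ?_))
          exact r.1.carrier.convex.segment_subset hp hp' hx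
        · refine le_of_eq ?_
          rw [hθ, mul_pow, div_pow, div_pow, pow_add, pow_add, inv_pow]
          have h4 : (4 : ℝ) ^ j ≠ 0 := by positivity
          field_simp
          rw [← mul_pow]
          norm_num
      refine ((r1.trans r2).trans r3).mono ?_
      have hT : 0 ≤ 1 / a * (q / σ) ^ k * θ ^ j := by positivity
      have e2 : 32 / a * (q / σ) ^ k * θ ^ (j + 1) = 32 * (1 / a * (q / σ) ^ k * θ ^ j) * θ := by
        rw [pow_succ]
        ring
      have e3 : ∀ c : ℝ, c / a * (q / σ) ^ k * θ ^ j = c * (1 / a * (q / σ) ^ k * θ ^ j) := by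
        intro c
        ring
      rw [e2, e3 16, e3 32]
      generalize 1 / a * (q / σ) ^ k * θ ^ j = X at hT
      have h5 := mul_le_mul_of_nonneg_left hθ4 hT
      linarith
  have := key n 0 (by omega) y y' (hy.trans (by rw [pow_zero]; nlinarith [pow_pos hq0 k]))
    (hy'.trans (by rw [pow_zero]; nlinarith [pow_pos hq0 k])) (by simpa using hyy')
  simpa using this

/-- The duration does not depend on `η`, so one may let `η` tend to 0. -/
theorem reach_of_connects {R : Set (Road d)} (hR : IsLocallyFinite R) (hd : d ≠ 0) {b : ℕ}
    (hb : 4 ≤ b) {σ a : ℝ} (ha : 0 < a) (hσ0 : 0 < σ) (hσ1 : σ ≤ 1) (hσ : 16 * (b : ℝ)⁻¹ ≤ σ)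
    {z : E d} {k : ℕ} (h : ∀ j, Connects R b σ a z k j) {y y' c : E d}
    (hy : dist y z ≤ 8 * (b : ℝ)⁻¹ ^ k) (hy' : dist y' z ≤ 8 * (b : ℝ)⁻¹ ^ k)
    (hyy' : dist y y' ≤ 8 * (b : ℝ)⁻¹ ^ k) {L ϱ : ℝ} (hL : 0 ≤ L)
    (hV : ∀ y ∈ Metric.closedBall c ϱ, speedLimit R y ≤ ENNReal.ofReal L)
    (hc : dist y c + (L + 1) * (32 / a * ((b : ℝ)⁻¹ / σ) ^ k) < ϱ) :
    Reach (speedLimit R) (32 / a * ((b : ℝ)⁻¹ / σ) ^ k) y y' := by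
  refine Reach.of_tendsto hR (η := fun n : ℕ => ENNReal.ofReal (1 / ((n : ℝ) + 1))) ?_ ?_ hL hV hc
    (tendsto_const_nhds (x := y')) fun n =>
      reach_add_of_connects hd hb ha hσ0 hσ1 hσ h (by positivity) hy hy' hyy'
  · rw [← ENNReal.ofReal_zero]
    exact ENNReal.tendsto_ofReal tendsto_one_div_add_atTop_nhds_zero_nat
  · intro n
    rw [← ENNReal.ofReal_one]
    refine ENNReal.ofReal_le_ofReal ?_
    rw [div_le_one (by positivity)]
    linarith [Nat.cast_nonneg (α := ℝ) n]

end Connections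

/-! ### Rotations -/

section Rotations

variable {d : ℕ}

theorem rot_add (g : SO d) (x y : E d) : rot g (x + y) = rot g x + rot g y := by
  simp [rot, Matrix.mulVec_add]

theorem rot_sub (g : SO d) (x y : E d) : rot g (x - y) = rot g x - rot g y := by
  simp [rot, Matrix.mulVec_sub]

theorem rot_smul (g : SO d) (t : ℝ) (x : E d) : rot g (t • x) = t • rot g x := by
  simp [rot, Matrix.mulVec_smul]

theorem rot_mul (g h : SO d) (x : E d) : rot (g * h) x = rot g (rot h x) := by
  simp [rot, Matrix.mulVec_mulVec]

theorem rot_one (x : E d) : rot 1 x = x := by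
  simp [rot]

theorem rot_rot_inv (g : SO d) (x : E d) : rot g (rot g⁻¹ x) = x := by
  rw [← rot_mul, mul_inv_cancel, rot_one]

theorem norm_rot (g : SO d) (x : E d) : ‖rot g x‖ = ‖x‖ := by
  have h : ∀ y : E d, ‖y‖ ^ 2 = y.ofLp ⬝ᵥ y.ofLp := by
    intro y
    rw [EuclideanSpace.real_norm_sq_eq]
    simp [dotProduct, sq]
  have : ‖rot g x‖ ^ 2 = ‖x‖ ^ 2 := by
    rw [h, h]
    simp only [rot]
    rw [Matrix.dotProduct_mulVec, ← Matrix.mulVec_transpose, Matrix.mulVec_mulVec,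
      SO.transpose_mul, Matrix.one_mulVec]
  exact (sq_eq_sq₀ (norm_nonneg _) (norm_nonneg _)).1 this

theorem continuous_rot (x : E d) : Continuous fun g : SO d => rot g x := by
  unfold rot
  refine (PiLp.continuous_toLp 2 _).comp ?_
  exact Continuous.matrix_mulVec continuous_subtype_val continuous_const

theorem exists_rot_e₁_eq (hd : 2 ≤ d) {u : E d} (hu : ‖u‖ = 1) : ∃ g : SO d, rot g (e₁ d) = u := by
  have h0 : 0 < d := by omega
  set i₀ : Fin d := ⟨0, h0⟩
  set i₁ : Fin d := ⟨1, by omega⟩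
  have hi : i₀ ≠ i₁ := by simp [i₀, i₁]
  obtain ⟨B, hB⟩ := Orthonormal.exists_orthonormalBasis_extension_of_card_eq (𝕜 := ℝ) (E := E d)
    (ι := Fin d) (by simp) (v := fun _ => u) (s := {i₀}) (by
      rw [orthonormal_iff_ite]
      rintro ⟨i, rfl⟩ ⟨j, rfl⟩
      simp [hu])
  set A : Matrix (Fin d) (Fin d) ℝ := Matrix.of fun i j => B j i with hA
  have hAA : A.transpose * A = 1 := by
    ext i j
    have := (orthonormal_iff_ite.1 B.orthonormal) i j
    rw [PiLp.inner_apply] at this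
    simp only [Matrix.mul_apply, Matrix.transpose_apply, hA, Matrix.of_apply, Matrix.one_apply]
    rw [← this]
    refine Finset.sum_congr rfl fun k _ => ?_
    simp [mul_comm]
  have hdet : A.det * A.det = 1 := by
    have := congrArg Matrix.det hAA
    rwa [Matrix.det_mul, Matrix.det_transpose, Matrix.det_one] at this
  -- Multiplying the second column by the determinant, which is ±1, puts the matrix in SO without
  -- changing the image of the first basis vector.
  set c : Fin d → ℝ := fun j => if j = i₁ then A.det else 1 with hc
  have hcc : ∀ j, c j * c j = 1 := by
    intro j
    by_cases hj : j = i₁ <;> simp [hc, hj, hdet]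
  set A' : Matrix (Fin d) (Fin d) ℝ := A * Matrix.diagonal c with hA'
  have hA'A' : A'.transpose * A' = 1 := by
    rw [hA', Matrix.transpose_mul, Matrix.diagonal_transpose, Matrix.mul_assoc,
      ← Matrix.mul_assoc A.transpose, hAA, Matrix.one_mul, Matrix.diagonal_mul_diagonal]
    simp [hcc]
  have hdet' : A'.det = 1 := by
    rw [hA', Matrix.det_mul, Matrix.det_diagonal]
    simp [hc, hdet]
  refine ⟨⟨A', Matrix.mem_specialOrthogonalGroup_iff.2
    ⟨(Matrix.mem_orthogonalGroup_iff' (Fin d) ℝ).2 hA'A', hdet'⟩⟩, ?_⟩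
  have he₁ : (e₁ d).ofLp = Pi.single i₀ 1 := by
    ext i
    simp [e₁, Pi.single_apply, i₀, Fin.ext_iff]
  have hBu : B i₀ = u := hB i₀ rfl
  ext i
  simp only [rot]
  rw [he₁, Matrix.mulVec_single_one]
  simp [hA', hA, hc, hi, hBu]

instance : IsProbabilityMeasure (haarSO d) := ⟨by
  have := Measure.haarMeasure_self (G := SO d) (K₀ := ⊤)
  simpa [haarSO] using this⟩

instance : (haarSO d).IsHaarMeasure := by
  unfold haarSO
  infer_instance

end Rotations

/-! ### The measure of the set of lines that meet given balls -/

section LineMeasure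

variable {d : ℕ} [NeZero d]

/-- The first coordinate. -/
def headCoord (x : E d) : ℝ := x ⟨0, Nat.pos_of_ne_zero (NeZero.ne d)⟩

/-- The coordinates other than the first one. -/
def tailCoord (x : E d) : Fin (d - 1) → ℝ := fun i => x ⟨i.val + 1, by omega⟩

theorem continuous_tailCoord {d : ℕ} : Continuous (tailCoord : E d → Fin (d - 1) → ℝ) := by
  unfold tailCoord
  fun_prop

theorem norm_sq_inHyperplane_add (w : Fin (d - 1) → ℝ) (t : ℝ) (x : E d) :
    ‖inHyperplane w + t • e₁ d - x‖ ^ 2 =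
      (t - headCoord x) ^ 2 + ∑ i, (w i - tailCoord x i) ^ 2 := by
  obtain ⟨n, rfl⟩ : ∃ n, d = n + 1 := ⟨d - 1, by have := NeZero.ne d; omega⟩
  rw [EuclideanSpace.real_norm_sq_eq, Fin.sum_univ_succ]
  congr 1
  · simp [inHyperplane, e₁, headCoord]
  · refine Finset.sum_congr rfl fun i _ => ?_
    simp [inHyperplane, e₁, tailCoord]
    rfl

theorem mem_lineMap_carrier {w : Fin (d - 1) → ℝ} {g : SO d} {y : E d} :
    y ∈ (lineMap d (w, g)).carrier ↔ ∃ t : ℝ, y = rot g (inHyperplane w + t • e₁ d) := by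
  change y ∈ AffineSubspace.mk' (rot g (inHyperplane w)) _ ↔ _
  rw [AffineSubspace.mem_mk', Submodule.mem_span_singleton]
  refine exists_congr fun t => ?_
  rw [rot_add, rot_smul, vsub_eq_sub, eq_sub_iff_add_eq, add_comm, eq_comm]

/-- Rotating by the inverse of `g` makes the line parallel to the first axis, and its distance to
`p` is then read off the other coordinates. -/
theorem lineMap_mem_hits_iff {w : Fin (d - 1) → ℝ} {g : SO d} {p : E d} {ϱ : ℝ} (hϱ : 0 ≤ ϱ) :
    lineMap d (w, g) ∈ hits p ϱ ↔ ∑ i, (w i - tailCoord (rot g⁻¹ p) i) ^ 2 ≤ ϱ ^ 2 := by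
  have hdist : ∀ t : ℝ, dist (rot g (inHyperplane w + t • e₁ d)) p ^ 2 =
      (t - headCoord (rot g⁻¹ p)) ^ 2 + ∑ i, (w i - tailCoord (rot g⁻¹ p) i) ^ 2 := by
    intro t
    rw [dist_eq_norm]
    nth_rewrite 1 [← rot_rot_inv g p]
    rw [← rot_sub, norm_rot, norm_sq_inHyperplane_add]
  constructor
  · rintro ⟨y, hy, hyp⟩
    obtain ⟨t, rfl⟩ := mem_lineMap_carrier.1 hy
    have h1 := pow_le_pow_left₀ dist_nonneg hyp 2
    rw [hdist] at h1
    nlinarith [sq_nonneg (t - headCoord (rot g⁻¹ p))]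
  · intro h
    refine ⟨_, mem_lineMap_carrier.2 ⟨headCoord (rot g⁻¹ p), rfl⟩, ?_⟩
    refine le_of_sq_le_sq ?_ hϱ
    rw [hdist]
    simpa using h

theorem measurable_lineMap : Measurable (lineMap d) :=
  continuous_coinduced_rng.measurable

/-- In the coinduced topology, closedness is tested on the preimage under `lineMap`, where it is a
continuous inequality. -/
theorem isClosed_hits (p : E d) {ϱ : ℝ} (hϱ : 0 ≤ ϱ) : IsClosed (hits p ϱ) := by
  rw [isClosed_coinduced]
  have : lineMap d ⁻¹' hits p ϱ =
      {x | ∑ i, (x.1 i - tailCoord (rot x.2⁻¹ p) i) ^ 2 ≤ ϱ ^ 2} := by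
    ext ⟨w, g⟩
    exact lineMap_mem_hits_iff hϱ
  rw [this]
  have hcont : Continuous fun x : (Fin (d - 1) → ℝ) × SO d => tailCoord (rot x.2⁻¹ p) :=
    continuous_tailCoord.comp ((continuous_rot p).comp continuous_snd.inv)
  refine isClosed_le (continuous_finsetSum _ fun i _ => ?_) continuous_const
  exact ((((continuous_apply i).comp continuous_fst)).sub ((continuous_apply i).comp hcont)).pow 2

theorem measurableSet_hits (p : E d) {ϱ : ℝ} (hϱ : 0 ≤ ϱ) : MeasurableSet (hits p ϱ) :=
  (isClosed_hits p hϱ).measurableSet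

theorem lineMeasure_apply {s : Set (Line d)} (hs : MeasurableSet s) :
    lineMeasure d s = ∫⁻ g, volume {w | lineMap d (w, g) ∈ s} ∂haarSO d := by
  rw [lineMeasure, Measure.map_apply measurable_lineMap hs,
    Measure.prod_apply_symm (measurable_lineMap hs)]
  rfl

theorem lineMeasure_hits_le (p : E d) {ϱ : ℝ} (hϱ : 0 ≤ ϱ) :
    lineMeasure d (hits p ϱ) ≤ ENNReal.ofReal ((2 * ϱ) ^ (d - 1)) := by
  rw [lineMeasure_apply (measurableSet_hits p hϱ)]
  calc ∫⁻ g, volume {w | lineMap d (w, g) ∈ hits p ϱ} ∂haarSO d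
      ≤ ∫⁻ _, ENNReal.ofReal ((2 * ϱ) ^ (d - 1)) ∂haarSO d := by
        refine lintegral_mono fun g => ?_
        -- A Euclidean ball lies in the cube of the same radius, whose volume is (2ϱ)^(d-1).
        have hsub : {w | lineMap d (w, g) ∈ hits p ϱ} ⊆
            Metric.closedBall (tailCoord (rot g⁻¹ p)) ϱ := by
          intro w hw
          have hw := (lineMap_mem_hits_iff hϱ).1 hw
          rw [Metric.mem_closedBall, dist_pi_le_iff hϱ]
          intro i
          rw [Real.dist_eq]
          refine abs_le_of_sq_le_sq (le_trans ?_ hw) hϱ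
          exact Finset.single_le_sum (f := fun i => (w i - tailCoord (rot g⁻¹ p) i) ^ 2)
            (fun i _ => sq_nonneg _) (Finset.mem_univ i)
        refine (measure_mono hsub).trans ?_
        rw [Real.volume_pi_closedBall _ hϱ, Fintype.card_fin]
    _ = ENNReal.ofReal ((2 * ϱ) ^ (d - 1)) := by simp

/-- A line that passes within ϱ/2 of `p`, in a direction within 1/(2K) of that of q - p, passes
within ϱ/2 + Kϱ/(2K) = ϱ of `q`. By invariance of Haar measure, the mass of such directions depends
only on `K` and `d`. -/
theorem exists_le_lineMeasure_hits_inter (hd : 2 ≤ d) {K : ℝ} (hK : 0 < K) :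
    ∃ c : ℝ, 0 < c ∧ ∀ (p q : E d) (ϱ : ℝ), 0 < ϱ → dist p q ≤ K * ϱ →
      ENNReal.ofReal (c * (ϱ / d) ^ (d - 1)) ≤ lineMeasure d (hits p ϱ ∩ hits q ϱ) := by
  have hd0 : (0 : ℝ) < d := by
    have : 0 < d := by omega
    exact_mod_cast this
  set U : Set (SO d) := {g | dist (rot g (e₁ d)) (e₁ d) < 1 / (2 * K)} with hU
  have hUo : IsOpen U := isOpen_lt ((continuous_rot _).dist continuous_const) continuous_const
  have hUpos : 0 < haarSO d U := hUo.measure_pos _ ⟨1, by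
    rw [hU, mem_ofPred_eq, rot_one, dist_self]
    positivity⟩
  have hUtop : haarSO d U ≠ ∞ := measure_ne_top _ _
  refine ⟨(haarSO d U).toReal, ENNReal.toReal_pos hUpos.ne' hUtop, fun p q ϱ hϱ hpq => ?_⟩
  obtain ⟨u, hu, hqp⟩ : ∃ u : E d, ‖u‖ = 1 ∧ q = p + dist p q • u := by
    rcases eq_or_ne p q with rfl | hne
    · refine ⟨EuclideanSpace.single ⟨0, by omega⟩ 1, by simp, by simp⟩
    · have h0 : dist p q ≠ 0 := dist_ne_zero.2 hne
      refine ⟨(dist p q)⁻¹ • (q - p), ?_, ?_⟩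
      · rw [norm_smul, norm_inv, Real.norm_of_nonneg dist_nonneg, ← dist_eq_norm, dist_comm q p]
        exact inv_mul_cancel₀ h0
      · rw [smul_smul, mul_inv_cancel₀ h0, one_smul]
        abel
  obtain ⟨g₀, hg₀⟩ := exists_rot_e₁_eq hd hu
  set U' : Set (SO d) := {g | dist (rot g (e₁ d)) u < 1 / (2 * K)} with hU'
  have hU'o : IsOpen U' := isOpen_lt ((continuous_rot _).dist continuous_const) continuous_const
  have hUU' : haarSO d U' = haarSO d U := by
    rw [← measure_preimage_mul (haarSO d) g₀ U']
    congr 1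
    ext h
    simp only [hU', hU, mem_preimage, mem_ofPred_eq]
    rw [← hg₀, rot_mul, dist_eq_norm, ← rot_sub, norm_rot, dist_eq_norm]
  rw [lineMeasure_apply ((measurableSet_hits p hϱ.le).inter (measurableSet_hits q hϱ.le))]
  have hϱd : 0 ≤ ϱ / (2 * d) := by positivity
  calc ENNReal.ofReal ((haarSO d U).toReal * (ϱ / d) ^ (d - 1))
      = ∫⁻ _ in U', ENNReal.ofReal ((ϱ / d) ^ (d - 1)) ∂haarSO d := by
        rw [setLIntegral_const, hUU', ENNReal.ofReal_mul ENNReal.toReal_nonneg,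
          ENNReal.ofReal_toReal hUtop, mul_comm]
    _ ≤ ∫⁻ g in U', volume {w | lineMap d (w, g) ∈ hits p ϱ ∩ hits q ϱ} ∂haarSO d := by
        refine setLIntegral_mono' hU'o.measurableSet fun g hg => ?_
        have hsub : Metric.closedBall (tailCoord (rot g⁻¹ p)) (ϱ / (2 * d)) ⊆
            {w | lineMap d (w, g) ∈ hits p ϱ ∩ hits q ϱ} := by
          intro w hw
          rw [Metric.mem_closedBall, dist_pi_le_iff hϱd] at hw
          have h1 : lineMap d (w, g) ∈ hits p (ϱ / 2) := by
            rw [lineMap_mem_hits_iff (by positivity)]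
            calc ∑ i, (w i - tailCoord (rot g⁻¹ p) i) ^ 2
                ≤ ∑ _i : Fin (d - 1), (ϱ / (2 * d)) ^ 2 := by
                  refine Finset.sum_le_sum fun i _ => ?_
                  rw [← sq_abs]
                  exact pow_le_pow_left₀ (abs_nonneg _) (hw i) 2
              _ = (d - 1 : ℕ) * (ϱ / (2 * d)) ^ 2 := by simp
              _ ≤ (d : ℝ) ^ 2 * (ϱ / (2 * d)) ^ 2 := by
                  refine mul_le_mul_of_nonneg_right ?_ (sq_nonneg _)
                  have : d - 1 ≤ d ^ 2 := (Nat.sub_le _ _).trans (Nat.le_self_pow two_ne_zero d)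
                  exact_mod_cast this
              _ = (ϱ / 2) ^ 2 := by
                  field_simp
          obtain ⟨y, hy, hyp⟩ := h1
          refine ⟨⟨y, hy, by linarith⟩, ?_⟩
          obtain ⟨t, rfl⟩ := mem_lineMap_carrier.1 hy
          refine ⟨_, mem_lineMap_carrier.2 ⟨t + dist p q, rfl⟩, ?_⟩
          have e : rot g (inHyperplane w + (t + dist p q) • e₁ d) =
              rot g (inHyperplane w + t • e₁ d) + dist p q • rot g (e₁ d) := by
            rw [← rot_smul, ← rot_add, add_smul, add_assoc]
          rw [e]
          nth_rewrite 2 [hqp]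
          refine (dist_add_add_le _ _ _ _).trans ?_
          rw [dist_smul₀, Real.norm_of_nonneg dist_nonneg]
          have hg' : dist (rot g (e₁ d)) u ≤ 1 / (2 * K) := le_of_lt hg
          have : dist p q * dist (rot g (e₁ d)) u ≤ K * ϱ * (1 / (2 * K)) :=
            mul_le_mul hpq hg' dist_nonneg (by positivity)
          have e2 : K * ϱ * (1 / (2 * K)) = ϱ / 2 := by field_simp
          linarith
        refine le_trans (le_of_eq ?_) (measure_mono hsub)
        rw [Real.volume_pi_closedBall _ hϱd, Fintype.card_fin]
        congr 2
        field_simp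
    _ ≤ ∫⁻ g, volume {w | lineMap d (w, g) ∈ hits p ϱ ∩ hits q ϱ} ∂haarSO d :=
        setLIntegral_le_lintegral _ _

end LineMeasure

/-! ### Estimates for Poisson processes -/

section Poisson

variable {Ω X : Type*} [MeasurableSpace Ω] [MeasurableSpace X] {P : Measure Ω} {ν : Measure X}
  {S : Ω → Set X}

theorem IsPoissonProcess.lintegral_encard (h : IsPoissonProcess P ν S) {B : Set X}
    (hB : MeasurableSet B) (hν : ν B ≠ ∞) (f : ℕ∞ → ℝ≥0∞) :
    ∫⁻ ω, f (S ω ∩ B).encard ∂P =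
      ∑' n : ℕ, ENNReal.ofReal (Real.exp (-(ν B).toReal) * (ν B).toReal ^ n / n.factorial) *
        f n := by
  have hf : Measurable f := measurable_of_countable f
  rw [← lintegral_map hf (h.measurable_encard B hB), h.map_encard B hB hν,
    lintegral_map hf (measurable_of_countable _), poissonMeasure, lintegral_sum_measure]
  refine tsum_congr fun n => ?_
  rw [lintegral_smul_measure, lintegral_dirac]
  rfl

theorem IsPoissonProcess.ae_finite (h : IsPoissonProcess P ν S) {B : Set X}
    (hB : MeasurableSet B) (hν : ν B ≠ ∞) : ∀ᵐ ω ∂P, (S ω ∩ B).Finite := by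
  have h1 := h.lintegral_encard hB hν fun n => if n = ⊤ then 1 else 0
  simp only [ENat.natCast_ne_top, if_false, mul_zero, tsum_zero] at h1
  have hmeas : Measurable fun ω => if (S ω ∩ B).encard = ⊤ then (1 : ℝ≥0∞) else 0 :=
    (measurable_of_countable fun n : ℕ∞ => if n = ⊤ then (1 : ℝ≥0∞) else 0).comp
      (h.measurable_encard B hB)
  rw [lintegral_eq_zero_iff hmeas] at h1
  filter_upwards [h1] with ω hω
  rw [← encard_ne_top_iff]
  intro htop
  simp [htop] at hω

theorem IsPoissonProcess.measure_inter_eq_empty (h : IsPoissonProcess P ν S) {B : Set X}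
    (hB : MeasurableSet B) (hν : ν B ≠ ∞) :
    P {ω | S ω ∩ B = ∅} = ENNReal.ofReal (Real.exp (-(ν B).toReal)) := by
  have h1 := h.lintegral_encard hB hν (({0} : Set ℕ∞).indicator 1)
  rw [tsum_eq_single 0 (fun n hn => by simp [hn])] at h1
  have h2 : (fun ω => ({0} : Set ℕ∞).indicator (1 : ℕ∞ → ℝ≥0∞) (S ω ∩ B).encard) =
      {ω | S ω ∩ B = ∅}.indicator 1 := by
    ext ω
    simp [indicator_apply]
  have hm : MeasurableSet {ω | S ω ∩ B = ∅} := by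
    have : {ω | S ω ∩ B = ∅} = (fun ω => (S ω ∩ B).encard) ⁻¹' {0} := by
      ext ω
      simp
    rw [this]
    exact h.measurable_encard B hB (measurableSet_singleton 0)
  rw [h2, lintegral_indicator_one hm] at h1
  simpa using h1

/-- The probability that, for all `k ∈ G`, one of finitely many sets `B k i` has no point of the
process, when the sets `B k i` for different `k` are disjoint. -/
theorem IsPoissonProcess.measure_forall_exists_empty_le (h : IsPoissonProcess P ν S)
    {ι κ : Type*} (G : Finset κ) (I : κ → Finset ι) (B : κ → ι → Set X) {Q c : ℝ}
    (hB : ∀ k i, MeasurableSet (B k i))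
    (hdisj : ∀ k k', k ≠ k' → ∀ i i', Disjoint (B k i) (B k' i'))
    (hfin : ∀ k i, ν (B k i) ≠ ∞) (hQ : ∀ k ∈ G, ((I k).card : ℝ) ≤ Q)
    (hc : ∀ k ∈ G, ∀ i ∈ I k, ENNReal.ofReal c ≤ ν (B k i)) :
    P {ω | ∀ k ∈ G, ∃ i ∈ I k, S ω ∩ B k i = ∅} ≤
      ENNReal.ofReal ((Q * Real.exp (-c)) ^ G.card) := by
  classical
  -- Union over the choices f of one empty set per index. The chosen sets are disjoint, so each
  -- choice costs a single void probability, that of their union.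
  have hsub : {ω | ∀ k ∈ G, ∃ i ∈ I k, S ω ∩ B k i = ∅} ⊆
      ⋃ f ∈ Fintype.piFinset fun k : G => I k, {ω | S ω ∩ ⋃ k : G, B k (f k) = ∅} := by
    intro ω hω
    choose f hf hfe using fun k : G => hω k k.2
    refine mem_iUnion₂.2 ⟨f, Fintype.mem_piFinset.2 hf, ?_⟩
    rw [mem_ofPred_eq, inter_iUnion]
    exact iUnion_eq_empty.2 hfe
  have hterm : ∀ f ∈ Fintype.piFinset fun k : G => I k,
      P {ω | S ω ∩ ⋃ k : G, B k (f k) = ∅} ≤ ENNReal.ofReal (Real.exp (-c) ^ G.card) := by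
    intro f hf
    have hf := Fintype.mem_piFinset.1 hf
    have hdisj' : Pairwise (Function.onFun Disjoint fun k : G => B k (f k)) := fun k k' hkk' =>
      hdisj k k' (fun heq => hkk' (Subtype.ext heq)) _ _
    have hν : ν (⋃ k : G, B k (f k)) = ∑ k : G, ν (B k (f k)) := by
      rw [measure_iUnion hdisj' fun k => hB _ _, tsum_fintype]
    have hνtop : ν (⋃ k : G, B k (f k)) ≠ ∞ := by
      rw [hν]
      exact (ENNReal.sum_lt_top.2 fun k _ => (hfin _ _).lt_top).ne
    rw [h.measure_inter_eq_empty (MeasurableSet.iUnion fun k => hB _ _) hνtop]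
    refine ENNReal.ofReal_le_ofReal ?_
    rw [← Real.exp_nat_mul, Real.exp_le_exp, mul_neg, neg_le_neg_iff, hν,
      ENNReal.toReal_sum fun k _ => hfin _ _]
    calc (G.card : ℝ) * c = ∑ _k : G, c := by simp
      _ ≤ ∑ k : G, (ν (B k (f k))).toReal := Finset.sum_le_sum fun k _ =>
          (ENNReal.ofReal_le_iff_le_toReal (hfin _ _)).1 (hc k k.2 _ (hf k))
  refine (measure_mono hsub).trans ((measure_biUnion_finset_le _ _).trans ?_)
  refine (Finset.sum_le_sum hterm).trans ?_
  rw [Finset.sum_const, Fintype.card_piFinset, nsmul_eq_mul]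
  have hcard : ((∏ k : G, (I k).card : ℕ) : ℝ) ≤ Q ^ G.card := by
    push_cast
    calc ∏ k : G, ((I k).card : ℝ) ≤ ∏ _k : G, Q :=
          Finset.prod_le_prod (fun _ _ => Nat.cast_nonneg _) fun k _ => hQ k k.2
      _ = Q ^ G.card := by simp
  rw [← ENNReal.ofReal_natCast, ← ENNReal.ofReal_mul (Nat.cast_nonneg _), mul_pow]
  exact ENNReal.ofReal_le_ofReal (mul_le_mul_of_nonneg_right hcard (by positivity))

/-- Powers with exponents in `ℕ∞`. -/
noncomputable def enatPow (c : ℝ≥0∞) (n : ℕ∞) : ℝ≥0∞ := if n = ⊤ then ⊤ else c ^ n.toNat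

/-- The generating function of the Poisson law at 2^w. -/
theorem IsPoissonProcess.lintegral_enatPow (h : IsPoissonProcess P ν S) {B : Set X}
    (hB : MeasurableSet B) (hν : ν B ≠ ∞) (w : ℕ) :
    ∫⁻ ω, enatPow (2 ^ w) (S ω ∩ B).encard ∂P =
      ENNReal.ofReal (Real.exp ((ν B).toReal * (2 ^ w - 1))) := by
  rw [h.lintegral_encard hB hν]
  set l := (ν B).toReal with hl
  have hl0 : 0 ≤ l := ENNReal.toReal_nonneg
  have hterm : ∀ n : ℕ, ENNReal.ofReal (Real.exp (-l) * l ^ n / n.factorial) *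
      enatPow (2 ^ w) n = ENNReal.ofReal (Real.exp (-l) * ((2 ^ w * l) ^ n / n.factorial)) := by
    intro n
    have : enatPow (2 ^ w) (n : ℕ∞) = ENNReal.ofReal ((2 ^ w) ^ n) := by
      rw [enatPow, if_neg (ENat.natCast_ne_top n), ENat.toNat_natCast, ENNReal.ofReal_pow (by positivity),
        ENNReal.ofReal_pow (by norm_num)]
      simp
    rw [this, ← ENNReal.ofReal_mul (by positivity)]
    congr 1
    rw [mul_pow]
    ring
  have hsum : HasSum (fun n : ℕ => Real.exp (-l) * ((2 ^ w * l) ^ n / n.factorial))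
      (Real.exp (l * (2 ^ w - 1))) := by
    have := (NormedSpace.expSeries_div_hasSum_exp (2 ^ w * l)).mul_left (Real.exp (-l))
    rw [← Real.exp_eq_exp_ℝ, ← Real.exp_add] at this
    rwa [show l * (2 ^ w - 1) = -l + 2 ^ w * l by ring]
  simp_rw [hterm]
  rw [← ENNReal.ofReal_tsum_of_nonneg (fun n => by positivity) hsum.summable, hsum.tsum_eq]

/-- A Chernoff bound for a weighted sum of the numbers of points in disjoint sets. -/
theorem IsPoissonProcess.measure_le_sum_mul_encard_le [IsProbabilityMeasure P]
    (h : IsPoissonProcess P ν S) {n : ℕ} (G : Fin n → Set X) (hG : ∀ i, MeasurableSet (G i))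
    (hdisj : Pairwise fun i j => Disjoint (G i) (G j)) (hν : ∀ i, ν (G i) ≠ ∞)
    (w : Fin n → ℕ) (T : ℕ) :
    P {ω | (T : ℕ∞) ≤ ∑ i, (w i : ℕ∞) * (S ω ∩ G i).encard} ≤
      ENNReal.ofReal (Real.exp (∑ i, (ν (G i)).toReal * 2 ^ w i) / 2 ^ T) := by
  set Φ : Ω → ℝ≥0∞ := fun ω => ∏ i, enatPow (2 ^ w i) (S ω ∩ G i).encard with hΦ
  have hmeas : ∀ i, Measurable fun ω => enatPow (2 ^ w i) (S ω ∩ G i).encard := fun i =>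
    (measurable_of_countable (enatPow (2 ^ w i))).comp (h.measurable_encard _ (hG i))
  have hΦm : Measurable Φ := Finset.measurable_fun_prod _ fun i _ => hmeas i
  have hind : iIndepFun (fun i ω => enatPow (2 ^ w i) (S ω ∩ G i).encard) P :=
    (h.indep n G hG hdisj).comp (fun i => enatPow (2 ^ w i)) fun i => measurable_of_countable _
  have hint : ∫⁻ ω, Φ ω ∂P ≤ ENNReal.ofReal (Real.exp (∑ i, (ν (G i)).toReal * 2 ^ w i)) := by
    have h1 : ∫⁻ ω, Φ ω ∂P = ∏ i, ∫⁻ ω, enatPow (2 ^ w i) (S ω ∩ G i).encard ∂P := by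
      have := lintegral_prod_eq_prod_lintegral_of_indepFun (μ := P) Finset.univ
        (fun i ω => enatPow (2 ^ w i) (S ω ∩ G i).encard) hind hmeas
      simpa [hΦ, Finset.prod_apply] using this
    rw [h1, Real.exp_sum, ENNReal.ofReal_prod_of_nonneg fun i _ => (Real.exp_pos _).le]
    refine Finset.prod_le_prod' fun i _ => ?_
    rw [h.lintegral_enatPow (hG i) (hν i)]
    refine ENNReal.ofReal_le_ofReal (Real.exp_le_exp.2 ?_)
    exact mul_le_mul_of_nonneg_left (by linarith) ENNReal.toReal_nonneg
  have hsub : {ω | (T : ℕ∞) ≤ ∑ i, (w i : ℕ∞) * (S ω ∩ G i).encard} ⊆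
      {ω | ENNReal.ofReal (2 ^ T) ≤ Φ ω} := by
    intro ω hω
    rw [mem_ofPred_eq] at hω ⊢
    have h2 : ENNReal.ofReal (2 ^ T) = 2 ^ T := by
      rw [ENNReal.ofReal_pow (by norm_num)]
      simp
    rw [h2]
    -- An infinite count makes the whole product infinite, because no other factor vanishes.
    by_cases htop : ∃ i, (S ω ∩ G i).encard = ⊤
    · obtain ⟨i, hi⟩ := htop
      have : Φ ω = ⊤ := by
        rw [hΦ]
        dsimp only
        rw [← Finset.mul_prod_erase _ _ (Finset.mem_univ i), hi, enatPow, if_pos rfl]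
        refine ENNReal.top_mul (Finset.prod_ne_zero_iff.2 fun j _ => ?_)
        unfold enatPow
        split_ifs
        · exact ENNReal.top_ne_zero
        · exact pow_ne_zero _ (pow_ne_zero _ two_ne_zero)
      rw [this]
      exact le_top
    · push Not at htop
      choose x hx using fun i => ENat.ne_top_iff_exists.1 (htop i)
      have hΦω : Φ ω = 2 ^ ∑ i, w i * x i := by
        rw [hΦ, ← Finset.prod_pow_eq_pow_sum]
        refine Finset.prod_congr rfl fun i _ => ?_
        rw [← hx i, enatPow, if_neg (ENat.natCast_ne_top _), ENat.toNat_natCast, pow_mul]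
      rw [hΦω]
      refine pow_le_pow_right₀ one_le_two ?_
      have : ∑ i, (w i : ℕ∞) * (S ω ∩ G i).encard = ((∑ i, w i * x i : ℕ) : ℕ∞) := by
        push_cast
        exact Finset.sum_congr rfl fun i _ => by rw [← hx i]
      rw [this] at hω
      exact_mod_cast hω
  refine (measure_mono hsub).trans ?_
  have hT : (0 : ℝ) < 2 ^ T := by positivity
  refine (meas_ge_le_lintegral_div hΦm.aemeasurable (by simp) ENNReal.ofReal_ne_top).trans ?_
  rw [ENNReal.ofReal_div_of_pos hT]
  exact ENNReal.div_le_div_right hint _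

end Poisson

/-! ### The intensity of sets of roads -/

section Intensity

/-- The multiplicative constant of the intensity measure. -/
noncomputable def intensityConst (d : ℕ) (β : ℝ) : ℝ := (unitBallVolume (d - 1))⁻¹ * (β - 1)

theorem intensityConst_pos (d : ℕ) {β : ℝ} (hβ : 1 < β) : 0 < intensityConst d β := by
  unfold intensityConst unitBallVolume
  have : 0 < Real.Gamma (((d - 1 : ℕ) : ℝ) / 2 + 1) := Real.Gamma_pos_of_pos (by positivity)
  have h2 : 0 < β - 1 := by linarith
  positivity

instance (β : ℝ) : SFinite (speedMeasure β) := by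
  have : SigmaFinite (Measure.comap (Subtype.val : Ioi (0 : ℝ) → ℝ) volume) := by
    refine SigmaFinite.of_map _ measurable_subtype_coe.aemeasurable ?_
    rw [map_comap_subtype_coe measurableSet_Ioi]
    infer_instance
  unfold speedMeasure
  infer_instance

instance (d : ℕ) [NeZero d] : SFinite (lineMeasure d) := by
  unfold lineMeasure
  infer_instance

theorem intensity_prod (d : ℕ) [NeZero d] (β : ℝ) (s : Set (Line d)) (t : Set (Ioi (0 : ℝ))) :
    intensity d β (s ×ˢ t) =
      ENNReal.ofReal (intensityConst d β) * (lineMeasure d s * speedMeasure β t) := by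
  rw [intensity, Measure.smul_apply, Measure.prod_prod, smul_eq_mul]
  rfl

theorem speedMeasure_ge_le {β s : ℝ} (hβ : 1 < β) (hs : 0 < s) :
    speedMeasure β {v | s ≤ (v : ℝ)} ≤ ENNReal.ofReal (s ^ (1 - β) / (β - 1)) := by
  have himage : (Subtype.val '' {v : Ioi (0 : ℝ) | s ≤ (v : ℝ)}) = Ici s := by
    ext v
    constructor
    · rintro ⟨v, hv, rfl⟩
      exact hv
    · intro hv
      exact ⟨⟨v, hs.trans_le hv⟩, hv, rfl⟩
  rw [speedMeasure, withDensity_apply _ (measurableSet_le measurable_const measurable_subtype_coe),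
    setLIntegral_subtype measurableSet_Ioi _ fun v : ℝ => ENNReal.ofReal (v ^ (-β)), himage,
    ← restrict_Ioi_eq_restrict_Ici, ← ofReal_integral_eq_lintegral_ofReal
      (integrableOn_Ioi_rpow_of_lt (by linarith) hs)
      ((ae_restrict_iff' measurableSet_Ioi).2 (Eventually.of_forall fun v hv =>
        Real.rpow_nonneg (hs.trans hv).le _)),
    integral_Ioi_rpow_of_lt (by linarith) hs]
  refine ENNReal.ofReal_le_ofReal (le_of_eq ?_)
  rw [show -β + 1 = 1 - β by ring, show β - 1 = -(1 - β) by ring, div_neg, neg_div]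

/-- On a window of length `s` the density is at least (2s)^(-β). Bounded windows are used so that
different scales involve disjoint sets of roads. -/
theorem le_speedMeasure_window {β s : ℝ} (hβ : 0 ≤ β) (hs : 0 < s) :
    ENNReal.ofReal (2 ^ (-β) * s ^ (1 - β)) ≤
      speedMeasure β {v | s ≤ (v : ℝ) ∧ (v : ℝ) < 2 * s} := by
  have himage : (Subtype.val '' {v : Ioi (0 : ℝ) | s ≤ (v : ℝ) ∧ (v : ℝ) < 2 * s}) =
      Ico s (2 * s) := by
    ext v
    constructor
    · rintro ⟨v, hv, rfl⟩
      exact hv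
    · intro hv
      exact ⟨⟨v, hs.trans_le hv.1⟩, hv, rfl⟩
  have hmeas : MeasurableSet {v : Ioi (0 : ℝ) | s ≤ (v : ℝ) ∧ (v : ℝ) < 2 * s} :=
    (measurableSet_le measurable_const measurable_subtype_coe).inter
      (measurableSet_lt measurable_subtype_coe measurable_const)
  rw [speedMeasure, withDensity_apply _ hmeas,
    setLIntegral_subtype measurableSet_Ioi _ fun v : ℝ => ENNReal.ofReal (v ^ (-β)), himage]
  calc ENNReal.ofReal (2 ^ (-β) * s ^ (1 - β))
      = ∫⁻ _ in Ico s (2 * s), ENNReal.ofReal ((2 * s) ^ (-β)) := by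
        rw [setLIntegral_const, Real.volume_Ico, ← ENNReal.ofReal_mul (by positivity),
          Real.mul_rpow (by norm_num) hs.le, show 2 * s - s = s by ring, mul_assoc,
          ← Real.rpow_add_one hs.ne', show -β + 1 = 1 - β by ring]
    _ ≤ ∫⁻ v in Ico s (2 * s), ENNReal.ofReal (v ^ (-β)) := by
        refine setLIntegral_mono' measurableSet_Ico fun v hv => ENNReal.ofReal_le_ofReal ?_
        exact Real.rpow_le_rpow_of_nonpos (hs.trans_le hv.1) hv.2.le (by linarith)

variable {d : ℕ} [NeZero d]

/-- The set of all roads of speed limit at least `v` that meet a ball. -/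
def fastSet (v : ℝ) (p : E d) (ϱ : ℝ) : Set (Road d) := hits p ϱ ×ˢ {u : Ioi (0 : ℝ) | v ≤ (u : ℝ)}

/-- The set of all roads of speed limit in `[v, 2v)` that meet two balls. -/
def joinSet (v : ℝ) (p p' : E d) (ϱ : ℝ) : Set (Road d) :=
  (hits p ϱ ∩ hits p' ϱ) ×ˢ {u : Ioi (0 : ℝ) | v ≤ (u : ℝ) ∧ (u : ℝ) < 2 * v}

theorem fastRoads_eq {d : ℕ} (R : Set (Road d)) (v : ℝ) (p : E d) (ϱ : ℝ) :
    fastRoads R v p ϱ = R ∩ fastSet v p ϱ := by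
  ext r
  simp [fastRoads, fastSet, and_comm]

theorem measurableSet_fastSet (v : ℝ) (p : E d) {ϱ : ℝ} (hϱ : 0 ≤ ϱ) :
    MeasurableSet (fastSet v p ϱ) :=
  (measurableSet_hits p hϱ).prod (measurableSet_le measurable_const measurable_subtype_coe)

theorem measurableSet_joinSet (v : ℝ) (p p' : E d) {ϱ : ℝ} (hϱ : 0 ≤ ϱ) :
    MeasurableSet (joinSet v p p' ϱ) :=
  ((measurableSet_hits p hϱ).inter (measurableSet_hits p' hϱ)).prod
    ((measurableSet_le measurable_const measurable_subtype_coe).inter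
      (measurableSet_lt measurable_subtype_coe measurable_const))

theorem intensity_fastSet_le {β : ℝ} (hβ : 1 < β) {v : ℝ} (hv : 0 < v) (p : E d) {ϱ : ℝ}
    (hϱ : 0 ≤ ϱ) :
    intensity d β (fastSet v p ϱ) ≤
      ENNReal.ofReal (intensityConst d β * ((2 * ϱ) ^ (d - 1) * (v ^ (1 - β) / (β - 1)))) := by
  rw [fastSet, intensity_prod, ENNReal.ofReal_mul (intensityConst_pos d hβ).le,
    ENNReal.ofReal_mul (by positivity)]
  gcongr
  · exact lineMeasure_hits_le p hϱ
  · exact speedMeasure_ge_le hβ hv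

theorem joinSet_subset_fastSet {d : ℕ} (v : ℝ) (p p' : E d) (ϱ : ℝ) :
    joinSet v p p' ϱ ⊆ fastSet v p ϱ := fun _ hr => ⟨hr.1.1, hr.2.1⟩

theorem intensity_fastSet_ne_top {β : ℝ} (hβ : 1 < β) {v : ℝ} (hv : 0 < v) (p : E d) {ϱ : ℝ}
    (hϱ : 0 ≤ ϱ) : intensity d β (fastSet v p ϱ) ≠ ∞ :=
  ((intensity_fastSet_le hβ hv p hϱ).trans_lt ENNReal.ofReal_lt_top).ne

theorem intensity_joinSet_ne_top {β : ℝ} (hβ : 1 < β) {v : ℝ} (hv : 0 < v) (p p' : E d) {ϱ : ℝ}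
    (hϱ : 0 ≤ ϱ) : intensity d β (joinSet v p p' ϱ) ≠ ∞ :=
  ((measure_mono (joinSet_subset_fastSet v p p' ϱ)).trans_lt
    (intensity_fastSet_ne_top hβ hv p hϱ).lt_top).ne

theorem exists_le_intensity_joinSet (hd : 2 ≤ d) {β : ℝ} (hβ : 1 < β) {K : ℝ} (hK : 0 < K) :
    ∃ c : ℝ, 0 < c ∧ ∀ (p p' : E d) (ϱ v : ℝ), 0 < ϱ → 0 < v → dist p p' ≤ K * ϱ →
      ENNReal.ofReal (c * (ϱ ^ (d - 1) * v ^ (1 - β))) ≤ intensity d β (joinSet v p p' ϱ) := by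
  obtain ⟨c, hc, h⟩ := exists_le_lineMeasure_hits_inter hd hK
  have hI := intensityConst_pos d hβ
  have hd0 : (0 : ℝ) < d := by
    have : 0 < d := by omega
    exact_mod_cast this
  refine ⟨intensityConst d β * (c * ((d : ℝ)⁻¹) ^ (d - 1) * 2 ^ (-β)), by positivity,
    fun p p' ϱ v hϱ hv hpp' => ?_⟩
  rw [joinSet, intensity_prod]
  calc ENNReal.ofReal (intensityConst d β * (c * ((d : ℝ)⁻¹) ^ (d - 1) * 2 ^ (-β)) *
        (ϱ ^ (d - 1) * v ^ (1 - β)))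
      = ENNReal.ofReal (intensityConst d β) * (ENNReal.ofReal (c * (ϱ / d) ^ (d - 1)) *
          ENNReal.ofReal (2 ^ (-β) * v ^ (1 - β))) := by
        rw [← ENNReal.ofReal_mul (by positivity), ← ENNReal.ofReal_mul hI.le, div_eq_mul_inv,
          mul_pow]
        congr 1
        ring
    _ ≤ _ := by
        gcongr
        · exact h p p' ϱ hϱ hpp'
        · exact le_speedMeasure_window (by linarith) hv

theorem ae_isLocallyFinite {β : ℝ} (hβ : 1 < β) {Ω : Type*} [MeasurableSpace Ω] {P : Measure Ω}
    {S : Ω → Set (Road d)} (hS : IsPoissonProcess P (intensity d β) S) :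
    ∀ᵐ ω ∂P, IsLocallyFinite (S ω) := by
  refine ae_all_iff.2 fun n => ?_
  filter_upwards [hS.ae_finite (measurableSet_fastSet ((n : ℝ) + 1)⁻¹ 0 n.cast_nonneg)
    (intensity_fastSet_ne_top hβ (by positivity) 0 n.cast_nonneg)] with ω hω
  rwa [fastRoads_eq]

end Intensity

/-! ### Good scales -/

section Scales

variable {d : ℕ} [NeZero d]

/-- Scale invariance: dividing lengths by `b` and multiplying speeds by `σ` preserves the mean
numbers of fast roads, up to constants. -/
theorem scale_pow {β σ q : ℝ} {D : ℕ} (hσ : 0 < σ) (hscale : σ ^ (1 - β) * q ^ D = 1) (n : ℕ) :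
    (σ ^ n) ^ (1 - β) * (q ^ n) ^ D = 1 := by
  rw [← Real.rpow_natCast σ n, ← Real.rpow_mul hσ.le, mul_comm (n : ℝ), Real.rpow_mul hσ.le,
    Real.rpow_natCast, ← pow_mul, mul_comm n, pow_mul, ← mul_pow, hscale, one_pow]

/-- A lower bound for the mean number of roads that join two balls at level `j` below scale `k`. -/
theorem exists_le_intensity_joinSet_scale (hd : 2 ≤ d) {β : ℝ} (hβ : 2 ≤ β) {b : ℕ} (hb : 0 < b) :
    ∃ c : ℝ, 0 < c ∧ ∀ (σ a : ℝ) (k j : ℕ) (p p' : E d), 0 < σ → 0 < a →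
      σ ^ (1 - β) * (b : ℝ)⁻¹ ^ (d - 1) = 1 →
      dist p p' ≤ 10 * b * (b : ℝ)⁻¹ ^ (k + j + 1) →
      ENNReal.ofReal (c * a ^ (1 - β) * 4 ^ j) ≤
        intensity d β (joinSet (a * 4⁻¹ ^ j * σ ^ (k + j)) p p' ((b : ℝ)⁻¹ ^ (k + j + 1))) := by
  have hb0 : (0 : ℝ) < b := by exact_mod_cast hb
  obtain ⟨c, hc, h⟩ := exists_le_intensity_joinSet hd (β := β) (by linarith)
    (K := 10 * b) (by positivity)
  refine ⟨c * (b : ℝ)⁻¹ ^ (d - 1), by positivity, fun σ a k j p p' hσ ha hscale hpp' => ?_⟩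
  refine le_trans (ENNReal.ofReal_le_ofReal ?_) (h p p' _ _ (by positivity) (by positivity) hpp')
  have h1 := scale_pow hσ hscale (k + j)
  -- Lowering the speed by 4^(-j) multiplies the mean number of roads by 4^(j(β-1)), at least 4^j as
  -- β ≥ 2.
  have h2 : (4 : ℝ) ^ j ≤ (4⁻¹ ^ j) ^ (1 - β) := by
    have : ((4 : ℝ)⁻¹ ^ j) ^ (1 - β) = (4 ^ j) ^ (β - 1) := by
      rw [inv_pow, Real.inv_rpow (by positivity), ← Real.rpow_neg (by positivity)]
      congr 1
      ring
    rw [this]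
    exact Real.self_le_rpow_of_one_le (one_le_pow₀ (by norm_num)) (by linarith)
  rw [Real.mul_rpow (by positivity) (by positivity), Real.mul_rpow ha.le (by positivity),
    pow_succ _ (k + j), mul_pow]
  have h3 : c * (((b : ℝ)⁻¹ ^ (k + j)) ^ (d - 1) * (b : ℝ)⁻¹ ^ (d - 1) *
      (a ^ (1 - β) * (4⁻¹ ^ j) ^ (1 - β) * (σ ^ (k + j)) ^ (1 - β))) =
      c * (b : ℝ)⁻¹ ^ (d - 1) * a ^ (1 - β) * (4⁻¹ ^ j) ^ (1 - β) *
        ((σ ^ (k + j)) ^ (1 - β) * ((b : ℝ)⁻¹ ^ (k + j)) ^ (d - 1)) := by ring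
  rw [h3, h1, mul_one]
  gcongr

/-- At a fixed level the windows [v, 2v) of different scales do not overlap since 2σ ≤ 1. The level
is the same on both sides: windows of different levels may overlap, so levels are treated
separately. -/
theorem disjoint_joinSet {d : ℕ} {σ a : ℝ} (ha : 0 < a) (hσ0 : 0 < σ) (hσ : 2 * σ ≤ 1) (j : ℕ)
    {k k' : ℕ} (hkk' : k ≠ k') (p p' u u' : E d) (ϱ ϱ' : ℝ) :
    Disjoint (joinSet (a * 4⁻¹ ^ j * σ ^ (k + j)) p p' ϱ)
      (joinSet (a * 4⁻¹ ^ j * σ ^ (k' + j)) u u' ϱ') := by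
  have key : ∀ {k k' : ℕ}, k < k' →
      2 * (a * 4⁻¹ ^ j * σ ^ (k' + j)) ≤ a * 4⁻¹ ^ j * σ ^ (k + j) := by
    intro k k' hlt
    have h1 : σ ^ (k' + j) ≤ σ ^ (k + j + 1) :=
      pow_le_pow_of_le_one hσ0.le (by linarith) (by omega)
    have h2 : 2 * σ ^ (k' + j) ≤ σ ^ (k + j) := by
      rw [pow_succ] at h1
      nlinarith [pow_pos hσ0 (k + j)]
    have h3 : 0 < a * 4⁻¹ ^ j := by positivity
    nlinarith
  refine disjoint_left.2 fun r hr hr' => ?_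
  have h1 := hr.2.1
  have h2 := hr.2.2
  have h3 := hr'.2.1
  have h4 := hr'.2.2
  rcases lt_or_gt_of_ne hkk' with hlt | hlt
  · have := key hlt
    exact absurd (h4.trans_le (this.trans h1)) (lt_irrefl _)
  · have := key hlt
    exact absurd (h2.trans_le (this.trans h3)) (lt_irrefl _)

/-- The crude exponent 4^j matches that of the void probabilities, so that both combine into one
power. -/
theorem card_grid_sq_le {d : ℕ} (hd : d ≠ 0) {b : ℕ} (hb : 0 < b) (j : ℕ) :
    ((grid d (16 * d * b ^ (j + 1) + 1) ×ˢ grid d (16 * d * b ^ (j + 1) + 1)).card : ℝ) ≤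
      (((35 * d * b : ℕ) : ℝ) ^ (2 * d)) ^ 4 ^ j := by
  rw [Finset.card_product, card_grid, ← pow_add, ← two_mul,
    ← pow_mul _ (2 * d) (4 ^ j), mul_comm (2 * d) (4 ^ j), pow_mul _ (4 ^ j) (2 * d)]
  have h1 : 2 * (16 * d * b ^ (j + 1) + 1) + 1 ≤ (35 * d * b) ^ 4 ^ j := by
    have hd1 : 1 ≤ d := Nat.one_le_iff_ne_zero.2 hd
    have h2 : j + 1 ≤ 4 ^ j := Nat.lt_pow_self (by norm_num)
    have hdb : 1 ≤ d * b ^ (j + 1) := Nat.one_le_iff_ne_zero.2 (by positivity)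
    calc 2 * (16 * d * b ^ (j + 1) + 1) + 1 ≤ 35 * (d * b ^ (j + 1)) := by nlinarith
      _ ≤ 35 ^ (j + 1) * (d ^ (j + 1) * b ^ (j + 1)) := by
          gcongr
          · exact Nat.le_self_pow (by omega) 35
          · exact Nat.le_self_pow (by omega) d
      _ = (35 * d * b) ^ (j + 1) := by rw [mul_pow, mul_pow, mul_assoc]
      _ ≤ (35 * d * b) ^ 4 ^ j := Nat.pow_le_pow_right (by positivity) h2
  exact_mod_cast Nat.pow_le_pow_left h1 (2 * d)

/-- A scale fails to connect only if one of its join sets is empty. The constant `c` does not depend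
on `a`, which can therefore be chosen small afterwards. -/
theorem measure_forall_not_connects_le (hd : 2 ≤ d) {β : ℝ} (hβ : 2 ≤ β) {b : ℕ} (hb : 0 < b)
    {σ : ℝ} (hσ0 : 0 < σ) (hσ : 2 * σ ≤ 1)
    (hscale : σ ^ (1 - β) * (b : ℝ)⁻¹ ^ (d - 1) = 1) :
    ∃ c : ℝ, 0 < c ∧ ∀ (Ω : Type*) [MeasurableSpace Ω] (P : Measure Ω) (S : Ω → Set (Road d)),
      IsPoissonProcess P (intensity d β) S → ∀ (a : ℝ), 0 < a →
      ∀ (z : E d) (j : ℕ) (G : Finset ℕ),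
      P {ω | ∀ k ∈ G, ¬ Connects (S ω) b σ a z k j} ≤
        ENNReal.ofReal (((((35 * d * b : ℕ) : ℝ) ^ (2 * d) *
          Real.exp (-(c * a ^ (1 - β)))) ^ 4 ^ j) ^ G.card) := by
  obtain ⟨c, hc, hjoin⟩ := exists_le_intensity_joinSet_scale hd hβ hb
  refine ⟨c, hc, fun Ω _ P S hS a ha z j G => ?_⟩
  have hb0 : (0 : ℝ) < b := by exact_mod_cast hb
  have hmain := hS.measure_forall_exists_empty_le (κ := ℕ)
    (ι := (Fin d → ℤ) × (Fin d → ℤ)) G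
    (fun k => (grid d (16 * d * b ^ (j + 1) + 1) ×ˢ grid d (16 * d * b ^ (j + 1) + 1)).filter
      fun m => dist (gridPt z ((b : ℝ)⁻¹ ^ (k + j + 1) / d) m.1)
        (gridPt z ((b : ℝ)⁻¹ ^ (k + j + 1) / d) m.2) ≤ 10 * b * (b : ℝ)⁻¹ ^ (k + j + 1))
    (fun k m => joinSet (a * 4⁻¹ ^ j * σ ^ (k + j)) (gridPt z ((b : ℝ)⁻¹ ^ (k + j + 1) / d) m.1)
        (gridPt z ((b : ℝ)⁻¹ ^ (k + j + 1) / d) m.2) ((b : ℝ)⁻¹ ^ (k + j + 1)))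
    (Q := (((35 * d * b : ℕ) : ℝ) ^ (2 * d)) ^ 4 ^ j) (c := c * a ^ (1 - β) * 4 ^ j)
    (fun k m => measurableSet_joinSet _ _ _ (by positivity))
    (fun k k' hkk' m m' => disjoint_joinSet ha hσ0 hσ j hkk' _ _ _ _ _ _)
    (fun k m => intensity_joinSet_ne_top (by linarith) (by positivity) _ _ (by positivity))
    (fun k _ => le_trans (by exact_mod_cast Finset.card_filter_le _ _)
      (card_grid_sq_le (NeZero.ne d) hb j))
    (fun k _ m hm => hjoin σ a k j _ _ hσ0 ha hscale (Finset.mem_filter.1 hm).2)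
  refine (measure_mono fun ω hω k hk => ?_).trans (hmain.trans (ENNReal.ofReal_le_ofReal ?_))
  · have hnot := hω k hk
    unfold Connects at hnot
    push Not at hnot
    obtain ⟨m, hm, m', hm', hdist, hno⟩ := hnot
    refine ⟨(m, m'), Finset.mem_filter.2 ⟨Finset.mk_mem_product hm hm', hdist⟩, ?_⟩
    refine eq_empty_iff_forall_notMem.2 fun r hr => ?_
    exact hno r hr.1 hr.2.2.1 hr.2.2.2 hr.2.1.1 hr.2.1.2
  · refine le_of_eq ?_
    rw [mul_pow (((35 * d * b : ℕ) : ℝ) ^ (2 * d)), ← Real.exp_nat_mul]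
    congr 4
    push_cast
    ring

/-- The scales among `n, …, 2n - 1` that fail to connect at level `j`. -/
noncomputable def badLevels (R : Set (Road d)) (b : ℕ) (σ a : ℝ) (z : E d) (n j : ℕ) : Finset ℕ :=
  open scoped Classical in (Finset.Ico n (2 * n)).filter fun k => ¬ Connects R b σ a z k j

/-- Level `j` may spoil fewer than n/2^(j+2) scales, hence none once j ≥ n, and these allowances sum
to less than n/2. -/
theorem two_mul_card_lt_of_badLevels {d : ℕ} {R : Set (Road d)} {b : ℕ} {σ a : ℝ} {z : E d} {n : ℕ}
    (hn : 0 < n) (h : ∀ j, (badLevels R b σ a z n j).card * 2 ^ (j + 2) < n) :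
    open scoped Classical in
    2 * ((Finset.Ico n (2 * n)).filter fun k => ¬ ∀ j, Connects R b σ a z k j).card < n := by
  classical
  have hempty : ∀ j, n ≤ j → badLevels R b σ a z n j = ∅ := by
    intro j hj
    by_contra hne
    have h1 : 1 ≤ (badLevels R b σ a z n j).card :=
      Finset.card_pos.2 (Finset.nonempty_iff_ne_empty.2 hne)
    have h2 : j + 2 < 2 ^ (j + 2) := Nat.lt_two_pow_self
    have := h j
    nlinarith
  have hsub : ((Finset.Ico n (2 * n)).filter fun k => ¬ ∀ j, Connects R b σ a z k j) ⊆
      (Finset.range n).biUnion fun j => badLevels R b σ a z n j := by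
    intro k hk
    obtain ⟨hk, hnot⟩ := Finset.mem_filter.1 hk
    push Not at hnot
    obtain ⟨j, hj⟩ := hnot
    have hmem : k ∈ badLevels R b σ a z n j := Finset.mem_filter.2 ⟨hk, hj⟩
    refine Finset.mem_biUnion.2 ⟨j, Finset.mem_range.2 ?_, hmem⟩
    by_contra hjn
    rw [hempty j (not_lt.1 hjn)] at hmem
    exact Finset.notMem_empty _ hmem
  have hle := (Finset.card_le_card hsub).trans Finset.card_biUnion_le
  have hterm : ∀ j ∈ Finset.range n, ((badLevels R b σ a z n j).card : ℝ) ≤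
      n / 4 * (1 / 2) ^ j := by
    intro j _
    have h1 : ((badLevels R b σ a z n j).card : ℝ) * 2 ^ (j + 2) ≤ n := by exact_mod_cast (h j).le
    rw [pow_add] at h1
    rw [one_div, inv_pow, ← div_eq_mul_inv, le_div_iff₀ (by positivity)]
    linarith
  have hsum : (∑ j ∈ Finset.range n, ((badLevels R b σ a z n j).card : ℝ)) < n / 2 := by
    refine (Finset.sum_le_sum hterm).trans_lt ?_
    rw [← Finset.mul_sum, geom_sum_eq (by norm_num)]
    have hn' : (0 : ℝ) < n := by exact_mod_cast hn
    have hp : (0 : ℝ) < (1 / 2) ^ n := by positivity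
    have e : ((1 / 2 : ℝ) ^ n - 1) / (1 / 2 - 1) = 2 - 2 * (1 / 2) ^ n := by
      rw [div_eq_iff (by norm_num)]
      ring
    rw [e]
    nlinarith [mul_pos hn' hp]
  have hcast := (Nat.cast_le (α := ℝ)).2 hle
  push_cast at hcast
  have : 2 * (((Finset.Ico n (2 * n)).filter fun k => ¬ ∀ j, Connects R b σ a z k j).card : ℝ) <
      n := by linarith
  exact_mod_cast this

/-- Union bound over the at most 2^n sets of bad scales and over the levels. A level `j` beyond its
allowance has at least n/2^(j+2) failures, each of cost ε^(4·4^j), and 4·4^j/2^(j+2) = 2^j ≥ j + 1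
makes the sum over `j` geometric. -/
theorem measure_exists_badLevels_le (hd : 2 ≤ d) {β : ℝ} (hβ : 2 ≤ β) {b : ℕ} (hb : 0 < b)
    {σ : ℝ} (hσ0 : 0 < σ) (hσ : 2 * σ ≤ 1)
    (hscale : σ ^ (1 - β) * (b : ℝ)⁻¹ ^ (d - 1) = 1) {ε : ℝ} (hε : 0 < ε) (hε2 : ε ≤ 1 / 2) :
    ∃ a : ℝ, 0 < a ∧ ∀ (Ω : Type*) [MeasurableSpace Ω] (P : Measure Ω) (S : Ω → Set (Road d)),
      IsPoissonProcess P (intensity d β) S → ∀ (z : E d) (n : ℕ), 0 < n →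
      P {ω | ∃ j, n ≤ (badLevels (S ω) b σ a z n j).card * 2 ^ (j + 2)} ≤
        ENNReal.ofReal (2 * (2 * ε) ^ n) := by
  obtain ⟨c, hc, hmain⟩ := measure_forall_not_connects_le hd hβ hb hσ0 hσ hscale
  set W : ℝ := ((35 * d * b : ℕ) : ℝ) ^ (2 * d) with hW
  -- As 1 - β < 0, slow roads are plentiful: a^(1-β) tends to infinity as `a` tends to 0.
  obtain ⟨a, ha, haε⟩ : ∃ a : ℝ, 0 < a ∧ W * Real.exp (-(c * a ^ (1 - β))) ≤ ε ^ 4 := by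
    have h1 : Tendsto (fun a : ℝ => c * a ^ (1 - β)) (𝓝[>] 0) atTop := by
      refine Tendsto.const_mul_atTop hc ?_
      exact tendsto_rpow_neg_nhdsGT_zero (by linarith)
    have h2 : Tendsto (fun a : ℝ => W * Real.exp (-(c * a ^ (1 - β)))) (𝓝[>] 0) (𝓝 0) := by
      have := ((Real.tendsto_exp_neg_atTop_nhds_zero.comp h1).const_mul W)
      simpa using this
    obtain ⟨a, ha1, ha2⟩ := ((h2.eventually_lt_const (by positivity : (0 : ℝ) < ε ^ 4)).and
      self_mem_nhdsWithin).exists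
    exact ⟨a, ha2, ha1.le⟩
  refine ⟨a, ha, fun Ω _ P S hS z n hn => ?_⟩
  have hε1 : ε ≤ 1 := by linarith
  have hlevel : ∀ j, P {ω | n ≤ (badLevels (S ω) b σ a z n j).card * 2 ^ (j + 2)} ≤
      ENNReal.ofReal (2 ^ n * (ε ^ n) ^ (j + 1)) := by
    intro j
    classical
    have hsub : {ω | n ≤ (badLevels (S ω) b σ a z n j).card * 2 ^ (j + 2)} ⊆
        ⋃ G ∈ (Finset.Ico n (2 * n)).powerset.filter fun G => n ≤ G.card * 2 ^ (j + 2),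
          {ω | ∀ k ∈ G, ¬ Connects (S ω) b σ a z k j} := by
      intro ω hω
      refine mem_iUnion₂.2 ⟨badLevels (S ω) b σ a z n j, Finset.mem_filter.2
        ⟨Finset.mem_powerset.2 (Finset.filter_subset _ _), hω⟩, fun k hk => ?_⟩
      exact (Finset.mem_filter.1 hk).2
    refine (measure_mono hsub).trans ((measure_biUnion_finset_le _ _).trans ?_)
    have hterm : ∀ G ∈ (Finset.Ico n (2 * n)).powerset.filter fun G => n ≤ G.card * 2 ^ (j + 2),
        P {ω | ∀ k ∈ G, ¬ Connects (S ω) b σ a z k j} ≤ ENNReal.ofReal ((ε ^ n) ^ (j + 1)) := by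
      intro G hG
      refine (hmain Ω P S hS a ha z j G).trans (ENNReal.ofReal_le_ofReal ?_)
      have hcard := (Finset.mem_filter.1 hG).2
      calc ((W * Real.exp (-(c * a ^ (1 - β)))) ^ 4 ^ j) ^ G.card ≤ ((ε ^ 4) ^ 4 ^ j) ^ G.card := by
            gcongr
        _ = ε ^ (4 * 4 ^ j * G.card) := by rw [← pow_mul, ← pow_mul, mul_assoc]
        _ ≤ ε ^ (n * (j + 1)) := by
            refine pow_le_pow_of_le_one hε.le hε1 ?_
            have h1 : j + 1 ≤ 2 ^ j := Nat.lt_two_pow_self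
            calc n * (j + 1) ≤ G.card * 2 ^ (j + 2) * 2 ^ j := Nat.mul_le_mul hcard h1
              _ = 4 * 4 ^ j * G.card := by
                  rw [show (4 : ℕ) ^ j = 2 ^ j * 2 ^ j by rw [← mul_pow]; norm_num, pow_add]
                  ring
        _ = (ε ^ n) ^ (j + 1) := by rw [pow_mul]
    refine (Finset.sum_le_card_nsmul _ _ _ hterm).trans ?_
    rw [nsmul_eq_mul, ← ENNReal.ofReal_natCast, ← ENNReal.ofReal_mul (Nat.cast_nonneg _)]
    refine ENNReal.ofReal_le_ofReal (mul_le_mul_of_nonneg_right ?_ (by positivity))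
    have : ((Finset.Ico n (2 * n)).powerset.filter fun G => n ≤ G.card * 2 ^ (j + 2)).card ≤
        2 ^ n := by
      refine (Finset.card_filter_le _ _).trans ?_
      rw [Finset.card_powerset, Nat.card_Ico]
      exact le_of_eq (by congr 1; omega)
    exact_mod_cast this
  have hset : {ω | ∃ j, n ≤ (badLevels (S ω) b σ a z n j).card * 2 ^ (j + 2)} =
      ⋃ j, {ω | n ≤ (badLevels (S ω) b σ a z n j).card * 2 ^ (j + 2)} := by
    ext ω
    simp
  rw [hset]
  refine (measure_iUnion_le _).trans ((ENNReal.tsum_le_tsum hlevel).trans ?_)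
  have hεn : ε ^ n ≤ 1 / 2 := by
    calc ε ^ n ≤ ε ^ 1 := pow_le_pow_of_le_one hε.le hε1 hn
      _ ≤ 1 / 2 := by rwa [pow_one]
  have hεn0 : 0 < ε ^ n := by positivity
  have hsum : HasSum (fun j : ℕ => 2 ^ n * (ε ^ n) ^ (j + 1)) (2 ^ n * (ε ^ n * (1 - ε ^ n)⁻¹)) := by
    have := ((hasSum_geometric_of_lt_one hεn0.le (by linarith)).mul_left (ε ^ n)).mul_left (2 ^ n)
    simpa only [pow_succ'] using this
  rw [← ENNReal.ofReal_tsum_of_nonneg (fun j => by positivity) hsum.summable, hsum.tsum_eq]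
  refine ENNReal.ofReal_le_ofReal ?_
  have hinv : (1 - ε ^ n)⁻¹ ≤ 2 := inv_le_of_inv_le₀ (by norm_num) (by norm_num at hεn ⊢; linarith)
  calc 2 ^ n * (ε ^ n * (1 - ε ^ n)⁻¹) ≤ 2 ^ n * (ε ^ n * 2) := by gcongr
    _ = 2 * (2 * ε) ^ n := by rw [mul_pow]; ring

end Scales

/-! ### Numbers of fast roads at most scales -/

section Occupation

variable {X : Type*}

open scoped Classical in
/-- The number of indices `k ∈ I` such that `x` belongs to `F k`. -/
noncomputable def occupation (I : Finset ℕ) (F : ℕ → Set X) (x : X) : ℕ :=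
  (I.filter fun k => x ∈ F k).card

theorem measurable_occupation [MeasurableSpace X] (I : Finset ℕ) {F : ℕ → Set X}
    (hF : ∀ k, MeasurableSet (F k)) : Measurable (occupation I F) := by
  classical
  have : occupation I F = fun x => ∑ k ∈ I, if x ∈ F k then 1 else 0 := by
    ext x
    rw [occupation, Finset.card_filter]
  rw [this]
  exact Finset.measurable_fun_sum _ fun k _ =>
    Measurable.ite (hF k) measurable_const measurable_const

/-- Double counting; an infinite `A` is harmless because `w` is positive. -/
theorem sum_encard_inter_le_of_occupation (I : Finset ℕ) (F : ℕ → Set X) (A : Set X) {w : ℕ}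
    (hw : 0 < w) (hA : ∀ x ∈ A, occupation I F x = w) :
    ∑ k ∈ I, (A ∩ F k).encard ≤ (w : ℕ∞) * A.encard := by
  classical
  by_cases hfin : A.Finite
  · lift A to Finset X using hfin
    have h1 : ∀ k, ((A : Set X) ∩ F k).encard = ((A.filter fun x => x ∈ F k).card : ℕ∞) := by
      intro k
      rw [← encard_coe_eq_coe_finsetCard, Finset.coe_filter]
      rfl
    simp_rw [h1, encard_coe_eq_coe_finsetCard, Finset.card_filter]
    have h2 : ∑ k ∈ I, ∑ x ∈ A, (if x ∈ F k then 1 else 0) = w * A.card := by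
      rw [Finset.sum_comm, mul_comm, ← smul_eq_mul, ← Finset.sum_const]
      refine Finset.sum_congr rfl fun x hx => ?_
      rw [← Finset.card_filter]
      exact hA x hx
    exact_mod_cast h2.le
  · rw [(not_finite.1 hfin).encard_eq, ENat.mul_top (by exact_mod_cast hw.ne')]
    exact le_top

/-- Sorting points by occupation replaces the overlapping sets `F k` by disjoint layers, whose
counts are independent. -/
theorem sum_encard_inter_le (I : Finset ℕ) (F : ℕ → Set X) (A : Set X) {n : ℕ}
    (hI : I.card ≤ n) :
    ∑ k ∈ I, (A ∩ F k).encard ≤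
      ∑ i : Fin n, ((i.val + 1 : ℕ) : ℕ∞) * (A ∩ {x | occupation I F x = i.val + 1}).encard := by
  classical
  have hk : ∀ k ∈ I, (A ∩ F k).encard ≤
      ∑ i : Fin n, ((A ∩ {x | occupation I F x = i.val + 1}) ∩ F k).encard := by
    intro k hk
    refine le_trans (encard_le_encard fun x hx => ?_) (encard_iUnion_le_of_fintype _)
    have hmem : k ∈ I.filter fun k => x ∈ F k := Finset.mem_filter.2 ⟨hk, hx.2⟩
    have h1 : 1 ≤ occupation I F x := Finset.card_pos.2 ⟨k, hmem⟩
    have h2 : occupation I F x ≤ n := (Finset.card_filter_le _ _).trans hI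
    refine mem_iUnion.2 ⟨⟨occupation I F x - 1, by omega⟩, ⟨hx.1, ?_⟩, hx.2⟩
    simp only [mem_ofPred_eq]
    omega
  refine (Finset.sum_le_sum hk).trans ?_
  rw [Finset.sum_comm]
  exact Finset.sum_le_sum fun i _ =>
    sum_encard_inter_le_of_occupation I F _ (Nat.succ_pos _) fun x hx => hx.2

/-- The probability that many of the sets `F k` contain many points of a Poisson process. -/
theorem IsPoissonProcess.measure_crowded_le {Ω : Type*} [MeasurableSpace Ω] [MeasurableSpace X]
    {P : Measure Ω} [IsProbabilityMeasure P] {ν : Measure X} {S : Ω → Set X}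
    (h : IsPoissonProcess P ν S) (I : Finset ℕ) {F : ℕ → Set X} (hF : ∀ k, MeasurableSet (F k))
    {n M : ℕ} (hI : I.card ≤ n) {c : ℝ}
    (hc : ∀ i < n, ν {x | occupation I F x = i + 1} ≤ ENNReal.ofReal (c * 4⁻¹ ^ i))
    (hc0 : 0 ≤ c) :
    open scoped Classical in
    P {ω | n ≤ 2 * (I.filter fun k => ((2 * M : ℕ) : ℕ∞) < (S ω ∩ F k).encard).card} ≤
      ENNReal.ofReal (Real.exp (4 * c) / 2 ^ (M * n)) := by
  classical
  have hmeas : ∀ i, MeasurableSet {x | occupation I F x = i + 1} := fun i =>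
    measurable_occupation I hF (measurableSet_singleton (i + 1))
  have hfin : ∀ i : Fin n, ν {x | occupation I F x = i.val + 1} ≠ ∞ := fun i =>
    ((hc i i.2).trans_lt ENNReal.ofReal_lt_top).ne
  -- If at least n/2 of the sets contain more than 2M points, the weighted count is at least `M *
  -- n`. The exponential weights 2^(i+1) are compensated by the decay 4^(-i) of the layers.
  have hchern := h.measure_le_sum_mul_encard_le (fun i : Fin n => {x | occupation I F x = i.val + 1})
    (fun i => hmeas i) (fun i j hij => disjoint_left.2 fun x hx hx' => hij (by
      have h1 : occupation I F x = i.val + 1 := hx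
      have h2 : occupation I F x = j.val + 1 := hx'
      exact Fin.ext (by omega))) hfin (fun i => i.val + 1) (M * n)
  refine (measure_mono fun ω hω => ?_).trans (hchern.trans (ENNReal.ofReal_le_ofReal ?_))
  · rw [mem_ofPred_eq] at hω ⊢
    refine le_trans ?_ (sum_encard_inter_le I F (S ω) hI)
    set J := I.filter fun k => ((2 * M : ℕ) : ℕ∞) < (S ω ∩ F k).encard with hJ
    calc ((M * n : ℕ) : ℕ∞) ≤ ((J.card * (2 * M) : ℕ) : ℕ∞) := by
          exact_mod_cast (by nlinarith : M * n ≤ J.card * (2 * M))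
      _ = ∑ _k ∈ J, ((2 * M : ℕ) : ℕ∞) := by
          rw [Finset.sum_const, nsmul_eq_mul]
          push_cast
          ring
      _ ≤ ∑ k ∈ J, (S ω ∩ F k).encard :=
          Finset.sum_le_sum fun k hk => (Finset.mem_filter.1 hk).2.le
      _ ≤ ∑ k ∈ I, (S ω ∩ F k).encard :=
          Finset.sum_le_sum_of_subset (Finset.filter_subset _ _)
  · refine div_le_div_of_nonneg_right (Real.exp_le_exp.2 ?_) (by positivity)
    calc ∑ i : Fin n, (ν {x | occupation I F x = i.val + 1}).toReal * 2 ^ (i.val + 1)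
        ≤ ∑ i : Fin n, 2 * c * (1 / 2) ^ i.val := by
          refine Finset.sum_le_sum fun i _ => ?_
          have h1 := ENNReal.toReal_le_of_le_ofReal (by positivity) (hc i i.2)
          calc (ν {x | occupation I F x = i.val + 1}).toReal * 2 ^ (i.val + 1)
              ≤ c * 4⁻¹ ^ i.val * 2 ^ (i.val + 1) := by gcongr
            _ = 2 * c * (4⁻¹ * 2) ^ i.val := by rw [mul_pow, pow_succ]; ring
            _ = 2 * c * (1 / 2) ^ i.val := by norm_num
      _ = 2 * c * ∑ i ∈ Finset.range n, (1 / 2 : ℝ) ^ i := by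
          rw [← Finset.mul_sum, Fin.sum_univ_eq_sum_range fun i => (1 / 2 : ℝ) ^ i]
      _ ≤ 2 * c * 2 := by
          refine mul_le_mul_of_nonneg_left ?_ (by positivity)
          exact (summable_geometric_two.sum_le_tsum _ fun i _ => by positivity).trans
            tsum_geometric_two.le
      _ = 4 * c := by ring

end Occupation

/-! ### Crowded scales of the Poisson process of roads. -/

section FastRoads

variable {d : ℕ} [NeZero d]

/-- A road that is counted at i + 1 scales has the speed required at the largest of them and comes
as close to `z` as the smallest requires. These two scales are at least `i` apart, which costs a
factor q^(i(d-1)) ≤ 4^(-i). -/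
theorem intensity_occupation_le (hd : 2 ≤ d) {β : ℝ} (hβ : 1 < β) {b : ℕ} (hb : 4 ≤ b) {σ : ℝ}
    (hσ0 : 0 < σ) (hscale : σ ^ (1 - β) * (b : ℝ)⁻¹ ^ (d - 1) = 1) {v : ℝ} (hv : 0 < v) :
    ∃ c : ℝ, 0 < c ∧ ∀ (z : E d) (n i : ℕ),
      intensity d β {r | occupation (Finset.Ico n (2 * n))
        (fun k => fastSet (v * σ ^ k) z (3 * (b : ℝ)⁻¹ ^ k)) r = i + 1} ≤
        ENNReal.ofReal (n * c * 4⁻¹ ^ i) := by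
  classical
  have hI := intensityConst_pos d hβ
  have hβ1 : 0 < β - 1 := by linarith
  have hb0 : (0 : ℝ) < b := by positivity
  have hb4 : (4 : ℝ) ≤ b := by exact_mod_cast hb
  have hq4 : (b : ℝ)⁻¹ ≤ 4⁻¹ := inv_anti₀ (by norm_num) hb4
  have hq1 : (b : ℝ)⁻¹ ≤ 1 := by linarith
  set c : ℝ := intensityConst d β * (6 ^ (d - 1) * (v ^ (1 - β) / (β - 1))) with hc
  refine ⟨c, by positivity, fun z n i => ?_⟩
  have hsub : {r | occupation (Finset.Ico n (2 * n))
      (fun k => fastSet (v * σ ^ k) z (3 * (b : ℝ)⁻¹ ^ k)) r = i + 1} ⊆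
      ⋃ k ∈ Finset.Ico n (2 * n), fastSet (v * σ ^ k) z (3 * (b : ℝ)⁻¹ ^ (k + i)) := by
    intro r hr
    set K := (Finset.Ico n (2 * n)).filter
      fun k => r ∈ fastSet (v * σ ^ k) z (3 * (b : ℝ)⁻¹ ^ k) with hK
    have hcard : K.card = i + 1 := hr
    have hne : K.Nonempty := Finset.card_pos.1 (by omega)
    have hmin := Finset.mem_filter.1 (K.min'_mem hne)
    have hmax := Finset.mem_filter.1 (K.max'_mem hne)
    have hle : K.min' hne + i ≤ K.max' hne := by
      have hs : K ⊆ Finset.Icc (K.min' hne) (K.max' hne) := fun k hk =>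
        Finset.mem_Icc.2 ⟨K.min'_le k hk, K.le_max' k hk⟩
      have := Finset.card_le_card hs
      rw [Nat.card_Icc, hcard] at this
      omega
    refine mem_iUnion₂.2 ⟨_, hmin.1, hits_mono ?_ hmax.2.1, hmin.2.2⟩
    rw [dist_self, zero_add]
    exact mul_le_mul_of_nonneg_left (pow_le_pow_of_le_one (by positivity) hq1 hle) (by norm_num)
  have hterm : ∀ k ∈ Finset.Ico n (2 * n),
      intensity d β (fastSet (v * σ ^ k) z (3 * (b : ℝ)⁻¹ ^ (k + i))) ≤
        ENNReal.ofReal (c * 4⁻¹ ^ i) := by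
    intro k _
    refine (intensity_fastSet_le hβ (by positivity) z (by positivity)).trans
      (ENNReal.ofReal_le_ofReal ?_)
    have h1 := scale_pow hσ0 hscale k
    have e : intensityConst d β * ((2 * (3 * (b : ℝ)⁻¹ ^ (k + i))) ^ (d - 1) *
        ((v * σ ^ k) ^ (1 - β) / (β - 1))) =
        c * ((σ ^ k) ^ (1 - β) * ((b : ℝ)⁻¹ ^ k) ^ (d - 1)) * ((b : ℝ)⁻¹ ^ i) ^ (d - 1) := by
      rw [hc, Real.mul_rpow hv.le (by positivity), pow_add, show (6 : ℝ) = 2 * 3 by norm_num]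
      ring
    rw [e, h1, mul_one]
    have hqi : (b : ℝ)⁻¹ ^ i ≤ 1 := pow_le_one₀ (by positivity) hq1
    have h2 : ((b : ℝ)⁻¹ ^ i) ^ (d - 1) ≤ 4⁻¹ ^ i := by
      calc ((b : ℝ)⁻¹ ^ i) ^ (d - 1) ≤ ((b : ℝ)⁻¹ ^ i) ^ 1 :=
            pow_le_pow_of_le_one (by positivity) hqi (by omega)
        _ = (b : ℝ)⁻¹ ^ i := pow_one _
        _ ≤ 4⁻¹ ^ i := by gcongr
    exact mul_le_mul_of_nonneg_left h2 (by positivity)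
  refine (measure_mono hsub).trans ((measure_biUnion_finset_le _ _).trans
    ((Finset.sum_le_card_nsmul _ _ _ hterm).trans ?_))
  rw [nsmul_eq_mul, ← ENNReal.ofReal_natCast, ← ENNReal.ofReal_mul (Nat.cast_nonneg _),
    Nat.card_Ico, show 2 * n - n = n by omega, mul_assoc (n : ℝ) c]

/-- The scales among `n, …, 2n - 1` at which more than `M` fast roads meet a ball around `z`. -/
noncomputable def crowdedScales (R : Set (Road d)) (b : ℕ) (σ v : ℝ) (z : E d) (n M : ℕ) :
    Finset ℕ :=
  open scoped Classical in (Finset.Ico n (2 * n)).filter fun k =>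
    (M : ℕ∞) < (fastRoads R (v * σ ^ k) z (3 * (b : ℝ)⁻¹ ^ k)).encard

/-- The Chernoff bound is exponential in `n` on both sides, namely (exp(4c)/2^(M+1))^n, so a large
`M` makes the base smaller than any given `ε`. -/
theorem measure_crowdedScales_le (hd : 2 ≤ d) {β : ℝ} (hβ : 1 < β) {b : ℕ} (hb : 4 ≤ b) {σ : ℝ}
    (hσ0 : 0 < σ) (hscale : σ ^ (1 - β) * (b : ℝ)⁻¹ ^ (d - 1) = 1) {v : ℝ} (hv : 0 < v) {ε : ℝ}
    (hε : 0 < ε) :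
    ∃ M : ℕ, 0 < M ∧ ∀ (Ω : Type*) [MeasurableSpace Ω] (P : Measure Ω) [IsProbabilityMeasure P]
      (S : Ω → Set (Road d)), IsPoissonProcess P (intensity d β) S → ∀ (z : E d) (n : ℕ),
      P {ω | n ≤ 2 * (crowdedScales (S ω) b σ v z n M).card} ≤ ENNReal.ofReal (ε ^ n) := by
  obtain ⟨c, hc, hocc⟩ := intensity_occupation_le hd hβ hb hσ0 hscale hv
  obtain ⟨M, hM⟩ := pow_unbounded_of_one_lt (Real.exp (4 * c) / ε) (one_lt_two)
  refine ⟨2 * (M + 1), by omega, fun Ω _ P _ S hS z n => ?_⟩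
  have hmain := hS.measure_crowded_le (M := M + 1) (Finset.Ico n (2 * n))
    (F := fun k => fastSet (v * σ ^ k) z (3 * (b : ℝ)⁻¹ ^ k))
    (fun k => measurableSet_fastSet _ _ (by positivity)) (n := n)
    (by rw [Nat.card_Ico]; omega) (fun i _ => hocc z n i) (by positivity)
  simp only [← fastRoads_eq] at hmain
  refine hmain.trans (ENNReal.ofReal_le_ofReal ?_)
  have e : Real.exp (4 * (n * c)) / 2 ^ ((M + 1) * n) = (Real.exp (4 * c) / 2 ^ (M + 1)) ^ n := by
    rw [div_pow, ← Real.exp_nat_mul, pow_mul]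
    congr 2
    ring
  rw [e]
  refine pow_le_pow_left₀ (by positivity) ?_ n
  rw [div_lt_iff₀ hε] at hM
  rw [div_le_iff₀ (by positivity), pow_succ]
  have : (0 : ℝ) < 2 ^ M := by positivity
  nlinarith

end FastRoads

/-! ### Every point has good scales -/

section GoodScales

variable {d : ℕ} [NeZero d]

/-- At scale `b^(-k)` around `z`, few fast roads are present and one can connect any two points. -/
def GoodScale (R : Set (Road d)) (b : ℕ) (σ a : ℝ) (M : ℕ) (z : E d) (k : ℕ) : Prop :=
  (∀ j, Connects R b σ a z k j) ∧
    (fastRoads R (a / 128 * σ ^ k) z (3 * (b : ℝ)⁻¹ ^ k)).encard ≤ M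

/-- With high probability fewer than half of the scales fail to connect and fewer than half are
crowded, so at least one is good. -/
theorem measure_forall_not_goodScale_le (hd : 2 ≤ d) {β : ℝ} (hβ : 2 ≤ β) {b : ℕ} (hb : 4 ≤ b)
    {σ : ℝ} (hσ0 : 0 < σ) (hσ : 2 * σ ≤ 1)
    (hscale : σ ^ (1 - β) * (b : ℝ)⁻¹ ^ (d - 1) = 1) {ε : ℝ} (hε : 0 < ε) (hε2 : ε ≤ 1 / 2) :
    ∃ (a : ℝ) (M : ℕ), 0 < a ∧ 0 < M ∧
      ∀ (Ω : Type*) [MeasurableSpace Ω] (P : Measure Ω) [IsProbabilityMeasure P]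
      (S : Ω → Set (Road d)), IsPoissonProcess P (intensity d β) S →
      ∀ (z : E d) (n : ℕ), 0 < n →
      P {ω | ∀ k ∈ Finset.Ico n (2 * n), ¬ GoodScale (S ω) b σ a M z k} ≤
        ENNReal.ofReal (3 * (2 * ε) ^ n) := by
  obtain ⟨a, ha, hA⟩ := measure_exists_badLevels_le hd hβ (by omega) hσ0 hσ hscale hε hε2
  obtain ⟨M, hM, hB⟩ := measure_crowdedScales_le hd (by linarith) hb hσ0 hscale
    (v := a / 128) (by positivity) hε
  refine ⟨a, M, ha, hM, fun Ω _ P _ S hS z n hn => ?_⟩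
  have hsub : {ω | ∀ k ∈ Finset.Ico n (2 * n), ¬ GoodScale (S ω) b σ a M z k} ⊆
      {ω | ∃ j, n ≤ (badLevels (S ω) b σ a z n j).card * 2 ^ (j + 2)} ∪
        {ω | n ≤ 2 * (crowdedScales (S ω) b σ (a / 128) z n M).card} := by
    classical
    intro ω hω
    by_contra hcon
    rw [mem_union, not_or, mem_ofPred_eq, mem_ofPred_eq] at hcon
    obtain ⟨h1, h2⟩ := hcon
    push Not at h1 h2
    have h3 := two_mul_card_lt_of_badLevels hn h1
    have h4 : Finset.Ico n (2 * n) ⊆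
        ((Finset.Ico n (2 * n)).filter fun k => ¬ ∀ j, Connects (S ω) b σ a z k j) ∪
          crowdedScales (S ω) b σ (a / 128) z n M := by
      intro k hk
      by_cases hconn : ∀ j, Connects (S ω) b σ a z k j
      · refine Finset.mem_union_right _ (Finset.mem_filter.2 ⟨hk, ?_⟩)
        by_contra hle
        exact hω k hk ⟨hconn, not_lt.1 hle⟩
      · exact Finset.mem_union_left _ (Finset.mem_filter.2 ⟨hk, hconn⟩)
    have h5 := (Finset.card_le_card h4).trans (Finset.card_union_le _ _)
    rw [Nat.card_Ico] at h5
    omega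
  refine (measure_mono hsub).trans ((measure_union_le _ _).trans ((add_le_add
    (hA Ω P S hS z n hn) (hB Ω P S hS z n)).trans ?_))
  rw [← ENNReal.ofReal_add (by positivity) (by positivity)]
  refine ENNReal.ofReal_le_ofReal ?_
  have : ε ^ n ≤ (2 * ε) ^ n := by gcongr; linarith
  linarith

theorem card_grid_le {d : ℕ} (hd : d ≠ 0) {b : ℕ} (hb : 0 < b) (N n : ℕ) :
    ((grid d (N * d * b ^ (2 * n) + 1)).card : ℝ) ≤
      (5 * (N + 1) * d : ℝ) ^ d * ((b : ℝ) ^ (2 * d)) ^ n := by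
  rw [card_grid]
  have h1 : 2 * (N * d * b ^ (2 * n) + 1) + 1 ≤ 5 * (N + 1) * d * b ^ (2 * n) := by
    have : 1 ≤ d * b ^ (2 * n) := Nat.one_le_iff_ne_zero.2 (by positivity)
    nlinarith
  have h2 := Nat.pow_le_pow_left h1 d
  have h3 : (5 * (N + 1) * d * b ^ (2 * n)) ^ d = (5 * (N + 1) * d) ^ d * (b ^ (2 * d)) ^ n := by
    rw [mul_pow, ← pow_mul, ← pow_mul]
    congr 2
    ring
  rw [h3] at h2
  exact_mod_cast h2

/-- Almost surely, at each point of a fine enough grid one of the scales `n, …, 2n - 1` is good. -/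
theorem ae_eventually_goodScale (hd : 2 ≤ d) {β : ℝ} (hβ : 2 ≤ β) {b : ℕ} (hb : 4 ≤ b)
    {σ : ℝ} (hσ0 : 0 < σ) (hσ : 2 * σ ≤ 1)
    (hscale : σ ^ (1 - β) * (b : ℝ)⁻¹ ^ (d - 1) = 1) :
    ∃ (a : ℝ) (M : ℕ), 0 < a ∧ 0 < M ∧
      ∀ (Ω : Type*) [MeasurableSpace Ω] (P : Measure Ω) [IsProbabilityMeasure P]
      (S : Ω → Set (Road d)), IsPoissonProcess P (intensity d β) S →
      ∀ᵐ ω ∂P, ∀ N : ℕ, ∀ᶠ n in atTop, ∀ m ∈ grid d (N * d * b ^ (2 * n) + 1),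
        ∃ k ∈ Finset.Ico n (2 * n),
          GoodScale (S ω) b σ a M (gridPt 0 ((b : ℝ)⁻¹ ^ (2 * n) / d) m) k := by
  have hb1 : (1 : ℝ) ≤ b := by exact_mod_cast (by omega : 1 ≤ b)
  have hB1 : (1 : ℝ) ≤ (b : ℝ) ^ (2 * d) := one_le_pow₀ hb1
  set B : ℝ := (b : ℝ) ^ (2 * d) with hB
  have hB0 : 0 < B := by linarith
  -- The value of `ε` is chosen so that B·2ε = 1/2, where B^n is the growth of the number of grid
  -- points.
  obtain ⟨a, M, ha, hM, hmain⟩ := measure_forall_not_goodScale_le hd hβ hb hσ0 hσ hscale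
    (ε := 1 / (4 * B)) (by positivity) (by
      rw [div_le_div_iff₀ (by positivity) (by norm_num)]
      linarith)
  refine ⟨a, M, ha, hM, fun Ω _ P _ S hS => ae_all_iff.2 fun N => ?_⟩
  set C : ℝ := (5 * (N + 1) * d : ℝ) ^ d * 3 with hC
  set s : ℕ → Set Ω := fun n => {ω | 0 < n ∧ ∃ m ∈ grid d (N * d * b ^ (2 * n) + 1),
    ∀ k ∈ Finset.Ico n (2 * n),
      ¬ GoodScale (S ω) b σ a M (gridPt 0 ((b : ℝ)⁻¹ ^ (2 * n) / d) m) k} with hs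
  have hle : ∀ n, P (s n) ≤ ENNReal.ofReal (C * (1 / 2) ^ n) := by
    intro n
    rcases Nat.eq_zero_or_pos n with rfl | hn
    · simp [hs]
    have hsub : s n ⊆ ⋃ m ∈ grid d (N * d * b ^ (2 * n) + 1), {ω | ∀ k ∈ Finset.Ico n (2 * n),
        ¬ GoodScale (S ω) b σ a M (gridPt 0 ((b : ℝ)⁻¹ ^ (2 * n) / d) m) k} := by
      rintro ω ⟨-, m, hm, hω⟩
      exact mem_iUnion₂.2 ⟨m, hm, hω⟩
    refine (measure_mono hsub).trans ((measure_biUnion_finset_le _ _).trans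
      ((Finset.sum_le_card_nsmul _ _ _ fun m _ => hmain Ω P S hS _ n hn).trans ?_))
    rw [nsmul_eq_mul, ← ENNReal.ofReal_natCast, ← ENNReal.ofReal_mul (Nat.cast_nonneg _)]
    refine ENNReal.ofReal_le_ofReal ?_
    calc ((grid d (N * d * b ^ (2 * n) + 1)).card : ℝ) * (3 * (2 * (1 / (4 * B))) ^ n)
        ≤ ((5 * (N + 1) * d : ℝ) ^ d * B ^ n) * (3 * (2 * (1 / (4 * B))) ^ n) := by
          gcongr
          exact card_grid_le (NeZero.ne d) (by omega) N n
      _ = C * (B * (2 * (1 / (4 * B)))) ^ n := by rw [mul_pow B]; ring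
      _ = C * (1 / 2) ^ n := by
          congr 2
          field_simp
          norm_num
  have hsum : ∑' n, P (s n) ≠ ∞ := by
    refine ((ENNReal.tsum_le_tsum hle).trans_lt ?_).ne
    rw [← ENNReal.ofReal_tsum_of_nonneg (fun n => by positivity)
      (summable_geometric_two.mul_left C)]
    exact ENNReal.ofReal_lt_top
  filter_upwards [ae_eventually_notMem hsum] with ω hω
  filter_upwards [hω, eventually_gt_atTop 0] with n hn hn0 m hm
  by_contra hcon
  push Not at hcon
  exact hn ⟨hn0, m, hm, hcon⟩

/-- A point with good scales around nearby grid points has small cut sets. -/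
theorem hasSmallCutSets_of_goodScale {R : Set (Road d)} (hR : IsLocallyFinite R) {b : ℕ}
    (hb : 4 ≤ b) {σ a : ℝ} (ha : 0 < a) (hσ0 : 0 < σ) (hσ1 : σ ≤ 1) (hσ : 16 * (b : ℝ)⁻¹ ≤ σ)
    {M : ℕ} (h : ∀ N : ℕ, ∀ᶠ n in atTop, ∀ m ∈ grid d (N * d * b ^ (2 * n) + 1),
        ∃ k ∈ Finset.Ico n (2 * n),
          GoodScale R b σ a M (gridPt 0 ((b : ℝ)⁻¹ ^ (2 * n) / d) m) k) (x : E d) :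
    HasSmallCutSets R (cutBound M) x := by
  have hb0 : (0 : ℝ) < b := by positivity
  have hb4 : (4 : ℝ) ≤ b := by exact_mod_cast hb
  have hd0 : (0 : ℝ) < d := by exact_mod_cast Nat.pos_of_ne_zero (NeZero.ne d)
  set q : ℝ := (b : ℝ)⁻¹ with hq
  have hq0 : 0 < q := inv_pos.2 hb0
  have hq4 : q ≤ 4⁻¹ := inv_anti₀ (by norm_num) hb4
  have hqσ : q / σ ≤ 1 / 16 := by
    rw [div_le_div_iff₀ hσ0 (by norm_num)]
    linarith
  obtain ⟨L, hL0, hL⟩ := hR.exists_bound x 1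
  obtain ⟨N, hN⟩ := exists_nat_ge (dist x 0)
  refine hasSmallCutSets hR fun δ hδ => ?_
  have hlim1 : Tendsto (fun k : ℕ => 2 * q ^ k) atTop (𝓝 0) := by
    simpa using (tendsto_pow_atTop_nhds_zero_of_lt_one hq0.le (by linarith)).const_mul 2
  have hlim2 : Tendsto (fun k : ℕ => 2 * q ^ k + (L + 1) * (32 / a * (q / σ) ^ k)) atTop (𝓝 0) := by
    have := (((tendsto_pow_atTop_nhds_zero_of_lt_one (by positivity : 0 ≤ q / σ)
      (by linarith)).const_mul (32 / a)).const_mul (L + 1))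
    simpa using hlim1.add this
  obtain ⟨n₀, hn₀⟩ := eventually_atTop.1
    ((hlim1.eventually_lt_const hδ).and (hlim2.eventually_lt_const one_pos))
  obtain ⟨n, hgood, hn⟩ := ((h N).and (eventually_ge_atTop n₀)).exists
  have hmesh : (N : ℝ) + q ^ (2 * n) / d ≤ (N * d * b ^ (2 * n) + 1 : ℕ) * (q ^ (2 * n) / d) := by
    push_cast
    rw [add_mul, one_mul]
    refine add_le_add (le_of_eq ?_) le_rfl
    rw [hq, inv_pow]
    field_simp
  -- The mesh is adapted to the scale q^(2n), finer than all the scales k < 2n in play, so `x` is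
  -- within q^k of the grid point `z` whichever scale is good.
  obtain ⟨m, hm, hmx⟩ := exists_gridPt_dist_le 0 x (by positivity : 0 < q ^ (2 * n) / d) hN hmesh
  rw [mul_div_cancel₀ _ hd0.ne'] at hmx
  obtain ⟨k, hk, hconn, hfast⟩ := hgood m hm
  set z : E d := gridPt 0 (q ^ (2 * n) / d) m
  obtain ⟨hnk, hk2⟩ := Finset.mem_Ico.1 hk
  obtain ⟨hkδ, hkL⟩ := hn₀ k (hn.trans hnk)
  have hqk : 0 < q ^ k := by positivity
  have hxz : dist x z ≤ q ^ k :=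
    hmx.trans (pow_le_pow_of_le_one hq0.le (by linarith) hk2.le)
  -- With r = q^k, the product of speed and duration is (a/128)(32/a)q^k = r/4, whence 128. The ball
  -- of radius 2r around `x` lies in that of radius 3r around `z`.
  refine ⟨q ^ k, a / 128 * σ ^ k, 32 / a * (q / σ) ^ k, hqk, hkδ.le, by positivity, ?_, ?_, ?_⟩
  · refine le_of_eq ?_
    rw [div_pow]
    field_simp
    norm_num
  · refine le_trans (encard_le_encard (fastRoads_mono le_rfl ?_)) hfast
    linarith
  · intro y hy y' hy'
    rw [Metric.mem_closedBall] at hy hy'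
    refine reach_of_connects hR (NeZero.ne d) hb ha hσ0 hσ1 hσ hconn ?_ ?_ ?_ hL0.le hL ?_
    · have := dist_triangle y x z
      linarith
    · have := dist_triangle y' x z
      linarith
    · have := dist_triangle_right y y' x
      linarith
    · linarith

/-- There are scale parameters suited to the exponents `d` and `β`. -/
theorem exists_scale {d : ℕ} (hd : 2 ≤ d) {β : ℝ} (hβ : (d : ℝ) < β) :
    ∃ (b : ℕ) (σ : ℝ), 4 ≤ b ∧ 0 < σ ∧ 2 * σ ≤ 1 ∧ 16 * (b : ℝ)⁻¹ ≤ σ ∧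
      σ ^ (1 - β) * (b : ℝ)⁻¹ ^ (d - 1) = 1 := by
  have hd2 : (2 : ℝ) ≤ d := by exact_mod_cast hd
  have hβ1 : 0 < β - 1 := by linarith
  -- With σ = b^(-α) scale invariance is exact. Since β > d means α < 1, the ratio (1/b)/σ =
  -- b^(-(1-α)) tends to 0 as `b` grows.
  set α : ℝ := (d - 1) / (β - 1) with hα
  have hα0 : 0 < α := div_pos (by linarith) hβ1
  have hα1 : α < 1 := (div_lt_one hβ1).2 (by linarith)
  have h1 : Tendsto (fun b : ℕ => (b : ℝ) ^ (-α)) atTop (𝓝 0) :=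
    (tendsto_rpow_neg_atTop hα0).comp tendsto_natCast_atTop_atTop
  have h2 : Tendsto (fun b : ℕ => (b : ℝ) ^ (-(1 - α))) atTop (𝓝 0) :=
    (tendsto_rpow_neg_atTop (sub_pos.2 hα1)).comp tendsto_natCast_atTop_atTop
  obtain ⟨b, ⟨hb1, hb2⟩, hb4⟩ := (((h1.eventually_lt_const (by norm_num : (0 : ℝ) < 1 / 2)).and
    (h2.eventually_lt_const (by norm_num : (0 : ℝ) < 1 / 16))).and (eventually_ge_atTop 4)).exists
  have hb0 : (0 : ℝ) < b := by positivity
  refine ⟨b, (b : ℝ) ^ (-α), hb4, by positivity, by linarith, ?_, ?_⟩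
  · have e : (b : ℝ)⁻¹ = (b : ℝ) ^ (-(1 - α)) * (b : ℝ) ^ (-α) := by
      rw [← Real.rpow_add hb0, ← Real.rpow_neg_one]
      congr 1
      ring
    rw [e]
    have : 0 < (b : ℝ) ^ (-α) := by positivity
    nlinarith
  · rw [← Real.rpow_mul hb0.le, ← Real.rpow_natCast, Real.inv_rpow hb0.le, ← Real.rpow_neg hb0.le,
      ← Real.rpow_add hb0, Nat.cast_sub (by omega)]
    have : -α * (1 - β) + -((d : ℝ) - (1 : ℕ)) = 0 := by
      rw [hα, Nat.cast_one]
      field_simp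
      ring
    rw [this, Real.rpow_zero]

end GoodScales

end PoissonRoads

theorem proposition2 (d : ℕ) [NeZero d] (hd : 2 ≤ d) (β : ℝ) (hβ : (d : ℝ) < β) :
    ∃ m : ℕ, 0 < m ∧
      ∀ (Ω : Type*) [MeasurableSpace Ω] (P : Measure Ω) [IsProbabilityMeasure P]
        (S : Ω → Set (PoissonRoads.Road d)),
        PoissonRoads.IsPoissonProcess P (PoissonRoads.intensity d β) S →
        ∀ᵐ ω ∂P,
          (∀ x : PoissonRoads.E d, PoissonRoads.HasSmallCutSets (S ω) m x) ∧
          ∀ x : PoissonRoads.E d, ¬ PoissonRoads.IsPlusStar (S ω) (m + 1) x := by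
  have hd2 : (2 : ℝ) ≤ d := by exact_mod_cast hd
  obtain ⟨b, σ, hb, hσ0, hσ2, hσ, hscale⟩ := PoissonRoads.exists_scale hd hβ
  obtain ⟨a, M, ha, hM, hgood⟩ :=
    PoissonRoads.ae_eventually_goodScale hd (by linarith) hb hσ0 hσ2 hscale
  refine ⟨PoissonRoads.cutBound M, Nat.mul_pos hM (Nat.succ_pos _), fun Ω _ P _ S hS => ?_⟩
  filter_upwards [PoissonRoads.ae_isLocallyFinite (by linarith) hS, hgood Ω P S hS] with ω hR hω
  have hcut : ∀ x, PoissonRoads.HasSmallCutSets (S ω) (PoissonRoads.cutBound M) x := fun x =>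
    PoissonRoads.hasSmallCutSets_of_goodScale hR hb ha hσ0 (by linarith) hσ hω x
  exact ⟨hcut, fun x => PoissonRoads.not_isPlusStar hR (hcut x)⟩
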